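/- Let $\Omega\subset\mathbb R^2$ be a smooth bounded domain whose boundary is a smooth simple closed curve $\Gamma$ of length $|\Gamma|$, let $|\Omega|$ be its area, and for $h>0$ let $\omega_h=\{x\in\Omega:\operatorname{dist}(x,\Gamma)<h\}$. For $\beta>0$ and a bounded open set $\omega$, let $\lambda_1(\omega,\beta)$ be the first eigenvalue of the magnetic Laplacian on $\omega$ with potential $A=\frac{\beta}{2}(-x_2\,dx_1+x_1\,dx_2)$ and magnetic Neumann boundary conditions, in its variational form $$\lambda_1(\omega,\beta)=\inf_{0\neq u\in H^1(\omega;\mathbb C)}\frac{\int_\omega|\nabla u-iuA|^2}{\int_\omega|u|^2}.$$ Then: (1) There is $\epsilon_0>0$, depending only on $\Omega$, such that for every $\beta>0$ with $\frac{\beta|\Omega|}{2\pi}\notin\mathbb N$ and every $h\in(0,\epsilon_0)$, $$\lambda_1(\omega_h,\beta)\ \ge\ \frac{4\pi^2}{|\Gamma|^2}\min_{n\in\mathbb Z}\Big(n-\frac{\beta|\Omega|}{2\pi}\Big)^2-\beta^{3/2}h .$$ Consequently, if $\frac{\beta|\Omega|}{2\pi}\notin\mathbb N$, then the area of $\omega_h$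 tends to $0$ as $h\to0^+$ (it does so for every $\Omega$), while $\lambda_1(\omega_h,\beta)\ge c$ for some $c>0$ and all sufficiently small $h>0$. (2) If $\beta>0$ and $\frac{\beta|\Omega|}{2\pi}\in\mathbb N$, then $\lambda_1(\omega_h,\beta)\to0$ as $h\to0^+$. In particular, for every $\beta>0$, $\lambda_1(\omega_h,\beta)\to0$ as $h\to0^+$ if and only if $\frac{\beta|\Omega|}{2\pi}\in\mathbb N$. -/

import Mathlib

open Set Filter Topology MeasureTheory
open scoped ContDiff

noncomputable section

/-- The Euclidean plane. -/
abbrev Plane : Type := EuclideanSpace ℝ (Fin 2)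

/-- The partial derivative `∂ⱼ φ`. -/
def partialDeriv (j : Fin 2) (φ : Plane → ℝ) (x : Plane) : ℝ :=
  fderiv ℝ φ x (EuclideanSpace.single j 1)

/-- `g` is the weak `j`-th partial derivative of `u` on the open set `W`:
`∫_W u ∂ⱼφ = - ∫_W g φ` for all `φ ∈ C_c^∞(W)`. -/
def IsWeakPartial (W : Set Plane) (j : Fin 2) (u g : Plane → ℂ) : Prop :=
  ∀ φ : Plane → ℝ, ContDiff ℝ ∞ φ → HasCompactSupport φ → tsupport φ ⊆ W →
    ∫ x in W, u x * (partialDeriv j φ x : ℂ) = - ∫ x in W, g x * (φ x : ℂ)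

/-- `u` belongs to the Sobolev space `H¹(W)` of complex valued functions, with weak
gradient `g = (g₀, g₁)`. -/
structure IsH1WithGradient (W : Set Plane) (u : Plane → ℂ) (g : Fin 2 → Plane → ℂ) : Prop where
  memLp : MemLp u 2 (volume.restrict W)
  gradient_memLp : ∀ j, MemLp (g j) 2 (volume.restrict W)
  weakPartial : ∀ j, IsWeakPartial W j u (g j)

/-- The components of the standard potential `A = (β / 2) (-x₂ dx₁ + x₁ dx₂)`
(the coordinates `x₁, x₂` are `x 0, x 1`). -/
def standardPotential (β : ℝ) (x : Plane) : Fin 2 → ℝ :=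
  ![-(β / 2) * x 1, (β / 2) * x 0]

/-- The magnetic energy `∫_W |∇^A u|²`, where `∇^A u = ∇u - i u A` and `g` is the weak
gradient of `u`. -/
def magneticEnergy (W : Set Plane) (β : ℝ) (u : Plane → ℂ) (g : Fin 2 → Plane → ℂ) : ℝ :=
  ∫ x in W, ∑ j, ‖g j x - Complex.I * u x * (standardPotential β x j : ℂ)‖ ^ 2

/-- The squared norm `∫_W |u|²`. -/
def sqNormL2 (W : Set Plane) (u : Plane → ℂ) : ℝ :=
  ∫ x in W, ‖u x‖ ^ 2

/-- The set of Rayleigh quotients `∫_W |∇^A u|² / ∫_W |u|²`, `0 ≠ u ∈ H¹(W)`. -/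
def rayleighQuotients (W : Set Plane) (β : ℝ) : Set ℝ :=
  {q | ∃ (u : Plane → ℂ) (g : Fin 2 → Plane → ℂ), IsH1WithGradient W u g ∧
    0 < sqNormL2 W u ∧ q = magneticEnergy W β u g / sqNormL2 W u}

/-- The first eigenvalue `λ₁(W, β)` of the magnetic Laplacian with standard potential and
magnetic Neumann conditions, in its variational form: the lowest value of the Rayleigh
quotient over `H¹(W)`. -/
def magneticLambda1 (W : Set Plane) (β : ℝ) : ℝ :=
  sInf (rayleighQuotients W β)

/-- A smooth bounded domain of the plane: open, connected, bounded, and locally near each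
boundary point the sublevel set `{ρ < 0}` of a smooth function with `dρ ≠ 0`. -/
structure IsSmoothBoundedDomain (Ω : Set Plane) : Prop where
  isOpen : IsOpen Ω
  isConnected : IsConnected Ω
  isBounded : Bornology.IsBounded Ω
  smooth_boundary : ∀ p ∈ frontier Ω, ∃ ρ : Plane → ℝ, ContDiff ℝ ∞ ρ ∧
    fderiv ℝ ρ p ≠ 0 ∧ ∀ᶠ x in 𝓝 p, (x ∈ Ω ↔ ρ x < 0)

/-- `γ` is a smooth regular parametrization, with period `1`, of a simple closed curve. -/
structure IsSimpleClosedCurve (γ : ℝ → Plane) : Prop where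
  smooth : ContDiff ℝ ∞ γ
  regular : ∀ t, deriv γ t ≠ 0
  periodic : Function.Periodic γ 1
  injOn : InjOn γ (Ico 0 1)

/-- The length of the closed curve parametrized by `γ`. -/
def curveLength (γ : ℝ → Plane) : ℝ :=
  ∫ t in (0 : ℝ)..1, ‖deriv γ t‖

/-- The inner tubular neighbourhood `ω_h = {x ∈ Ω : dist(x, ∂Ω) < h}`. -/
def innerTube (Ω : Set Plane) (h : ℝ) : Set Plane :=
  {x | x ∈ Ω ∧ Metric.infDist x (frontier Ω) < h}

/-- The flux `β |Ω| / 2π`. -/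
def magneticFlux (Ω : Set Plane) (β : ℝ) : ℝ :=
  β * volume.real Ω / (2 * Real.pi)

end

open scoped ComplexConjugate

noncomputable section

/-! ### Smooth functions of one real variable -/

/-! Parametrize Γ by arclength as `z`, with Ω on its left, and write points of the tube as x = z(s)
+ r i z'(s); the area element is J ds dr with J = 1 - r κ(s). Dropping the normal part of |∇^A u|²
leaves, for each r in (0, h), a one-dimensional magnetic operator on the closed parallel curve at
distance r. That curve has length Λ(r) = L - rK, where K is the total curvature, and the circulation
of A along it is F(r) = (β/2)(2|Ω| - 2rL + r²K). The operator is diagonalized by explicit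
exponentials with frequencies (2πn - F(r))/Λ(r), so λ₁ is at least any common lower bound of their
squares (`TubeWidth.mul_sqNormL2_le_magneticEnergy`).

Since u is only in H¹, the diagonalization is done weakly. Testing with χ(r) times the conjugate of
an eigenfunction shows that, for almost every r, the Fourier coefficients of the tangential
derivative are those of u times the frequencies (`TubeWidth.ae_fiber_modeDensity`). Parseval in the
arclength of the parallel curve concludes (`weighted_norm_le_of_coeff_le`).

Let d be the distance from the flux Φ = β|Ω|/2π to the integers. Three geometric facts turn the
frequencies into the stated bound. The area formula (`TubeWidth.sweep_eq`) identifies F(0) with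
β|Ω|. The inequality K ≥ 0, by Hopf's secant argument (`BoundaryCurve.turning_nonneg`), gives Λ ≤ L
and |F(r) - β|Ω|| ≤ βrL. Thus the squared frequency loses at most 4πdβr/L, and the isoperimetric
inequality (`TubeWidth.isoperimetric`) yields 4πd ≤ √β L, so the loss is at most β^{3/2} h
(`frequency_sq_ge`).

For integral flux, A agrees on the tube up to O(βh) with the gradient of a phase whose increment
around Γ is β|Ω|, a multiple of 2π. The exponential of this phase is an admissible test function and
gives λ₁ = O(β²h²) (`TubeWidth.magneticLambda1_le`). -/

theorem contDiff_infty_of_hasDerivAt {E : Type*} [NormedAddCommGroup E] [NormedSpace ℝ E]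
    {f f' : ℝ → E} (h : ∀ t, HasDerivAt f (f' t) t) (h' : ContDiff ℝ ∞ f') : ContDiff ℝ ∞ f := by
  rw [contDiff_infty_iff_deriv]
  refine ⟨fun t => (h t).differentiableAt, ?_⟩
  have : deriv f = f' := funext fun t => (h t).deriv
  rwa [this]

theorem hasDerivAt_primitive {f : ℝ → ℝ} (hf : Continuous f) (s : ℝ) :
    HasDerivAt (fun s => ∫ t in (0 : ℝ)..s, f t) (f s) s :=
  intervalIntegral.integral_hasDerivAt_right (hf.intervalIntegrable _ _)
    (hf.stronglyMeasurableAtFilter _ _) hf.continuousAt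

theorem contDiff_primitive {f : ℝ → ℝ} (hf : ContDiff ℝ ∞ f) :
    ContDiff ℝ ∞ (fun s => ∫ t in (0 : ℝ)..s, f t) :=
  contDiff_infty_of_hasDerivAt (hasDerivAt_primitive hf.continuous) hf

theorem primitive_add_period {f : ℝ → ℝ} (hf : Continuous f) {L : ℝ}
    (hL : Function.Periodic f L) (s : ℝ) :
    (∫ t in (0 : ℝ)..(s + L), f t) = (∫ t in (0 : ℝ)..s, f t) + ∫ t in (0 : ℝ)..L, f t := by
  rw [← intervalIntegral.integral_add_adjacent_intervals (hf.intervalIntegrable 0 s)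
    (hf.intervalIntegrable s (s + L)), hL.intervalIntegral_add_eq s 0, zero_add]

theorem Function.Periodic.exists_norm_le {E : Type*} [NormedAddCommGroup E] {f : ℝ → E}
    {L : ℝ} (hL : Function.Periodic f L) (hL0 : 0 < L) (hf : Continuous f) :
    ∃ M, 0 ≤ M ∧ ∀ s, ‖f s‖ ≤ M := by
  obtain ⟨M, hM⟩ := isCompact_Icc.exists_bound_of_continuousOn (s := Icc 0 L) hf.continuousOn
  refine ⟨M, (norm_nonneg _).trans (hM 0 ⟨le_rfl, hL0.le⟩), fun s => ?_⟩
  obtain ⟨y, hy, hys⟩ := hL.exists_mem_Ico₀ hL0 s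
  rw [hys]
  exact hM y ⟨hy.1, hy.2.le⟩

theorem Function.Periodic.deriv {E : Type*} [NormedAddCommGroup E] [NormedSpace ℝ E]
    {f : ℝ → E} {L : ℝ} (hL : Function.Periodic f L) : Function.Periodic (deriv f) L := by
  intro s
  rw [← deriv_comp_add_const f L s]
  congr 1
  exact funext hL

/-! ### Closed curves parametrized by arclength -/

/-- `z` parametrizes by arclength a smooth simple closed curve of length `L`. -/
structure ArcCurve (L : ℝ) (z : ℝ → ℂ) : Prop where
  pos : 0 < L
  smooth : ContDiff ℝ ∞ z
  unit : ∀ s, ‖deriv z s‖ = 1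
  periodic : Function.Periodic z L
  inj : ∀ s t, z s = z t → ∃ n : ℤ, t = s + n * L

/-- The signed curvature of a curve with unit speed. -/
def curvature (z : ℝ → ℂ) (s : ℝ) : ℝ := (conj (deriv z s) * deriv (deriv z) s).im

/-- The tangential component of the position vector. -/
def tangentialPart (z : ℝ → ℂ) (s : ℝ) : ℝ := (conj (z s) * deriv z s).re

/-- Twice the rate at which the position vector sweeps area. -/
def sweepRate (z : ℝ → ℂ) (s : ℝ) : ℝ := (conj (z s) * deriv z s).im

/-- The angle by which the tangent turns along `[0, s]`. -/
def turning (z : ℝ → ℂ) (s : ℝ) : ℝ := ∫ t in (0 : ℝ)..s, curvature z t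

/-- Twice the signed area swept by the position vector along `[0, s]`. -/
def sweep (z : ℝ → ℂ) (s : ℝ) : ℝ := ∫ t in (0 : ℝ)..s, sweepRate z t

namespace ArcCurve

variable {L : ℝ} {z : ℝ → ℂ}

theorem contDiff_deriv (hz : ArcCurve L z) : ContDiff ℝ ∞ (deriv z) :=
  (contDiff_infty_iff_deriv.1 hz.smooth).2

theorem contDiff_deriv_deriv (hz : ArcCurve L z) : ContDiff ℝ ∞ (deriv (deriv z)) :=
  (contDiff_infty_iff_deriv.1 hz.contDiff_deriv).2

theorem hasDerivAt (hz : ArcCurve L z) (s : ℝ) : HasDerivAt z (deriv z s) s :=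
  ((contDiff_infty_iff_deriv.1 hz.smooth).1 s).hasDerivAt

theorem conj_mul_self (hz : ArcCurve L z) (s : ℝ) : conj (deriv z s) * deriv z s = 1 := by
  rw [mul_comm, Complex.mul_conj, Complex.normSq_eq_norm_sq, hz.unit]; simp

theorem deriv_ne_zero (hz : ArcCurve L z) (s : ℝ) : deriv z s ≠ 0 := by
  intro h
  have := hz.unit s
  simp [h] at this

theorem contDiff_conj {f : ℝ → ℂ} (hf : ContDiff ℝ ∞ f) : ContDiff ℝ ∞ (fun s => conj (f s)) :=
  Complex.conjCLE.contDiff.comp hf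

theorem hasDerivAt_conj {f : ℝ → ℂ} {f' : ℂ} {s : ℝ} (hf : HasDerivAt f f' s) :
    HasDerivAt (fun s => conj (f s)) (conj f') s :=
  (Complex.conjCLE.toContinuousLinearMap.hasFDerivAt.comp_hasDerivAt s hf)

theorem hasDerivAt_re {f : ℝ → ℂ} {f' : ℂ} {s : ℝ} (hf : HasDerivAt f f' s) :
    HasDerivAt (fun s => (f s).re) f'.re s :=
  (Complex.reCLM.hasFDerivAt.comp_hasDerivAt s hf)

theorem hasDerivAt_im {f : ℝ → ℂ} {f' : ℂ} {s : ℝ} (hf : HasDerivAt f f' s) :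
    HasDerivAt (fun s => (f s).im) f'.im s :=
  (Complex.imCLM.hasFDerivAt.comp_hasDerivAt s hf)

theorem contDiff_curvature (hz : ArcCurve L z) : ContDiff ℝ ∞ (curvature z) :=
  Complex.imCLM.contDiff.comp ((contDiff_conj hz.contDiff_deriv).mul hz.contDiff_deriv_deriv)

theorem contDiff_tangentialPart (hz : ArcCurve L z) : ContDiff ℝ ∞ (tangentialPart z) :=
  Complex.reCLM.contDiff.comp ((contDiff_conj hz.smooth).mul hz.contDiff_deriv)

theorem contDiff_sweepRate (hz : ArcCurve L z) : ContDiff ℝ ∞ (sweepRate z) :=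
  Complex.imCLM.contDiff.comp ((contDiff_conj hz.smooth).mul hz.contDiff_deriv)

theorem contDiff_turning (hz : ArcCurve L z) : ContDiff ℝ ∞ (turning z) :=
  contDiff_primitive hz.contDiff_curvature

theorem contDiff_sweep (hz : ArcCurve L z) : ContDiff ℝ ∞ (sweep z) :=
  contDiff_primitive hz.contDiff_sweepRate

theorem hasDerivAt_turning (hz : ArcCurve L z) (s : ℝ) :
    HasDerivAt (turning z) (curvature z s) s :=
  hasDerivAt_primitive hz.contDiff_curvature.continuous s

theorem hasDerivAt_sweep (hz : ArcCurve L z) (s : ℝ) :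
    HasDerivAt (sweep z) (sweepRate z s) s :=
  hasDerivAt_primitive hz.contDiff_sweepRate.continuous s

theorem periodic_deriv (hz : ArcCurve L z) : Function.Periodic (deriv z) L := hz.periodic.deriv

theorem periodic_curvature (hz : ArcCurve L z) : Function.Periodic (curvature z) L := fun s => by
  simp only [curvature, hz.periodic_deriv s, hz.periodic_deriv.deriv s]

theorem periodic_tangentialPart (hz : ArcCurve L z) : Function.Periodic (tangentialPart z) L :=
  fun s => by simp only [tangentialPart, hz.periodic_deriv s, hz.periodic s]

theorem periodic_sweepRate (hz : ArcCurve L z) : Function.Periodic (sweepRate z) L :=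
  fun s => by simp only [sweepRate, hz.periodic_deriv s, hz.periodic s]

theorem turning_add (hz : ArcCurve L z) (s : ℝ) : turning z (s + L) = turning z s + turning z L :=
  primitive_add_period hz.contDiff_curvature.continuous hz.periodic_curvature s

theorem sweep_add (hz : ArcCurve L z) (s : ℝ) : sweep z (s + L) = sweep z s + sweep z L :=
  primitive_add_period hz.contDiff_sweepRate.continuous hz.periodic_sweepRate s

theorem turning_zero (z : ℝ → ℂ) : turning z 0 = 0 := by simp [turning]

/-- The Frenet equation. -/
theorem hasDerivAt_deriv (hz : ArcCurve L z) (s : ℝ) :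
    HasDerivAt (deriv z) (curvature z s * Complex.I * deriv z s) s := by
  have h1 : HasDerivAt (deriv z) (deriv (deriv z) s) s :=
    ((contDiff_infty_iff_deriv.1 hz.contDiff_deriv).1 s).hasDerivAt
  have h2 := (hasDerivAt_conj h1).mul h1
  have h3 : (fun s => conj (deriv z s)) * deriv z = fun _ => (1 : ℂ) := funext hz.conj_mul_self
  rw [h3] at h2
  have h4 := h2.unique (hasDerivAt_const s (1 : ℂ))
  have h5 : conj (deriv z s) * deriv (deriv z) s = curvature z s * Complex.I := by
    apply Complex.ext
    · have := congrArg Complex.re h4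
      simp at this ⊢
      linarith
    · simp [curvature]
  convert h1 using 1
  rw [← h5, mul_right_comm, hz.conj_mul_self, one_mul]

/-- By the Frenet equation the derivative is |z'|² plus the real part of κ i conj(z) z'. It supplies
a primitive of the term κ · `sweepRate`, which is what allows the potential to be integrated in
closed form along the parallel curves. -/
theorem hasDerivAt_tangentialPart (hz : ArcCurve L z) (s : ℝ) :
    HasDerivAt (tangentialPart z) (1 - curvature z s * sweepRate z s) s := by
  have h : HasDerivAt (tangentialPart z) _ s := hasDerivAt_re ((hasDerivAt_conj (hz.hasDerivAt s)).mul (hz.hasDerivAt_deriv s))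
  convert h using 1
  rw [hz.conj_mul_self]
  simp [sweepRate]
  ring

end ArcCurve

/-! ### Arclength parametrization -/

theorem exists_int_of_injOn_Ico {E : Type*} {c : ℝ → E} {p : ℝ} (hp : 0 < p)
    (hper : Function.Periodic c p) (hinj : InjOn c (Ico 0 p)) {s t : ℝ} (h : c s = c t) :
    ∃ n : ℤ, t = s + n * p := by
  have hs := toIcoMod_mem_Ico' hp s
  have ht := toIcoMod_mem_Ico' hp t
  have es : c (toIcoMod hp 0 s) = c s := by
    rw [toIcoMod]; exact hper.sub_zsmul_eq _
  have et : c (toIcoMod hp 0 t) = c t := by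
    rw [toIcoMod]; exact hper.sub_zsmul_eq _
  have key := hinj hs ht (by rw [es, et, h])
  refine ⟨toIcoDiv hp 0 t - toIcoDiv hp 0 s, ?_⟩
  have h1 := toIcoMod_add_toIcoDiv_zsmul hp 0 s
  have h2 := toIcoMod_add_toIcoDiv_zsmul hp 0 t
  simp only [zsmul_eq_mul] at h1 h2
  push_cast
  linarith

/-- Compose with the inverse of the arclength function ℓ. The relation ℓ(s + 1) = ℓ(s) + L gives
ℓ(n) = nL at the integers, hence surjectivity of ℓ, and it also turns period 1 into period L. -/
theorem exists_arcCurve {c : ℝ → ℂ} (hc : ContDiff ℝ ∞ c) (hreg : ∀ t, deriv c t ≠ 0)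
    (hper : Function.Periodic c 1) (hinj : InjOn c (Ico 0 1)) :
    ∃ z, ArcCurve (∫ t in (0 : ℝ)..1, ‖deriv c t‖) z ∧ range z = range c := by
  have hc' : ContDiff ℝ ∞ (deriv c) := (contDiff_infty_iff_deriv.1 hc).2
  have hv : ContDiff ℝ ∞ (fun t => ‖deriv c t‖) := hc'.norm ℝ hreg
  have hvper : Function.Periodic (fun t => ‖deriv c t‖) 1 := fun t => by
    simp only [hper.deriv t]
  set L := ∫ t in (0 : ℝ)..1, ‖deriv c t‖ with hL
  set ℓ : ℝ → ℝ := fun s => ∫ t in (0 : ℝ)..s, ‖deriv c t‖ with hℓ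
  have hℓd : ∀ s, HasDerivAt ℓ (‖deriv c s‖) s := hasDerivAt_primitive hv.continuous
  have hmono : StrictMono ℓ := strictMono_of_deriv_pos fun s => by
    rw [(hℓd s).deriv]; exact norm_pos_iff.2 (hreg s)
  have hℓsm : ContDiff ℝ ∞ ℓ := contDiff_primitive hv
  have hℓadd : ∀ s, ℓ (s + 1) = ℓ s + L := primitive_add_period hv.continuous hvper
  have hL0 : 0 < L := by
    have := hmono one_pos
    simpa [hℓ] using this
  have hℓn : ∀ (n : ℕ), ℓ n = n * L := by
    intro n
    induction n with
    | zero => simp [hℓ]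
    | succ n ih => push_cast; rw [hℓadd, ih]; ring
  have hℓneg : ∀ (n : ℕ), ℓ (-n) = -(n * L) := by
    intro n
    induction n with
    | zero => simp [hℓ]
    | succ n ih =>
      have := hℓadd (-((n + 1 : ℕ) : ℝ))
      have e : (-((n + 1 : ℕ) : ℝ)) + 1 = -n := by push_cast; ring
      rw [e, ih] at this
      push_cast at this ⊢
      linarith
  have htop : Tendsto ℓ atTop atTop := by
    refine hmono.monotone.tendsto_atTop_atTop fun b => ?_
    obtain ⟨n, hn⟩ := exists_nat_ge (b / L)
    exact ⟨n, by rw [hℓn]; rwa [div_le_iff₀ hL0] at hn⟩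
  have hbot : Tendsto ℓ atBot atBot := by
    refine hmono.monotone.tendsto_atBot_atBot fun b => ?_
    obtain ⟨n, hn⟩ := exists_nat_ge (-b / L)
    exact ⟨-n, by rw [hℓneg]; rw [div_le_iff₀ hL0] at hn; linarith⟩
  have hsurj : Function.Surjective ℓ := hℓsm.continuous.surjective htop hbot
  set e : ℝ ≃ₜ ℝ := (hmono.orderIsoOfSurjective ℓ hsurj).toHomeomorph with he
  have hee : ∀ s, e s = ℓ s := fun s => rfl
  have hes : ContDiff ℝ ∞ e.symm :=
    e.contDiff_symm_deriv (f' := fun s => ‖deriv c s‖) (fun s => norm_ne_zero_iff.2 (hreg s))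
      hℓd hℓsm
  have hesd : ∀ y, HasDerivAt e.symm (‖deriv c (e.symm y)‖)⁻¹ y := fun y =>
    (hℓd (e.symm y)).of_local_left_inverse e.symm.continuous.continuousAt
      (norm_ne_zero_iff.2 (hreg _)) (Eventually.of_forall fun y => e.apply_symm_apply y)
  have hzd : ∀ y, HasDerivAt (fun y => c (e.symm y))
      ((‖deriv c (e.symm y)‖)⁻¹ • deriv c (e.symm y)) y := fun y =>
    HasDerivAt.scomp y (((contDiff_infty_iff_deriv.1 hc).1 _).hasDerivAt) (hesd y)
  have hsadd : ∀ y, e.symm (y + L) = e.symm y + 1 := fun y => by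
    rw [Homeomorph.symm_apply_eq, hee, hℓadd, ← hee, e.apply_symm_apply]
  refine ⟨fun y => c (e.symm y), ⟨hL0, hc.comp hes, fun y => ?_, fun y => ?_, fun s t h => ?_⟩, ?_⟩
  · rw [(hzd y).deriv, norm_smul, norm_inv, norm_norm, inv_mul_cancel₀]
    exact norm_ne_zero_iff.2 (hreg _)
  · simp only [hsadd, hper _]
  · obtain ⟨n, hn⟩ := exists_int_of_injOn_Ico one_pos hper hinj h
    refine ⟨n, ?_⟩
    have hnat : ∀ (n : ℕ) y, e.symm (y + n * L) = e.symm y + n := by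
      intro n y
      induction n with
      | zero => simp
      | succ n ih =>
        have : y + ((n + 1 : ℕ) : ℝ) * L = (y + n * L) + L := by push_cast; ring
        rw [this, hsadd, ih]; push_cast; ring
    apply e.symm.injective
    rw [hn]
    obtain ⟨m, rfl | rfl⟩ := n.eq_nat_or_neg
    · simp [hnat]
    · have := hnat m (s + ((-(m : ℤ) : ℤ) : ℝ) * L)
      have e2 : s + ((-(m : ℤ) : ℤ) : ℝ) * L + m * L = s := by push_cast; ring
      rw [e2] at this
      rw [this]; push_cast; ring
  · exact (e.symm.surjective.range_comp c)

/-! ### The boundary of a smooth domain -/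

/-- The identification of the complex plane with the Euclidean plane. -/
def toPlane : ℂ ≃ₗᵢ[ℝ] Plane := Complex.orthonormalBasisOneI.repr

theorem toPlane_zero (w : ℂ) : toPlane w 0 = w.re := by
  simp [toPlane]

theorem toPlane_one (w : ℂ) : toPlane w 1 = w.im := by
  simp [toPlane]

/-- `z` parametrizes by arclength the boundary of the bounded open set `Ω`, which lies to the left
of the curve. -/
structure BoundaryCurve (Ω : Set Plane) (L : ℝ) (z : ℝ → ℂ) : Prop extends ArcCurve L z where
  isOpen : IsOpen Ω
  isBounded : Bornology.IsBounded Ω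
  frontier_eq : frontier Ω = range fun s => toPlane (z s)
  inward : ∀ s, ∀ᶠ r : ℝ in 𝓝[>] 0, toPlane (z s + r * (Complex.I * deriv z s)) ∈ Ω
  outward : ∀ s, ∀ᶠ r : ℝ in 𝓝[>] 0, toPlane (z s - r * (Complex.I * deriv z s)) ∉ Ω

theorem ArcCurve.reverse {L : ℝ} {z : ℝ → ℂ} (hz : ArcCurve L z) :
    ArcCurve L (fun s => z (-s)) where
  pos := hz.pos
  smooth := hz.smooth.comp contDiff_neg
  unit s := by rw [deriv_comp_neg, norm_neg, hz.unit]
  periodic s := by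
    have := hz.periodic (-s - L)
    rw [sub_add_cancel] at this
    simp only
    rw [this]; congr 1; ring
  inj s t h := by
    obtain ⟨n, hn⟩ := hz.inj _ _ h
    exact ⟨-n, by push_cast; linarith⟩

theorem eventually_neg_of_hasDerivAt_neg {f : ℝ → ℝ} {f' : ℝ} (hf : HasDerivAt f f' 0)
    (h0 : f 0 = 0) (h' : f' < 0) : ∀ᶠ r in 𝓝[>] 0, f r < 0 := by
  have h := (hasDerivAt_iff_tendsto_slope.1 hf).mono_left (nhdsGT_le_nhdsNE 0)
  filter_upwards [h.eventually_lt_const h', self_mem_nhdsWithin] with r hr hr0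
  simp only [slope, h0, sub_zero, vsub_eq_sub, smul_eq_mul] at hr
  have : 0 < r⁻¹ := inv_pos.2 hr0
  by_contra hcon
  push Not at hcon
  exact absurd (mul_nonneg this.le hcon) (not_le.2 hr)

/-- A local defining function vanishes along the curve, so its differential kills the tangent; being
nonzero, it does not kill the normal. The sign of its normal derivative is constant near s₀ by
continuity and decides which side lies in Ω. -/
theorem forall_side_of_smooth_boundary {Ω : Set Plane} {L : ℝ} {z : ℝ → ℂ} (hz : ArcCurve L z)
    (hΩ : IsSmoothBoundedDomain Ω) (hfr : frontier Ω = range fun s => toPlane (z s)) (s₀ : ℝ) :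
    (∀ᶠ s in 𝓝 s₀, (∀ᶠ r : ℝ in 𝓝[>] 0, toPlane (z s + r * (Complex.I * deriv z s)) ∈ Ω) ∧
      ∀ᶠ r : ℝ in 𝓝[>] 0, toPlane (z s - r * (Complex.I * deriv z s)) ∉ Ω) ∨
    (∀ᶠ s in 𝓝 s₀, (∀ᶠ r : ℝ in 𝓝[>] 0, toPlane (z s - r * (Complex.I * deriv z s)) ∈ Ω) ∧
      ∀ᶠ r : ℝ in 𝓝[>] 0, toPlane (z s + r * (Complex.I * deriv z s)) ∉ Ω) := by
  obtain ⟨ρ, hρ, hdρ, hev⟩ := hΩ.smooth_boundary (toPlane (z s₀)) (hfr ▸ mem_range_self s₀)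
  set σ : ℂ → ℝ := fun w => ρ (toPlane w) with hσ
  have hσs : ContDiff ℝ ∞ σ := hρ.comp toPlane.contDiff
  have hσd : ∀ w, HasFDerivAt σ (fderiv ℝ σ w) w := fun w =>
    (hσs.differentiable (by simp) w).hasFDerivAt
  have hev' : ∀ᶠ w in 𝓝 (z s₀), (toPlane w ∈ Ω ↔ σ w < 0) :=
    (toPlane.continuous.tendsto (z s₀)).eventually hev
  have hzc : Continuous z := hz.smooth.continuous
  have hevs : ∀ᶠ s in 𝓝 s₀, ∀ᶠ w in 𝓝 (z s), (toPlane w ∈ Ω ↔ σ w < 0) :=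
    (hzc.tendsto s₀).eventually hev'.eventually_nhds
  -- A frontier point is not in the open set Ω, so σ ≥ 0 there; if σ > 0, a whole neighbourhood
  -- would miss Ω, contradicting membership in the closure.
  have hzero : ∀ᶠ s in 𝓝 s₀, σ (z s) = 0 := by
    filter_upwards [hevs] with s hs
    have hmem : toPlane (z s) ∈ frontier Ω := hfr ▸ mem_range_self s
    have h1 : toPlane (z s) ∉ Ω := fun h => by
      rw [hΩ.isOpen.frontier_eq] at hmem
      exact hmem.2 h
    have h2 : 0 ≤ σ (z s) := not_lt.1 fun h => h1 (hs.self_of_nhds.2 h)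
    refine le_antisymm (not_lt.1 fun h3 => ?_) h2
    have h4 : ∀ᶠ w in 𝓝 (z s), toPlane w ∉ Ω := by
      filter_upwards [hs, (hσs.continuous.tendsto (z s)).eventually_const_lt h3] with w hw hw'
      rw [hw]; exact not_lt.2 hw'.le
    have h5 : ∀ᶠ x in 𝓝 (toPlane (z s)), x ∉ Ω := by
      have := (toPlane.symm.continuous.tendsto (toPlane (z s)))
      rw [toPlane.symm_apply_apply] at this
      filter_upwards [this.eventually h4] with x hx
      simpa using hx
    exact (mem_closure_iff_frequently.1 (frontier_subset_closure hmem)) h5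
  have htan : fderiv ℝ σ (z s₀) (deriv z s₀) = 0 := by
    have h1 := (hσd (z s₀)).comp_hasDerivAt s₀ (hz.hasDerivAt s₀)
    have h2 : HasDerivAt (σ ∘ z) 0 s₀ :=
      (hasDerivAt_const s₀ (0 : ℝ)).congr_of_eventuallyEq hzero
    exact h1.unique h2
  have hnor : fderiv ℝ σ (z s₀) (Complex.I * deriv z s₀) ≠ 0 := by
    intro hn
    apply hdρ
    have hchain : fderiv ℝ σ (z s₀) =
        (fderiv ℝ ρ (toPlane (z s₀))).comp (toPlane.toContinuousLinearEquiv : ℂ →L[ℝ] Plane) :=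
      (((hρ.differentiable (by simp) (toPlane (z s₀))).hasFDerivAt).comp (z s₀)
        (toPlane.toContinuousLinearEquiv : ℂ →L[ℝ] Plane).hasFDerivAt).fderiv
    have hall : ∀ w, fderiv ℝ σ (z s₀) w = 0 := by
      intro w
      have hw : w = (w * conj (deriv z s₀)).re • deriv z s₀ +
          (w * conj (deriv z s₀)).im • (Complex.I * deriv z s₀) := by
        have h1 := Complex.re_add_im (w * conj (deriv z s₀))
        have h2 := hz.conj_mul_self s₀
        simp only [Complex.real_smul]
        calc w = w * conj (deriv z s₀) * deriv z s₀ := by rw [mul_assoc, h2, mul_one]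
          _ = _ := by rw [← h1]; simp only [Complex.re_add_im]; linear_combination -(h1 * deriv z s₀)
      rw [hw, map_add, map_smul, map_smul, htan, hn]; simp
    ext x
    have := hall (toPlane.symm x)
    rw [hchain] at this
    simpa using this
  have hcont : Continuous fun s => fderiv ℝ σ (z s) (Complex.I * deriv z s) := by
    have h1 : Continuous fun s => fderiv ℝ σ (z s) :=
      (hσs.continuous_fderiv (by simp)).comp hzc
    exact h1.clm_apply (continuous_const.mul hz.contDiff_deriv.continuous)
  have hline : ∀ s (v : ℂ), HasDerivAt (fun r : ℝ => σ (z s + r * v)) (fderiv ℝ σ (z s) v) 0 := by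
    intro s v
    have h1 : HasDerivAt (fun r : ℝ => z s + r * v) v 0 := by
      simpa using ((Complex.ofRealCLM.hasDerivAt (x := (0 : ℝ))).mul_const v).const_add (z s)
    have h2 := hσd (z s + ((0 : ℝ) : ℂ) * v)
    simp only [Complex.ofReal_zero, zero_mul, add_zero] at h2
    exact HasFDerivAt.comp_hasDerivAt_of_eq 0 h2 h1 (by simp)
  have hlim : ∀ s (v : ℂ), Tendsto (fun r : ℝ => z s + r * v) (𝓝[>] 0) (𝓝 (z s)) := by
    intro s v
    have : Continuous fun r : ℝ => z s + r * v := by fun_prop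
    have h := this.tendsto 0
    simp only [Complex.ofReal_zero, zero_mul, add_zero] at h
    exact h.mono_left nhdsWithin_le_nhds
  have hin : ∀ s (v : ℂ), (∀ᶠ w in 𝓝 (z s), (toPlane w ∈ Ω ↔ σ w < 0)) → σ (z s) = 0 →
      fderiv ℝ σ (z s) v < 0 → ∀ᶠ r : ℝ in 𝓝[>] 0, toPlane (z s + r * v) ∈ Ω := by
    intro s v hs h0 hv
    filter_upwards [(hlim s v).eventually hs,
      eventually_neg_of_hasDerivAt_neg (hline s v) (by simpa using h0) hv] with r h1 h2
    exact h1.2 h2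
  have hout : ∀ s (v : ℂ), (∀ᶠ w in 𝓝 (z s), (toPlane w ∈ Ω ↔ σ w < 0)) → σ (z s) = 0 →
      0 < fderiv ℝ σ (z s) v → ∀ᶠ r : ℝ in 𝓝[>] 0, toPlane (z s + r * v) ∉ Ω := by
    intro s v hs h0 hv
    filter_upwards [(hlim s v).eventually hs,
      eventually_neg_of_hasDerivAt_neg (hline s v).neg (by simpa using h0)
        (neg_neg_of_pos hv)] with r h1 h2
    rw [h1, not_lt]
    simp only [Pi.neg_apply] at h2
    linarith
  rcases lt_or_gt_of_ne hnor with hneg | hpos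
  · left
    filter_upwards [hevs, hzero, (hcont.tendsto s₀).eventually_lt_const hneg] with s h1 h2 h3
    refine ⟨hin s _ h1 h2 h3, ?_⟩
    simp only [sub_eq_add_neg, ← mul_neg]
    exact hout s _ h1 h2 (by rw [mul_neg, map_neg]; linarith)
  · right
    filter_upwards [hevs, hzero, (hcont.tendsto s₀).eventually_const_lt hpos] with s h1 h2 h3
    refine ⟨?_, hout s _ h1 h2 h3⟩
    simp only [sub_eq_add_neg, ← mul_neg]
    exact hin s _ h1 h2 (by rw [mul_neg, map_neg]; linarith)

/-- The side on which Ω lies is locally constant in the parameter, hence constant because ℝ is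
connected. If Ω lies on the right, the curve is reversed. -/
theorem IsSmoothBoundedDomain.exists_boundaryCurve {Ω : Set Plane} {γ : ℝ → Plane}
    (hΩ : IsSmoothBoundedDomain Ω) (hγ : IsSimpleClosedCurve γ)
    (hΓ : frontier Ω = Set.range γ) : ∃ z, BoundaryCurve Ω (curveLength γ) z := by
  set c : ℝ → ℂ := fun t => toPlane.symm (γ t) with hc
  have hcs : ContDiff ℝ ∞ c := toPlane.symm.contDiff.comp hγ.smooth
  have hcd : ∀ t, deriv c t = toPlane.symm (deriv γ t) := fun t =>
    ((toPlane.symm.toContinuousLinearEquiv : Plane →L[ℝ] ℂ).hasFDerivAt.comp_hasDerivAt t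
      ((hγ.smooth.differentiable (by simp) t).hasDerivAt)).deriv
  obtain ⟨z, hz, hr⟩ := exists_arcCurve hcs (fun t => by
      rw [hcd]; simpa using hγ.regular t)
    (fun t => by simp only [hc, hγ.periodic t])
    (fun s hs t ht h => hγ.injOn hs ht (toPlane.symm.injective h))
  have hlen : (∫ t in (0 : ℝ)..1, ‖deriv c t‖) = curveLength γ := by
    simp only [hcd, curveLength, LinearIsometryEquiv.norm_map]
  rw [hlen] at hz
  have hfr : frontier Ω = range fun s => toPlane (z s) := by
    have : (range fun s => toPlane (z s)) = toPlane '' range z := by rw [← range_comp]; rfl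
    rw [this, hr, ← range_comp, hΓ]
    congr 1
    funext t
    simp [hc]
  set A : Set ℝ := {s | (∀ᶠ r : ℝ in 𝓝[>] 0, toPlane (z s + r * (Complex.I * deriv z s)) ∈ Ω) ∧
      ∀ᶠ r : ℝ in 𝓝[>] 0, toPlane (z s - r * (Complex.I * deriv z s)) ∉ Ω} with hA
  set A' : Set ℝ := {s | (∀ᶠ r : ℝ in 𝓝[>] 0, toPlane (z s - r * (Complex.I * deriv z s)) ∈ Ω) ∧
      ∀ᶠ r : ℝ in 𝓝[>] 0, toPlane (z s + r * (Complex.I * deriv z s)) ∉ Ω} with hA'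
  have hdisj : ∀ s, s ∈ A → s ∈ A' → False := by
    intro s h1 h2
    obtain ⟨r, h3, h4⟩ := (h1.1.and h2.2).exists
    exact h4 h3
  have hcov : ∀ s, (∀ᶠ t in 𝓝 s, t ∈ A) ∨ ∀ᶠ t in 𝓝 s, t ∈ A' :=
    forall_side_of_smooth_boundary hz hΩ hfr
  have hAo : IsOpen A := isOpen_iff_mem_nhds.2 fun s hs => by
    rcases hcov s with h | h
    · exact h
    · exact (hdisj s hs h.self_of_nhds).elim
  have hAc : IsClosed A := ⟨isOpen_iff_mem_nhds.2 fun s hs => by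
    rcases hcov s with h | h
    · exact (hs h.self_of_nhds).elim
    · filter_upwards [h] with t ht ht'
      exact hdisj t ht' ht⟩
  rcases isClopen_iff.1 ⟨hAc, hAo⟩ with h | h
  · have hall : ∀ s, s ∈ A' := fun s => by
      rcases hcov s with h' | h'
      · have := h'.self_of_nhds
        rw [h] at this; exact this.elim
      · exact h'.self_of_nhds
    refine ⟨fun s => z (-s), hz.reverse, hΩ.isOpen, hΩ.isBounded, ?_, fun s => ?_, fun s => ?_⟩
    · rw [hfr]
      exact ((neg_surjective (G := ℝ)).range_comp fun s => toPlane (z s)).symm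
    · have := (hall (-s)).1
      simpa only [deriv_comp_neg, mul_neg, ← sub_eq_add_neg] using this
    · have := (hall (-s)).2
      simpa only [deriv_comp_neg, mul_neg, sub_neg_eq_add] using this
  · have hall : ∀ s, s ∈ A := fun s => h ▸ mem_univ s
    exact ⟨z, hz, hΩ.isOpen, hΩ.isBounded, hfr, fun s => (hall s).1, fun s => (hall s).2⟩

/-! ### Fermi coordinates near the boundary -/

/-- The point at distance `p.2` from `z p.1` along the left normal. -/
def fermiMap (z : ℝ → ℂ) (p : ℝ × ℝ) : ℂ := z p.1 + p.2 * (Complex.I * deriv z p.1)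

/-- The Jacobian of `fermiMap`. -/
def fermiJac (z : ℝ → ℂ) (p : ℝ × ℝ) : ℝ := 1 - p.2 * curvature z p.1

/-- The derivative of `fermiMap`. -/
def fermiDeriv (z : ℝ → ℂ) (p : ℝ × ℝ) : ℝ × ℝ →L[ℝ] ℂ :=
  (ContinuousLinearMap.fst ℝ ℝ ℝ).smulRight (fermiJac z p * deriv z p.1) +
    (ContinuousLinearMap.snd ℝ ℝ ℝ).smulRight (Complex.I * deriv z p.1)

theorem fermiDeriv_apply (z : ℝ → ℂ) (p v : ℝ × ℝ) :
    fermiDeriv z p v = v.1 * (fermiJac z p * deriv z p.1) + v.2 * (Complex.I * deriv z p.1) := by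
  simp [fermiDeriv]

namespace ArcCurve

variable {L : ℝ} {z : ℝ → ℂ}

theorem contDiff_fermiMap (hz : ArcCurve L z) : ContDiff ℝ ∞ (fermiMap z) := by
  have h1 : ContDiff ℝ ∞ fun p : ℝ × ℝ => z p.1 := hz.smooth.comp contDiff_fst
  have h2 : ContDiff ℝ ∞ fun p : ℝ × ℝ => deriv z p.1 := hz.contDiff_deriv.comp contDiff_fst
  have h3 : ContDiff ℝ ∞ fun p : ℝ × ℝ => (p.2 : ℂ) := Complex.ofRealCLM.contDiff.comp contDiff_snd
  exact h1.add (h3.mul (contDiff_const.mul h2))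

theorem contDiff_fermiJac (hz : ArcCurve L z) : ContDiff ℝ ∞ (fermiJac z) :=
  contDiff_const.sub (contDiff_snd.mul (hz.contDiff_curvature.comp contDiff_fst))

theorem hasFDerivAt_fermiMap (hz : ArcCurve L z) (p : ℝ × ℝ) :
    HasFDerivAt (fermiMap z) (fermiDeriv z p) p := by
  have h1 : HasFDerivAt (fun p : ℝ × ℝ => z p.1) _ p :=
    HasFDerivAt.comp p (hz.hasDerivAt p.1).hasFDerivAt hasFDerivAt_fst
  have h2 : HasFDerivAt (fun p : ℝ × ℝ => deriv z p.1) _ p :=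
    HasFDerivAt.comp p (hz.hasDerivAt_deriv p.1).hasFDerivAt hasFDerivAt_fst
  have h3 : HasFDerivAt (fun p : ℝ × ℝ => (p.2 : ℂ)) _ p :=
    HasFDerivAt.comp p Complex.ofRealCLM.hasFDerivAt hasFDerivAt_snd
  refine (h1.add (h3.mul ((hasFDerivAt_const Complex.I p).mul h2))).congr_fderiv ?_
  apply ContinuousLinearMap.ext
  intro v
  simp [fermiDeriv, fermiJac]
  linear_combination (v.1 * p.2 * curvature z p.1 * deriv z p.1) * Complex.I_mul_I

theorem fermiMap_add (hz : ArcCurve L z) (s r : ℝ) :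
    fermiMap z (s + L, r) = fermiMap z (s, r) := by
  simp only [fermiMap, hz.periodic s, hz.periodic_deriv s]

theorem fermiMap_add_int (hz : ArcCurve L z) (s r : ℝ) (n : ℤ) :
    fermiMap z (s + n * L, r) = fermiMap z (s, r) :=
  Function.Periodic.int_mul (f := fun s => fermiMap z (s, r)) (fun s => hz.fermiMap_add s r) n s

theorem norm_fermiMap_sub (hz : ArcCurve L z) (s r : ℝ) : ‖fermiMap z (s, r) - z s‖ = |r| := by
  simp [fermiMap, hz.unit]

theorem exists_curvature_bound (hz : ArcCurve L z) : ∃ M, 0 ≤ M ∧ ∀ s, |curvature z s| ≤ M :=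
  hz.periodic_curvature.exists_norm_le hz.pos hz.contDiff_curvature.continuous

theorem norm_deriv_sub_le (hz : ArcCurve L z) {M : ℝ} (hM : ∀ s, |curvature z s| ≤ M) (s t : ℝ) :
    ‖deriv z t - deriv z s‖ ≤ M * |t - s| :=
  convex_univ.norm_image_sub_le_of_norm_hasDerivWithin_le
    (fun x _ => (hz.hasDerivAt_deriv x).hasDerivWithinAt)
    (fun x _ => by simpa [hz.unit] using hM x) (mem_univ s) (mem_univ t)

theorem norm_sub_sub_le (hz : ArcCurve L z) {M : ℝ} (hM0 : 0 ≤ M)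
    (hM : ∀ s, |curvature z s| ≤ M) (s t : ℝ) :
    ‖z t - z s - (t - s) * deriv z s‖ ≤ M * |t - s| * |t - s| := by
  have h : ∀ x : ℝ, HasDerivAt (fun x : ℝ => z x - x * deriv z s) (deriv z x - deriv z s) x := by
    intro x
    have h1 := (Complex.ofRealCLM.hasDerivAt (x := x)).mul_const (deriv z s)
    exact ((hz.hasDerivAt x).sub h1).congr_deriv (by simp)
  have := (convex_uIcc s t).norm_image_sub_le_of_norm_hasDerivWithin_le (C := M * |t - s|)
    (fun x _ => (h x).hasDerivWithinAt)
    (fun x hx => (hz.norm_deriv_sub_le hM s x).trans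
      (mul_le_mul_of_nonneg_left (abs_sub_left_of_mem_uIcc hx) hM0))
    left_mem_uIcc right_mem_uIcc
  have e : z t - z s - (t - s) * deriv z s = z t - t * deriv z s - (z s - s * deriv z s) := by ring
  rw [e]
  exact this

/-- For parameters at least δ apart modulo the period, compactness bounds the chord below by some c,
so normals of length less than c/2 cannot meet. For closer parameters, second-order Taylor estimates
at the base point exclude a crossing. -/
theorem exists_fermi_injective (hz : ArcCurve L z) : ∃ ε > 0, ∀ s t r q : ℝ, |r| < ε → |q| < ε →
    fermiMap z (s, r) = fermiMap z (t, q) → r = q ∧ ∃ n : ℤ, t = s + n * L := by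
  obtain ⟨M, hM0, hM⟩ := hz.exists_curvature_bound
  have hL := hz.pos
  -- This choice gives Mδ < 1/2, so each of the two error terms below is less than |w|/2 when w ≠ 0.
  set δ : ℝ := 1 / (2 * (M + 1)) with hδ
  have hδ0 : 0 < δ := by positivity
  set C : Set (ℝ × ℝ) := Icc 0 L ×ˢ (Icc (-(L / 2)) (L / 2) ∩ {w | δ ≤ |w|}) with hC
  have hCc : IsCompact C := isCompact_Icc.prod
    (isCompact_Icc.inter_right (isClosed_le continuous_const continuous_abs))
  have hcont : Continuous fun p : ℝ × ℝ => ‖z (p.1 + p.2) - z p.1‖ := by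
    have := hz.smooth.continuous
    fun_prop
  obtain ⟨c, hc0, hc⟩ := hCc.exists_forall_le' (a := 0) hcont.continuousOn (fun p hp => by
    rw [norm_pos_iff, sub_ne_zero]
    intro h
    obtain ⟨n, hn⟩ := hz.inj _ _ h
    have h1 : |(n : ℝ)| * L ≤ L / 2 := by
      rw [← abs_of_pos hL, ← abs_mul, abs_of_pos hL, abs_le]
      have := hp.2.1
      constructor <;> linarith [this.1, this.2]
    have h2 : |(n : ℝ)| < 1 := by
      by_contra hcon
      push Not at hcon
      nlinarith
    have h3 : n = 0 := by
      have : |n| < 1 := by exact_mod_cast h2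
      exact Int.abs_lt_one_iff.1 this
    have h4 : p.2 = 0 := by rw [h3] at hn; push_cast at hn; linarith
    have h5 : δ ≤ |p.2| := hp.2.2
    rw [h4, abs_zero] at h5
    linarith)
  refine ⟨min (c / 2) δ, by positivity, fun s t r q hr hq h => ?_⟩
  obtain ⟨s', hs', hs⟩ : ∃ s' ∈ Ico 0 L, ∃ k : ℤ, s = s' + k * L := by
    refine ⟨toIcoMod hL 0 s, by simpa using toIcoMod_mem_Ico' hL s, toIcoDiv hL 0 s, ?_⟩
    have := toIcoMod_add_toIcoDiv_zsmul hL 0 s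
    rw [zsmul_eq_mul] at this
    exact this.symm
  obtain ⟨k, rfl⟩ := hs
  obtain ⟨w, hw, m, rfl⟩ : ∃ w ∈ Icc (-(L / 2)) (L / 2), ∃ m : ℤ, t = s' + w + m * L := by
    refine ⟨t - s' - round ((t - s') / L) * L, ?_, round ((t - s') / L), by ring⟩
    have h1 := abs_sub_round ((t - s') / L)
    rw [abs_le] at h1
    have h2 : t - s' = (t - s') / L * L := by field_simp
    constructor <;> nlinarith [h1.1, h1.2]
  rw [hz.fermiMap_add_int, hz.fermiMap_add_int] at h
  have hrc : |r| < c / 2 := hr.trans_le (min_le_left _ _)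
  have hqc : |q| < c / 2 := hq.trans_le (min_le_left _ _)
  have hqδ : |q| < δ := hq.trans_le (min_le_right _ _)
  have hMδ : M * δ < 1 / 2 := by
    rw [hδ, mul_one_div, div_lt_div_iff₀ (by positivity) (by norm_num)]
    linarith
  have hw0 : w = 0 := by
    by_cases hwδ : δ ≤ |w|
    · exfalso
      have h1 := hc (s', w) ⟨⟨hs'.1, hs'.2.le⟩, hw, hwδ⟩
      have h2 : z (s' + w) - z s' = (fermiMap z (s', r) - z s') -
          (fermiMap z (s' + w, q) - z (s' + w)) := by rw [h]; ring
      have h3 := norm_sub_le (fermiMap z (s', r) - z s') (fermiMap z (s' + w, q) - z (s' + w))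
      rw [← h2, hz.norm_fermiMap_sub, hz.norm_fermiMap_sub] at h3
      linarith
    · push Not at hwδ
      set T := deriv z s' with hT
      have h1 := hz.norm_sub_sub_le hM0 hM s' (s' + w)
      have h2 := hz.norm_deriv_sub_le hM s' (s' + w)
      simp only [add_sub_cancel_left, Complex.ofReal_add] at h1 h2
      -- The coincidence of the two points multiplied by `conj T`. Its real part removes the term (r
      -- - q) i and leaves the Taylor remainder, of size M|w|², and a rotation error of size |q| M
      -- |w|.
      have h3 : (w : ℂ) = -(conj T * (z (s' + w) - z s' - w * T)) +
          (r - q) * Complex.I - q * Complex.I * (conj T * (deriv z (s' + w) - T)) := by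
        have h4 := hz.conj_mul_self s'
        simp only [fermiMap, ← hT] at h h4
        linear_combination -(conj T) * h - ((w : ℂ) - (r - q) * Complex.I) * h4
      have h5 := congrArg Complex.re h3
      have h6 : |(conj T * (z (s' + w) - z s' - w * T)).re| ≤ M * |w| * |w| :=
        (Complex.abs_re_le_norm _).trans (by rw [norm_mul, RCLike.norm_conj, hz.unit, one_mul]
                                             exact h1)
      have h7 : |(q * Complex.I * (conj T * (deriv z (s' + w) - T))).re| ≤ |q| * (M * |w|) :=
        (Complex.abs_re_le_norm _).trans (by
          rw [norm_mul, norm_mul, norm_mul, RCLike.norm_conj, hz.unit, one_mul]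
          simpa using mul_le_mul_of_nonneg_left h2 (abs_nonneg q))
      have h8 : |w| ≤ M * |w| * |w| + |q| * (M * |w|) := by
        have e : w = -(conj T * (z (s' + w) - z s' - w * T)).re -
            (q * Complex.I * (conj T * (deriv z (s' + w) - T))).re := by
          have e0 : (((r : ℂ) - q) * Complex.I).re = 0 := by simp
          rw [Complex.sub_re, Complex.add_re, Complex.neg_re, e0, Complex.ofReal_re] at h5
          linarith
        rw [abs_le] at h6 h7 ⊢
        constructor <;> linarith
      have h9 : M * |w| ≤ M * δ := mul_le_mul_of_nonneg_left hwδ.le hM0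
      have h10 : M * |q| ≤ M * δ := mul_le_mul_of_nonneg_left hqδ.le hM0
      have h11 : |w| * (1 - M * |w| - M * |q|) ≤ 0 := by nlinarith
      have h12 : |w| ≤ 0 := by
        by_contra hcon
        push Not at hcon
        have : 0 < 1 - M * |w| - M * |q| := by linarith
        nlinarith [mul_pos hcon this]
      exact abs_nonpos_iff.1 h12
  subst hw0
  refine ⟨?_, m - k, by push_cast; ring⟩
  rw [add_zero] at h
  simp only [fermiMap, add_right_inj] at h
  have h1 := mul_right_cancel₀ (mul_ne_zero Complex.I_ne_zero (hz.deriv_ne_zero s')) h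
  exact_mod_cast h1

end ArcCurve

/-- Fermi coordinates are good coordinates on the inner tube of width `ε`. -/
structure TubeWidth (Ω : Set Plane) (L : ℝ) (z : ℝ → ℂ) (ε : ℝ) : Prop
    extends BoundaryCurve Ω L z where
  width_pos : 0 < ε
  abs_mul_curvature_le : ∀ s r, |r| ≤ ε → |r * curvature z s| ≤ 1 / 2
  fermi_inj : ∀ s t r q : ℝ, |r| < ε → |q| < ε →
    fermiMap z (s, r) = fermiMap z (t, q) → r = q ∧ ∃ n : ℤ, t = s + n * L

theorem IsPreconnected.subset_of_disjoint_frontier {X : Type*} [TopologicalSpace X]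
    {s Ω : Set X} (hs : IsPreconnected s) (hΩ : IsOpen Ω) (hd : Disjoint s (frontier Ω))
    (hne : (s ∩ Ω).Nonempty) : s ⊆ Ω := by
  refine hs.subset_left_of_subset_union hΩ (isClosed_closure (s := Ω)).isOpen_compl ?_ ?_ hne
  · exact disjoint_compl_right.mono_left subset_closure
  · intro x hx
    by_cases h : x ∈ closure Ω
    · left
      by_contra hcon
      exact disjoint_left.1 hd hx (by rw [hΩ.frontier_eq]; exact ⟨h, hcon⟩)
    · exact Or.inr h

theorem BoundaryCurve.exists_tubeWidth {Ω : Set Plane} {L : ℝ} {z : ℝ → ℂ}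
    (hz : BoundaryCurve Ω L z) : ∃ ε, TubeWidth Ω L z ε := by
  obtain ⟨ε, hε, hinj⟩ := hz.toArcCurve.exists_fermi_injective
  obtain ⟨M, hM0, hM⟩ := hz.toArcCurve.exists_curvature_bound
  refine ⟨min ε (1 / (2 * (M + 1))), hz, by positivity, fun s r hr => ?_, fun s t r q hr hq =>
    hinj s t r q (hr.trans_le (min_le_left _ _)) (hq.trans_le (min_le_left _ _))⟩
  have h1 : |r| ≤ 1 / (2 * (M + 1)) := hr.trans (min_le_right _ _)
  rw [abs_mul]
  calc |r| * |curvature z s| ≤ 1 / (2 * (M + 1)) * M :=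
        mul_le_mul h1 (hM s) (abs_nonneg _) (by positivity)
    _ ≤ 1 / 2 := by
        rw [one_div_mul_eq_div, div_le_div_iff₀ (by positivity) (by norm_num)]
        linarith

namespace TubeWidth

variable {Ω : Set Plane} {L ε : ℝ} {z : ℝ → ℂ}

theorem half_le_fermiJac (hz : TubeWidth Ω L z ε) {p : ℝ × ℝ} (hp : p.2 ∈ Icc 0 ε) :
    1 / 2 ≤ fermiJac z p := by
  have := abs_le.1 (hz.abs_mul_curvature_le p.1 p.2 (by rw [abs_of_nonneg hp.1]; exact hp.2))
  simp only [fermiJac]; linarith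

theorem fermiJac_le (hz : TubeWidth Ω L z ε) {p : ℝ × ℝ} (hp : p.2 ∈ Icc 0 ε) :
    fermiJac z p ≤ 3 / 2 := by
  have := abs_le.1 (hz.abs_mul_curvature_le p.1 p.2 (by rw [abs_of_nonneg hp.1]; exact hp.2))
  simp only [fermiJac]; linarith

theorem fermiJac_pos (hz : TubeWidth Ω L z ε) {p : ℝ × ℝ} (hp : p.2 ∈ Icc 0 ε) :
    0 < fermiJac z p := lt_of_lt_of_le (by norm_num) (hz.half_le_fermiJac hp)

/-- The normal segment is connected and enters Ω at its foot by `inward`. It never meets the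
frontier, because frontier points have normal coordinate 0 and the coordinates are injective. -/
theorem fermiMap_mem (hz : TubeWidth Ω L z ε) (s : ℝ) {r : ℝ} (hr : r ∈ Ioo 0 ε) :
    toPlane (fermiMap z (s, r)) ∈ Ω := by
  have hcont : Continuous fun r : ℝ => toPlane (fermiMap z (s, r)) :=
    toPlane.continuous.comp (hz.contDiff_fermiMap.continuous.comp (by fun_prop))
  have hpre : IsPreconnected ((fun r : ℝ => toPlane (fermiMap z (s, r))) '' Ioo 0 ε) :=
    isPreconnected_Ioo.image _ hcont.continuousOn
  refine hpre.subset_of_disjoint_frontier hz.isOpen ?_ ?_ (mem_image_of_mem _ hr)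
  · rw [disjoint_left]
    rintro _ ⟨q, hq, rfl⟩ hfr
    rw [hz.frontier_eq] at hfr
    obtain ⟨t, ht⟩ := hfr
    have h1 : fermiMap z (s, q) = fermiMap z (t, 0) := by
      have := toPlane.injective ht
      simp only [fermiMap] at this ⊢
      rw [← this]; simp
    have := (hz.fermi_inj s t q 0 (by rw [abs_of_pos hq.1]; exact hq.2)
      (by simpa using hz.width_pos) h1).1
    exact hq.1.ne' this
  · obtain ⟨q, hq, hq'⟩ := ((hz.inward s).and (Ioo_mem_nhdsGT hz.width_pos)).exists
    exact ⟨_, ⟨q, hq', rfl⟩, hq⟩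

/-- A point of the tube is joined to a nearest boundary point z(s), and criticality of the distance
makes the difference normal to the curve. The other inclusion is `fermiMap_mem` with the bound
dist(x, Γ) ≤ r. -/
theorem innerTube_eq (hz : TubeWidth Ω L z ε) {h : ℝ} (hh : h ≤ ε) :
    innerTube Ω h = (fun p => toPlane (fermiMap z p)) '' (univ ×ˢ Ioo 0 h) := by
  apply Subset.antisymm
  · rintro x ⟨hxΩ, hxd⟩
    have hfc : IsCompact (frontier Ω) := hz.isBounded.isCompact_closure.of_isClosed_subset
      isClosed_frontier frontier_subset_closure
    have hfn : (frontier Ω).Nonempty := by rw [hz.frontier_eq]; exact range_nonempty _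
    obtain ⟨y, hy, hdy⟩ := hfc.exists_infDist_eq_dist hfn x
    have hy' := hy
    rw [hz.frontier_eq] at hy'
    obtain ⟨s, rfl⟩ := hy'
    set d := Metric.infDist x (frontier Ω) with hd
    have hd0 : 0 < d := by
      rw [hd, ← isClosed_frontier.notMem_iff_infDist_pos hfn, hz.isOpen.frontier_eq]
      exact fun h => h.2 hxΩ
    obtain ⟨p, rfl⟩ := toPlane.surjective x
    have hball : Metric.ball (toPlane p) d ⊆ Ω := by
      refine (convex_ball _ _).isPreconnected.subset_of_disjoint_frontier hz.isOpen ?_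
        ⟨_, Metric.mem_ball_self hd0, hxΩ⟩
      rw [disjoint_left]
      intro y hy hyf
      have := Metric.infDist_le_dist_of_mem (x := toPlane p) hyf
      rw [Metric.mem_ball, dist_comm] at hy
      linarith
    set v := p - z s with hv
    have hvn : ‖v‖ = d := by
      rw [hdy, dist_eq_norm, ← map_sub, toPlane.norm_map]
    have hmin : ∀ t, ‖v‖ ^ 2 ≤ ‖p - z t‖ ^ 2 := by
      intro t
      have h1 : toPlane (z t) ∈ frontier Ω := by rw [hz.frontier_eq]; exact mem_range_self t
      have h2 := Metric.infDist_le_dist_of_mem (x := toPlane p) h1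
      rw [dist_eq_norm, ← map_sub, toPlane.norm_map, ← hd, ← hvn] at h2
      gcongr
    have hder : HasDerivAt (fun t => ‖p - z t‖ ^ 2) (2 * inner ℝ v (-deriv z s)) s :=
      ((hz.hasDerivAt s).const_sub p).norm_sq
    have hcrit : inner ℝ v (-deriv z s) = 0 := by
      have hlm : IsLocalMin (fun t => ‖p - z t‖ ^ 2) s := Eventually.of_forall hmin
      have := hlm.hasDerivAt_eq_zero hder
      linarith
    have hre : (conj (deriv z s) * v).re = 0 := by
      rw [inner_neg_right, neg_eq_zero, Complex.inner] at hcrit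
      rw [← Complex.conj_re, map_mul, Complex.conj_conj, mul_comm]
      rw [mul_comm] at hcrit
      exact hcrit
    set ρ := (conj (deriv z s) * v).im with hρ
    have hvρ : v = ρ * (Complex.I * deriv z s) := by
      have h1 := Complex.re_add_im (conj (deriv z s) * v)
      rw [hre, ← hρ, Complex.ofReal_zero, zero_add] at h1
      have h2 := hz.conj_mul_self s
      linear_combination (-v) * h2 - deriv z s * h1
    have hp : p = z s + ρ * (Complex.I * deriv z s) := by rw [← hvρ, hv]; ring
    have hρd : |ρ| = d := by rw [← hvn, hvρ]; simp [hz.unit]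
    -- If ρ ≤ 0, then ρ = -d and the ball of radius d about the point, which lies in Ω, contains
    -- points immediately on the outward side of z(s), contradicting `outward`.
    have hρ0 : 0 < ρ := by
      by_contra hcon
      push Not at hcon
      rw [abs_of_nonpos hcon] at hρd
      obtain ⟨q, hq, hq'⟩ := ((hz.outward s).and (Ioo_mem_nhdsGT hd0)).exists
      apply hq
      apply hball
      rw [Metric.mem_ball, dist_eq_norm, ← map_sub, toPlane.norm_map, hp]
      have : z s - q * (Complex.I * deriv z s) - (z s + ρ * (Complex.I * deriv z s)) =
          ((d - q : ℝ) : ℂ) * (Complex.I * deriv z s) := by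
        rw [← hρd]; push_cast; ring
      rw [this]
      simp only [norm_mul, Complex.norm_I, hz.unit, Complex.norm_real, Real.norm_eq_abs, mul_one]
      rw [abs_of_pos (by linarith [hq'.2])]
      linarith [hq'.1]
    rw [abs_of_pos hρ0] at hρd
    exact ⟨(s, ρ), ⟨mem_univ _, hρ0, by rw [hρd]; exact hxd⟩, by
      simp only [fermiMap]; rw [← hp]⟩
  · rintro _ ⟨⟨s, r⟩, ⟨-, hr⟩, rfl⟩
    refine ⟨hz.fermiMap_mem s ⟨hr.1, hr.2.trans_le hh⟩, ?_⟩
    have h1 : toPlane (z s) ∈ frontier Ω := by rw [hz.frontier_eq]; exact mem_range_self s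
    refine (Metric.infDist_le_dist_of_mem h1).trans_lt ?_
    rw [dist_eq_norm, ← map_sub, toPlane.norm_map, hz.norm_fermiMap_sub, abs_of_pos hr.1]
    exact hr.2

/-- The fundamental domain for the Fermi coordinates of the inner tube. -/
abbrev cell (L h : ℝ) : Set (ℝ × ℝ) := Ioc 0 L ×ˢ Ioo 0 h

theorem innerTube_eq_cell (hz : TubeWidth Ω L z ε) {h : ℝ} (hh : h ≤ ε) :
    innerTube Ω h = (fun p => toPlane (fermiMap z p)) '' cell L h := by
  rw [hz.innerTube_eq hh]
  apply Subset.antisymm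
  · rintro _ ⟨⟨s, r⟩, ⟨-, hr⟩, rfl⟩
    refine ⟨(toIocMod hz.pos 0 s, r), ⟨by simpa using toIocMod_mem_Ioc hz.pos 0 s, hr⟩, ?_⟩
    have h1 := toIocMod_add_toIocDiv_zsmul hz.pos 0 s
    rw [zsmul_eq_mul] at h1
    have h2 := hz.fermiMap_add_int (toIocMod hz.pos 0 s) r (toIocDiv hz.pos 0 s)
    rw [h1] at h2
    simp only [h2]
  · exact image_mono (prod_mono (subset_univ _) Subset.rfl)

theorem injOn_cell (hz : TubeWidth Ω L z ε) {h : ℝ} (hh : h ≤ ε) :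
    InjOn (fermiMap z) (cell L h) := by
  rintro ⟨s, r⟩ ⟨hs, hr⟩ ⟨t, q⟩ ⟨ht, hq⟩ heq
  simp only at hs hr ht hq
  obtain ⟨h1, n, hn⟩ := hz.fermi_inj s t r q (by rw [abs_of_pos hr.1]; linarith [hr.2])
    (by rw [abs_of_pos hq.1]; linarith [hq.2]) heq
  have hL := hz.pos
  have h3 : n = 0 := by
    have a1 : (n : ℝ) < 1 := by
      by_contra hcon; push Not at hcon; nlinarith [hs.1, hs.2, ht.1, ht.2]
    have a2 : (-1 : ℝ) < n := by
      by_contra hcon; push Not at hcon; nlinarith [hs.1, hs.2, ht.1, ht.2]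
    have a3 : n < 1 := by exact_mod_cast a1
    have a4 : -1 < n := by exact_mod_cast a2
    omega
  subst h3
  simp [hn, h1]

/-- Precomposition with ℂ ≃ ℝ × ℝ turns the derivative into an endomorphism of ℂ, so that its
determinant is defined. The frame z', i z' is orthonormal and positively oriented, leaving only the
factor J. -/
theorem det_fermiDeriv (hz : ArcCurve L z) (p : ℝ × ℝ) :
    ((fermiDeriv z p).comp (Complex.equivRealProdCLM : ℂ →L[ℝ] ℝ × ℝ)).det = fermiJac z p := by
  rw [ContinuousLinearMap.det, ← LinearMap.det_toMatrix Complex.basisOneI, Matrix.det_fin_two]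
  have h := congrArg Complex.re (hz.conj_mul_self p.1)
  simp at h
  simp [LinearMap.toMatrix_apply, Complex.coe_basisOneI, fermiDeriv_apply]
  linear_combination fermiJac z p * h

theorem preimage_innerTube (hz : TubeWidth Ω L z ε) {h : ℝ} (hh : h ≤ ε) :
    toPlane ⁻¹' innerTube Ω h =
      (fun w => fermiMap z (Complex.equivRealProdCLM w)) ''
        (Complex.equivRealProdCLM ⁻¹' cell L h) := by
  rw [hz.innerTube_eq_cell hh]
  have e1 : (fun w => fermiMap z (Complex.equivRealProdCLM w)) ''
      (Complex.equivRealProdCLM ⁻¹' cell L h) = fermiMap z '' cell L h := by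
    have : (fun w => fermiMap z (Complex.equivRealProdCLM w)) =
      fermiMap z ∘ Complex.equivRealProdCLM := rfl
    rw [this, image_comp, image_preimage_eq _ Complex.equivRealProdCLM.surjective]
  rw [e1]
  have : (fun p => toPlane (fermiMap z p)) = toPlane ∘ fermiMap z := rfl
  rw [this, image_comp, preimage_image_eq _ toPlane.injective]

theorem measurableSet_cell (L h : ℝ) : MeasurableSet (cell L h) :=
  measurableSet_Ioc.prod measurableSet_Ioo

theorem measurableSet_innerTube (hΩ : IsOpen Ω) (h : ℝ) : MeasurableSet (innerTube Ω h) :=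
  hΩ.measurableSet.inter
    (isOpen_lt (Metric.continuous_infDist_pt _) continuous_const).measurableSet

/-- The change of variables to Fermi coordinates, together with the corresponding statement about
integrability. -/
theorem change_of_variables (hz : TubeWidth Ω L z ε) {h : ℝ} (hh : h ≤ ε)
    {E : Type*} [NormedAddCommGroup E] [NormedSpace ℝ E] (f : Plane → E) :
    (∫ x in innerTube Ω h, f x =
      ∫ p in cell L h, fermiJac z p • f (toPlane (fermiMap z p))) ∧
    (IntegrableOn f (innerTube Ω h) ↔
      IntegrableOn (fun p => fermiJac z p • f (toPlane (fermiMap z p))) (cell L h)) := by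
  have hmp : MeasurePreserving toPlane := toPlane.measurePreserving
  have hme : MeasurableEmbedding toPlane := toPlane.toHomeomorph.measurableEmbedding
  set e := Complex.equivRealProdCLM
  have hep : MeasurePreserving (Complex.measurableEquivRealProd : ℂ → ℝ × ℝ) :=
    Complex.volume_preserving_equiv_real_prod
  have hee : MeasurableEmbedding (Complex.measurableEquivRealProd : ℂ → ℝ × ℝ) :=
    Complex.measurableEquivRealProd.measurableEmbedding
  have hcoe : ∀ w, Complex.measurableEquivRealProd w = e w := fun w => rfl
  have hS : MeasurableSet (e ⁻¹' cell L h) :=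
    (measurableSet_cell L h).preimage e.continuous.measurable
  have hd : ∀ w ∈ e ⁻¹' cell L h, HasFDerivWithinAt (fun w => fermiMap z (e w))
      ((fermiDeriv z (e w)).comp (e : ℂ →L[ℝ] ℝ × ℝ)) (e ⁻¹' cell L h) w := fun w _ =>
    (HasFDerivAt.comp w (hz.hasFDerivAt_fermiMap (e w)) e.hasFDerivAt).hasFDerivWithinAt
  have hi : InjOn (fun w => fermiMap z (e w)) (e ⁻¹' cell L h) := fun w hw v hv hwv =>
    e.injective (hz.injOn_cell hh hw hv hwv)
  have habs : ∀ w ∈ e ⁻¹' cell L h,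
      |((fermiDeriv z (e w)).comp (e : ℂ →L[ℝ] ℝ × ℝ)).det| = fermiJac z (e w) := fun w hw => by
    rw [det_fermiDeriv hz.toArcCurve, abs_of_pos]
    exact hz.fermiJac_pos ⟨hw.2.1.le, hw.2.2.le.trans hh⟩
  constructor
  · rw [← hmp.setIntegral_preimage_emb hme, hz.preimage_innerTube hh,
      integral_image_eq_integral_abs_det_fderiv_smul volume hS hd hi,
      ← hep.setIntegral_preimage_emb hee]
    refine setIntegral_congr_fun hS fun w hw => ?_
    rw [habs w hw, hcoe]
  · rw [← hmp.integrableOn_comp_preimage hme, hz.preimage_innerTube hh,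
      integrableOn_image_iff_integrableOn_abs_det_fderiv_smul volume hS hd hi,
      ← hep.integrableOn_comp_preimage hee]
    refine integrableOn_congr_fun (fun w hw => ?_) hS
    simp only [Function.comp]
    rw [habs w hw, hcoe]

theorem setIntegral_innerTube (hz : TubeWidth Ω L z ε) {h : ℝ} (hh : h ≤ ε)
    {E : Type*} [NormedAddCommGroup E] [NormedSpace ℝ E] (f : Plane → E) :
    ∫ x in innerTube Ω h, f x =
      ∫ p in cell L h, fermiJac z p • f (toPlane (fermiMap z p)) :=
  (hz.change_of_variables hh f).1

theorem integrableOn_innerTube_iff (hz : TubeWidth Ω L z ε) {h : ℝ} (hh : h ≤ ε)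
    {E : Type*} [NormedAddCommGroup E] [NormedSpace ℝ E] (f : Plane → E) :
    IntegrableOn f (innerTube Ω h) ↔
      IntegrableOn (fun p => fermiJac z p • f (toPlane (fermiMap z p))) (cell L h) :=
  (hz.change_of_variables hh f).2

end TubeWidth

/-! ### Functions given in Fermi coordinates -/

/-- The strip of parameters of the inner tube of width `ε`. -/
abbrev fermiStrip (ε : ℝ) : Set (ℝ × ℝ) := univ ×ˢ Ioo 0 ε

open Classical in
/-- The function on the inner tube which is `Ψ` in Fermi coordinates, extended by zero. -/
def fermiLift {E : Type*} [Zero E] (z : ℝ → ℂ) (ε : ℝ) (Ψ : ℝ × ℝ → E) (x : Plane) : E :=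
  if h : ∃ p ∈ fermiStrip ε, toPlane (fermiMap z p) = x then Ψ h.choose else 0

theorem isOpen_fermiStrip (ε : ℝ) : IsOpen (fermiStrip ε) := isOpen_univ.prod isOpen_Ioo

/-- Near f(a) the function ψ is Ψ composed with the smooth local inverse of f. -/
theorem ContDiffAt.of_comp_localDiffeo {E F G : Type*} [NormedAddCommGroup E] [NormedSpace ℝ E]
    [CompleteSpace E] [NormedAddCommGroup F] [NormedSpace ℝ F] [NormedAddCommGroup G]
    [NormedSpace ℝ G] {f : E → F} {f' : E ≃L[ℝ] F} {ψ : F → G} {Ψ : E → G} {a : E}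
    (hf : ContDiffAt ℝ ∞ f a) (hf' : HasFDerivAt f (f' : E →L[ℝ] F) a)
    (hΨ : ContDiffAt ℝ ∞ Ψ a) (h : ψ ∘ f =ᶠ[𝓝 a] Ψ) : ContDiffAt ℝ ∞ ψ (f a) := by
  have hn : (∞ : WithTop ℕ∞) ≠ 0 := by simp
  have hs : HasStrictFDerivAt f (f' : E →L[ℝ] F) a := hf.hasStrictFDerivAt' hf' hn
  set g := hf.localInverse hf' hn with hg
  have hgs : ContDiffAt ℝ ∞ g (f a) := hf.to_localInverse hf' hn
  have hga : g (f a) = a := hs.localInverse_apply_image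
  have hri : ∀ᶠ y in 𝓝 (f a), f (g y) = y := hs.eventually_right_inverse
  have hgt : Tendsto g (𝓝 (f a)) (𝓝 a) := by
    have := hgs.continuousAt.tendsto
    rwa [hga] at this
  have hcomp : ContDiffAt ℝ ∞ (Ψ ∘ g) (f a) := by
    apply ContDiffAt.comp
    · rwa [hga]
    · exact hgs
  refine hcomp.congr_of_eventuallyEq ?_
  filter_upwards [hri, hgt.eventually h] with y h1 h2
  simp only [Function.comp] at h2 ⊢
  rw [← h2, h1]

theorem toPlane_single (j : Fin 2) :
    EuclideanSpace.single j (1 : ℝ) = toPlane (if j = 0 then 1 else Complex.I) := by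
  fin_cases j <;> ext i <;> fin_cases i <;> simp [toPlane_zero, toPlane_one]

namespace TubeWidth

variable {Ω : Set Plane} {L ε : ℝ} {z : ℝ → ℂ} {E : Type*} [NormedAddCommGroup E]

/-- The chosen preimage does not matter: two preimages in the strip have the same r and parameters
differing by a multiple of L, and Ψ is L-periodic. -/
theorem fermiLift_apply (hz : TubeWidth Ω L z ε) {Ψ : ℝ × ℝ → E}
    (hper : ∀ s r, Ψ (s + L, r) = Ψ (s, r)) {p : ℝ × ℝ} (hp : p ∈ fermiStrip ε) :
    fermiLift z ε Ψ (toPlane (fermiMap z p)) = Ψ p := by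
  have hex : ∃ q ∈ fermiStrip ε, toPlane (fermiMap z q) = toPlane (fermiMap z p) := ⟨p, hp, rfl⟩
  rw [fermiLift, dif_pos hex]
  obtain ⟨hq, hqp⟩ := hex.choose_spec
  set q := hex.choose
  obtain ⟨h1, n, hn⟩ := hz.fermi_inj p.1 q.1 p.2 q.2 (by rw [abs_of_pos hp.2.1]; exact hp.2.2)
    (by rw [abs_of_pos hq.2.1]; exact hq.2.2) (toPlane.injective hqp).symm
  have h2 : Ψ (p.1 + n * L, p.2) = Ψ (p.1, p.2) :=
    Function.Periodic.int_mul (f := fun s => Ψ (s, p.2)) (fun s => hper s p.2) n p.1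
  have h3 : q = (p.1 + n * L, p.2) := Prod.ext hn h1.symm
  rw [h3, h2]

theorem fermiLift_eq_zero (hz : TubeWidth Ω L z ε) (Ψ : ℝ × ℝ → E) {x : Plane}
    (hx : x ∉ innerTube Ω ε) : fermiLift z ε Ψ x = 0 := by
  rw [hz.innerTube_eq le_rfl] at hx
  rw [fermiLift, dif_neg]
  rintro ⟨p, hp, rfl⟩
  exact hx (mem_image_of_mem _ hp)

/-- The closed sub-tube with normal coordinate in `[a, b]`. -/
theorem isCompact_fermi_image (hz : TubeWidth Ω L z ε) (a b : ℝ) :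
    IsCompact ((fun p => toPlane (fermiMap z p)) '' (univ ×ˢ Icc a b)) := by
  have : (fun p => toPlane (fermiMap z p)) '' (univ ×ˢ Icc a b) =
      (fun p => toPlane (fermiMap z p)) '' (Icc 0 L ×ˢ Icc a b) := by
    apply Subset.antisymm
    · rintro _ ⟨⟨s, r⟩, ⟨-, hr⟩, rfl⟩
      have h0 := toIcoMod_mem_Ico' hz.pos s
      refine ⟨(toIcoMod hz.pos 0 s, r), ⟨⟨h0.1, h0.2.le⟩, hr⟩, ?_⟩
      have h1 := toIcoMod_add_toIcoDiv_zsmul hz.pos 0 s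
      rw [zsmul_eq_mul] at h1
      have h2 := hz.fermiMap_add_int (toIcoMod hz.pos 0 s) r (toIcoDiv hz.pos 0 s)
      rw [h1] at h2
      simp only [h2]
    · exact image_mono (prod_mono (subset_univ _) Subset.rfl)
  rw [this]
  exact (isCompact_Icc.prod isCompact_Icc).image
    (toPlane.continuous.comp hz.contDiff_fermiMap.continuous)

theorem tsupport_fermiLift_subset (hz : TubeWidth Ω L z ε) {Ψ : ℝ × ℝ → E} {a b : ℝ}
    (hsupp : ∀ p : ℝ × ℝ, p.2 ∉ Icc a b → Ψ p = 0) :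
    tsupport (fermiLift z ε Ψ) ⊆ (fun p => toPlane (fermiMap z p)) '' (univ ×ˢ Icc a b) := by
  refine closure_minimal (fun x hx => ?_) (hz.isCompact_fermi_image a b).isClosed
  rw [Function.mem_support, fermiLift] at hx
  split_ifs at hx with h
  · refine ⟨h.choose, ⟨mem_univ _, ?_⟩, h.choose_spec.2⟩
    by_contra hcon
    exact hx (hsupp _ hcon)
  · exact (hx rfl).elim

theorem hasCompactSupport_fermiLift (hz : TubeWidth Ω L z ε) {Ψ : ℝ × ℝ → E} {a b : ℝ}
    (hsupp : ∀ p : ℝ × ℝ, p.2 ∉ Icc a b → Ψ p = 0) : HasCompactSupport (fermiLift z ε Ψ) :=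
  (hz.isCompact_fermi_image a b).of_isClosed_subset (isClosed_tsupport _)
    (hz.tsupport_fermiLift_subset hsupp)

theorem tsupport_fermiLift_subset_innerTube (hz : TubeWidth Ω L z ε) {Ψ : ℝ × ℝ → E} {a b h : ℝ}
    (ha : 0 < a) (hb : b < h) (hh : h ≤ ε) (hsupp : ∀ p : ℝ × ℝ, p.2 ∉ Icc a b → Ψ p = 0) :
    tsupport (fermiLift z ε Ψ) ⊆ innerTube Ω h := by
  rw [hz.innerTube_eq hh]
  refine (hz.tsupport_fermiLift_subset hsupp).trans (image_mono (prod_mono Subset.rfl ?_))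
  exact fun r hr => ⟨ha.trans_le hr.1, hr.2.trans_lt hb⟩

theorem eventually_fermiLift (hz : TubeWidth Ω L z ε) {Ψ : ℝ × ℝ → E}
    (hper : ∀ s r, Ψ (s + L, r) = Ψ (s, r)) {p : ℝ × ℝ} (hp : p ∈ fermiStrip ε) :
    ∀ᶠ q in 𝓝 p, fermiLift z ε Ψ (toPlane (fermiMap z q)) = Ψ q := by
  filter_upwards [(isOpen_fermiStrip ε).mem_nhds hp] with q hq
  exact hz.fermiLift_apply hper hq

variable [NormedSpace ℝ E]

/-- The derivative of the Fermi coordinates as an isomorphism. -/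
theorem exists_fermiDeriv_equiv (hz : TubeWidth Ω L z ε) {p : ℝ × ℝ} (hp : p ∈ fermiStrip ε) :
    ∃ f' : (ℝ × ℝ) ≃L[ℝ] Plane, (∀ v, f' v = toPlane (fermiDeriv z p v)) ∧
      HasFDerivAt (fun p => toPlane (fermiMap z p)) (f' : ℝ × ℝ →L[ℝ] Plane) p := by
  have hdet := det_fermiDeriv hz.toArcCurve p
  have hne : ((fermiDeriv z p).comp (Complex.equivRealProdCLM : ℂ →L[ℝ] ℝ × ℝ)).det ≠ 0 := by
    rw [hdet]; exact (hz.fermiJac_pos ⟨hp.2.1.le, hp.2.2.le⟩).ne'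
  set A := ((fermiDeriv z p).comp
    (Complex.equivRealProdCLM : ℂ →L[ℝ] ℝ × ℝ)).toContinuousLinearEquivOfDetNeZero hne with hA
  have hAv : ∀ w, A w = fermiDeriv z p (Complex.equivRealProdCLM w) := fun w => rfl
  refine ⟨(Complex.equivRealProdCLM.symm.trans A).trans toPlane.toContinuousLinearEquiv,
    fun v => ?_, ?_⟩
  · simp only [ContinuousLinearEquiv.trans_apply, hAv, ContinuousLinearEquiv.apply_symm_apply]
    rfl
  · refine HasFDerivAt.congr_fderiv (HasFDerivAt.comp p
      (toPlane.toContinuousLinearEquiv : ℂ →L[ℝ] Plane).hasFDerivAt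
      (hz.hasFDerivAt_fermiMap p)) ?_
    apply ContinuousLinearMap.ext
    intro v
    simp only [ContinuousLinearMap.comp_apply, ContinuousLinearEquiv.coe_coe,
      ContinuousLinearEquiv.trans_apply, hAv, ContinuousLinearEquiv.apply_symm_apply]

/-- A function which is smooth in Fermi coordinates is smooth. -/
theorem contDiffAt_of_fermi (hz : TubeWidth Ω L z ε) {ψ : Plane → E} {Ψ : ℝ × ℝ → E}
    {p : ℝ × ℝ} (hp : p ∈ fermiStrip ε) (hΨ : ContDiffAt ℝ ∞ Ψ p)
    (h : ∀ᶠ q in 𝓝 p, ψ (toPlane (fermiMap z q)) = Ψ q) :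
    ContDiffAt ℝ ∞ ψ (toPlane (fermiMap z p)) := by
  obtain ⟨f', -, hf'⟩ := hz.exists_fermiDeriv_equiv hp
  exact ContDiffAt.of_comp_localDiffeo
    (f := fun p => toPlane (fermiMap z p))
    (toPlane.contDiff.comp hz.contDiff_fermiMap).contDiffAt hf' hΨ h

/-- The partial derivatives in terms of the derivatives in Fermi coordinates. -/
theorem fderiv_single_of_fermi (hz : TubeWidth Ω L z ε) {ψ : Plane → E} {Ψ : ℝ × ℝ → E}
    {p : ℝ × ℝ} (hp : p ∈ fermiStrip ε) (hψ : DifferentiableAt ℝ ψ (toPlane (fermiMap z p)))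
    (h : ∀ᶠ q in 𝓝 p, ψ (toPlane (fermiMap z q)) = Ψ q) :
    fderiv ℝ ψ (toPlane (fermiMap z p)) (EuclideanSpace.single 0 1) =
      ((deriv z p.1).re / fermiJac z p) • fderiv ℝ Ψ p (1, 0) -
        (deriv z p.1).im • fderiv ℝ Ψ p (0, 1) ∧
    fderiv ℝ ψ (toPlane (fermiMap z p)) (EuclideanSpace.single 1 1) =
      ((deriv z p.1).im / fermiJac z p) • fderiv ℝ Ψ p (1, 0) +
        (deriv z p.1).re • fderiv ℝ Ψ p (0, 1) := by
  obtain ⟨f', hf'v, hf'⟩ := hz.exists_fermiDeriv_equiv hp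
  have hJ : fermiJac z p ≠ 0 := (hz.fermiJac_pos ⟨hp.2.1.le, hp.2.2.le⟩).ne'
  have hcomp : HasFDerivAt Ψ
      ((fderiv ℝ ψ (toPlane (fermiMap z p))).comp (f' : ℝ × ℝ →L[ℝ] Plane)) p :=
    (HasFDerivAt.comp p hψ.hasFDerivAt hf').congr_of_eventuallyEq
      (by filter_upwards [h] with q hq; exact hq.symm)
  have hΨ : ∀ v, fderiv ℝ Ψ p v =
      fderiv ℝ ψ (toPlane (fermiMap z p)) (toPlane (fermiDeriv z p v)) := by
    intro v
    rw [hcomp.fderiv, ← hf'v]; rfl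
  have hsplit : ∀ a b : ℝ, fderiv ℝ Ψ p (a, b) =
      a • fderiv ℝ Ψ p (1, 0) + b • fderiv ℝ Ψ p (0, 1) := by
    intro a b
    rw [← map_smul, ← map_smul, ← map_add]
    simp
  have hT := hz.conj_mul_self p.1
  have hTc : ((deriv z p.1).re + (deriv z p.1).im * Complex.I : ℂ) = deriv z p.1 :=
    Complex.re_add_im _
  have hTn := congrArg Complex.re hT
  simp at hTn
  have hJc : (fermiJac z p : ℂ) ≠ 0 := by exact_mod_cast hJ
  -- With T = z', the identity T conj(T) = 1 gives 1 = Re T · T - Im T · iT and i = Im T · T + Re T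
  -- · iT. Dividing the tangential coefficient by J gives the coordinate vectors mapped to 1 and i.
  have e1 : fermiDeriv z p ((deriv z p.1).re / fermiJac z p, -(deriv z p.1).im) = 1 := by
    rw [fermiDeriv_apply]
    apply Complex.ext
    · simp
      field_simp
      linarith
    · simp
      field_simp
      ring
  have e2 : fermiDeriv z p ((deriv z p.1).im / fermiJac z p, (deriv z p.1).re) = Complex.I := by
    rw [fermiDeriv_apply]
    apply Complex.ext
    · simp
      field_simp
      ring
    · simp
      field_simp
      linarith
  constructor
  · rw [toPlane_single, if_pos rfl, ← e1, ← hΨ, hsplit, neg_smul, sub_eq_add_neg]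
  · rw [toPlane_single, if_neg (by decide), ← e2, ← hΨ, hsplit]

theorem contDiffAt_fermiLift (hz : TubeWidth Ω L z ε) {Ψ : ℝ × ℝ → E}
    (hper : ∀ s r, Ψ (s + L, r) = Ψ (s, r)) (hΨ : ContDiffOn ℝ ∞ Ψ (fermiStrip ε))
    {p : ℝ × ℝ} (hp : p ∈ fermiStrip ε) :
    ContDiffAt ℝ ∞ (fermiLift z ε Ψ) (toPlane (fermiMap z p)) :=
  hz.contDiffAt_of_fermi hp (hΨ.contDiffAt ((isOpen_fermiStrip ε).mem_nhds hp))
    (hz.eventually_fermiLift hper hp)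

theorem contDiff_fermiLift (hz : TubeWidth Ω L z ε) {Ψ : ℝ × ℝ → E}
    (hper : ∀ s r, Ψ (s + L, r) = Ψ (s, r)) (hΨ : ContDiffOn ℝ ∞ Ψ (fermiStrip ε)) {a b : ℝ}
    (ha : 0 < a) (hb : b < ε) (hsupp : ∀ p : ℝ × ℝ, p.2 ∉ Icc a b → Ψ p = 0) :
    ContDiff ℝ ∞ (fermiLift z ε Ψ) := by
  rw [contDiff_iff_contDiffAt]
  intro x
  by_cases hx : x ∈ tsupport (fermiLift z ε Ψ)
  · obtain ⟨p, ⟨-, hp⟩, rfl⟩ := hz.tsupport_fermiLift_subset hsupp hx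
    exact hz.contDiffAt_fermiLift hper hΨ ⟨mem_univ _, ha.trans_le hp.1, hp.2.trans_lt hb⟩
  · have h0 : fermiLift z ε Ψ =ᶠ[𝓝 x] fun _ => 0 := by
      filter_upwards [(isClosed_tsupport _).isOpen_compl.mem_nhds hx] with y hy
      exact image_eq_zero_of_notMem_tsupport hy
    exact contDiffAt_const.congr_of_eventuallyEq h0

end TubeWidth

/-! ### The area formula -/

/-- A smooth function which is `1` on `(-∞, w / 3]` and `0` on `[2 w / 3, ∞)`. -/
def cutoff (w r : ℝ) : ℝ := Real.smoothTransition (2 - 3 * r / w)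

theorem contDiff_cutoff (w : ℝ) : ContDiff ℝ ∞ (cutoff w) :=
  Real.smoothTransition.contDiff.comp
    (contDiff_const.sub ((contDiff_const.mul contDiff_id).div_const w))

theorem cutoff_eq_one {w r : ℝ} (hw : 0 < w) (hr : r ≤ w / 3) : cutoff w r = 1 := by
  apply Real.smoothTransition.one_of_one_le
  have : 3 * r / w ≤ 1 := by rw [div_le_one hw]; linarith
  linarith

theorem cutoff_eq_zero {w r : ℝ} (hw : 0 < w) (hr : 2 * w / 3 ≤ r) : cutoff w r = 0 := by
  apply Real.smoothTransition.zero_of_nonpos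
  have : 2 ≤ 3 * r / w := by rw [le_div_iff₀ hw]; linarith
  linarith

theorem cutoff_antitone {w : ℝ} (hw : 0 < w) : Antitone (cutoff w) := fun a b hab =>
  Real.smoothTransition.monotone (by gcongr)

theorem hasDerivAt_cutoff (w r : ℝ) : HasDerivAt (cutoff w) (deriv (cutoff w) r) r :=
  ((contDiff_cutoff w).differentiable (by simp) r).hasDerivAt

theorem deriv_cutoff_nonpos {w : ℝ} (hw : 0 < w) (r : ℝ) : deriv (cutoff w) r ≤ 0 :=
  (cutoff_antitone hw).deriv_nonpos

theorem continuous_deriv_cutoff (w : ℝ) : Continuous (deriv (cutoff w)) :=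
  (contDiff_cutoff w).continuous_deriv (by simp)

theorem integral_deriv_cutoff {w : ℝ} (hw : 0 < w) :
    ∫ r in Ioo 0 w, deriv (cutoff w) r = -1 := by
  rw [← integral_Ioc_eq_integral_Ioo, ← intervalIntegral.integral_of_le hw.le,
    intervalIntegral.integral_eq_sub_of_hasDerivAt (fun r _ => hasDerivAt_cutoff w r)
      ((continuous_deriv_cutoff w).intervalIntegrable _ _),
    cutoff_eq_zero hw (by linarith), cutoff_eq_one hw (by linarith)]
  norm_num

namespace TubeWidth

variable {Ω : Set Plane} {L ε : ℝ} {z : ℝ → ℂ}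

theorem isBounded_innerTube (hΩ : Bornology.IsBounded Ω) (h : ℝ) :
    Bornology.IsBounded (innerTube Ω h) := hΩ.subset fun _ hx => hx.1

theorem volume_innerTube_lt_top (hΩ : Bornology.IsBounded Ω) (h : ℝ) :
    volume (innerTube Ω h) < ⊤ := (isBounded_innerTube hΩ h).measure_lt_top

theorem volume_cell {L h : ℝ} (hL : 0 ≤ L) (hh : 0 ≤ h) : volume.real (cell L h) = L * h := by
  rw [Measure.real, Measure.volume_eq_prod, Measure.prod_prod, Real.volume_Ioc, Real.volume_Ioo,
    ENNReal.toReal_mul, ENNReal.toReal_ofReal (by linarith), ENNReal.toReal_ofReal (by linarith)]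
  ring

theorem volume_cell_lt_top (L h : ℝ) : volume (cell L h) < ⊤ := by
  rw [Measure.volume_eq_prod, Measure.prod_prod, Real.volume_Ioc, Real.volume_Ioo]
  exact ENNReal.mul_lt_top ENNReal.ofReal_lt_top ENNReal.ofReal_lt_top

theorem integrableOn_cell_of_continuousOn {E : Type*} [NormedAddCommGroup E]
    {f : ℝ × ℝ → E} (hf : Continuous f) (L h : ℝ) : IntegrableOn f (cell L h) :=
  (hf.continuousOn.integrableOn_compact (isCompact_Icc.prod isCompact_Icc)).mono_set
    (prod_mono Ioc_subset_Icc_self Ioo_subset_Icc_self)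

theorem volume_innerTube (hz : TubeWidth Ω L z ε) {h : ℝ} (hh : h ≤ ε) :
    volume.real (innerTube Ω h) = ∫ p in cell L h, fermiJac z p := by
  have := hz.setIntegral_innerTube hh (fun _ => (1 : ℝ))
  simpa using this

theorem volume_innerTube_le (hz : TubeWidth Ω L z ε) {h : ℝ} (h0 : 0 ≤ h) (hh : h ≤ ε) :
    volume.real (innerTube Ω h) ≤ 3 / 2 * (L * h) := by
  rw [hz.volume_innerTube hh, ← volume_cell hz.pos.le h0]
  have := setIntegral_mono_on
    (integrableOn_cell_of_continuousOn hz.contDiff_fermiJac.continuous L h)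
    (integrableOn_const (μ := volume) (s := cell L h) (C := (3 / 2 : ℝ))
      (volume_cell_lt_top L h).ne) (measurableSet_cell L h)
    (fun p hp => hz.fermiJac_le ⟨hp.2.1.le, hp.2.2.le.trans hh⟩)
  simpa [mul_comm] using this

theorem volume_innerTube_pos (hz : TubeWidth Ω L z ε) {h : ℝ} (h0 : 0 < h) (hh : h ≤ ε) :
    0 < volume.real (innerTube Ω h) := by
  have h1 := setIntegral_mono_on
    (integrableOn_const (μ := volume) (s := cell L h) (C := (1 / 2 : ℝ))
      (volume_cell_lt_top L h).ne)
    (integrableOn_cell_of_continuousOn hz.contDiff_fermiJac.continuous L h) (measurableSet_cell L h)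
    (fun p hp => hz.half_le_fermiJac ⟨hp.2.1.le, hp.2.2.le.trans hh⟩)
  rw [hz.volume_innerTube hh]
  refine lt_of_lt_of_le ?_ h1
  rw [setIntegral_const, volume_cell hz.pos.le h0.le, smul_eq_mul]
  have := hz.pos
  positivity

/-- The function which is `1` in the interior of `Ω` and is cut off in the tube of width `w`. -/
def interiorCutoff (Ω : Set Plane) (z : ℝ → ℂ) (ε w : ℝ) (x : Plane) : ℝ :=
  Ω.indicator 1 x - fermiLift z ε (fun p => cutoff w p.2) x

theorem interiorCutoff_of_mem_tube (hz : TubeWidth Ω L z ε) (w : ℝ) {p : ℝ × ℝ}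
    (hp : p ∈ fermiStrip ε) :
    interiorCutoff Ω z ε w (toPlane (fermiMap z p)) = 1 - cutoff w p.2 := by
  rw [interiorCutoff, hz.fermiLift_apply (fun _ _ => rfl) hp,
    indicator_of_mem (hz.fermiMap_mem p.1 hp.2)]
  rfl

theorem interiorCutoff_of_notMem (hz : TubeWidth Ω L z ε) (w : ℝ) {x : Plane} (hx : x ∉ Ω) :
    interiorCutoff Ω z ε w x = 0 := by
  rw [interiorCutoff, indicator_of_notMem hx, hz.fermiLift_eq_zero _ fun h => hx h.1, sub_zero]

/-- Deep inside Ω the lift vanishes and the value is 1; away from the closure it is 0. At a frontier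
point the cutoff equals 1 for r ≤ w/3 and cancels the jump of the indicator, so the value is 0 on
both sides. -/
theorem interiorCutoff_eventually_const (hz : TubeWidth Ω L z ε) {w : ℝ} (hw : 0 < w)
    (hwε : w ≤ ε) {x : Plane} (hx : x ∉ innerTube Ω w) :
    ∃ c, interiorCutoff Ω z ε w =ᶠ[𝓝 x] fun _ => c := by
  by_cases hxΩ : x ∈ Ω
  · refine ⟨1, ?_⟩
    -- A closed set containing all points of the tube where the lift is nonzero. A point of K inside
    -- Ω has r > 0 and r ≤ 2w/3 < w, so it would belong to the excluded tube.
    set K := (fun p => toPlane (fermiMap z p)) '' (univ ×ˢ Icc 0 (2 * w / 3)) with hK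
    have hxK : x ∉ K := by
      rintro ⟨⟨s, r⟩, ⟨-, hr⟩, rfl⟩
      rcases hr.1.eq_or_lt with h0 | h0
      · have h1 : toPlane (fermiMap z (s, r)) ∈ frontier Ω := by
          rw [hz.frontier_eq]
          refine ⟨s, ?_⟩
          simp only at h0
          simp [fermiMap, ← h0]
        rw [hz.isOpen.frontier_eq] at h1
        exact h1.2 hxΩ
      · apply hx
        rw [hz.innerTube_eq hwε]
        exact ⟨(s, r), ⟨mem_univ _, h0, by simp only at hr ⊢; linarith [hr.2]⟩, rfl⟩
    filter_upwards [hz.isOpen.mem_nhds hxΩ,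
      (hz.isCompact_fermi_image 0 (2 * w / 3)).isClosed.isOpen_compl.mem_nhds hxK] with y hy hyK
    rw [interiorCutoff, indicator_of_mem hy, Pi.one_apply, sub_eq_self]
    by_cases hyt : y ∈ innerTube Ω ε
    · rw [hz.innerTube_eq le_rfl] at hyt
      obtain ⟨p, hp, rfl⟩ := hyt
      rw [hz.fermiLift_apply (fun _ _ => rfl) hp]
      apply cutoff_eq_zero hw
      by_contra hcon
      push Not at hcon
      exact hyK ⟨p, ⟨mem_univ _, hp.2.1.le, hcon.le⟩, rfl⟩
    · exact hz.fermiLift_eq_zero _ hyt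
  · refine ⟨0, ?_⟩
    by_cases hxf : x ∈ frontier Ω
    · filter_upwards [Metric.ball_mem_nhds x (show 0 < w / 3 by positivity)] with y hy
      by_cases hyΩ : y ∈ Ω
      · have h1 : y ∈ innerTube Ω (w / 3) :=
          ⟨hyΩ, (Metric.infDist_le_dist_of_mem hxf).trans_lt hy⟩
        rw [hz.innerTube_eq (by linarith)] at h1
        obtain ⟨p, ⟨-, hp⟩, rfl⟩ := h1
        rw [hz.interiorCutoff_of_mem_tube w ⟨mem_univ _, hp.1, by linarith [hp.2]⟩,
          cutoff_eq_one hw hp.2.le, sub_self]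
      · exact hz.interiorCutoff_of_notMem w hyΩ
    · have hxc : x ∉ closure Ω := fun h => hxf (by rw [hz.isOpen.frontier_eq]; exact ⟨h, hxΩ⟩)
      filter_upwards [isClosed_closure.isOpen_compl.mem_nhds hxc] with y hy
      exact hz.interiorCutoff_of_notMem w fun h => hy (subset_closure h)

theorem contDiff_interiorCutoff (hz : TubeWidth Ω L z ε) {w : ℝ} (hw : 0 < w)
    (hwε : w ≤ ε) : ContDiff ℝ ∞ (interiorCutoff Ω z ε w) := by
  rw [contDiff_iff_contDiffAt]
  intro x
  by_cases hx : x ∈ innerTube Ω w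
  · rw [hz.innerTube_eq hwε] at hx
    obtain ⟨p, ⟨-, hp⟩, rfl⟩ := hx
    have hp' : p ∈ fermiStrip ε := ⟨mem_univ _, hp.1, hp.2.trans_le hwε⟩
    refine hz.contDiffAt_of_fermi (Ψ := fun p => 1 - cutoff w p.2) hp'
      (contDiff_const.sub ((contDiff_cutoff w).comp contDiff_snd)).contDiffAt ?_
    filter_upwards [(isOpen_fermiStrip ε).mem_nhds hp'] with q hq
    exact hz.interiorCutoff_of_mem_tube w hq
  · obtain ⟨c, hc⟩ := hz.interiorCutoff_eventually_const hw hwε hx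
    exact contDiffAt_const.congr_of_eventuallyEq hc

theorem hasCompactSupport_interiorCutoff (hz : TubeWidth Ω L z ε) (w : ℝ) :
    HasCompactSupport (interiorCutoff Ω z ε w) :=
  HasCompactSupport.intro hz.isBounded.isCompact_closure fun _ hx =>
    hz.interiorCutoff_of_notMem w fun h => hx (subset_closure h)

theorem integral_coord_mul_partialDeriv {φ : Plane → ℝ} (hφ : ContDiff ℝ ∞ φ)
    (hc : HasCompactSupport φ) (j : Fin 2) :
    ∫ x : Plane, x j * partialDeriv j φ x = -∫ x, φ x := by
  set v : Plane := EuclideanSpace.single j 1 with hv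
  set f : Plane → ℝ := fun x => x j with hf
  have hfl : f = (EuclideanSpace.proj j : Plane →L[ℝ] ℝ) := rfl
  have hfd : ∀ x, fderiv ℝ f x v = 1 := by
    intro x
    rw [hfl, ContinuousLinearMap.fderiv]
    simp [hv]
  have hfc : Continuous f := by rw [hfl]; exact ContinuousLinearMap.continuous _
  have hdc : Continuous fun x => fderiv ℝ φ x v :=
    (hφ.continuous_fderiv (by simp)).clm_apply continuous_const
  have hds : HasCompactSupport fun x => fderiv ℝ φ x v := hc.fderiv_apply ℝ v
  have h := integral_mul_fderiv_eq_neg_fderiv_mul_of_integrable (μ := volume) (f := f) (g := φ)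
    (v := v) ?_ ?_ ?_ ?_ ?_
  · simp only [hfd, one_mul] at h
    exact h
  · simp only [hfd, one_mul]
    exact hφ.continuous.integrable_of_hasCompactSupport hc
  · exact (hfc.mul hdc).integrable_of_hasCompactSupport hds.mul_left
  · exact (hfc.mul hφ.continuous).integrable_of_hasCompactSupport hc.mul_left
  · intro x _
    rw [hfl]; exact ContinuousLinearMap.differentiableAt _
  · intro x _
    exact hφ.differentiable (by simp) x

theorem integrable_coord_mul_partialDeriv {φ : Plane → ℝ} (hφ : ContDiff ℝ ∞ φ)
    (hc : HasCompactSupport φ) (j : Fin 2) :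
    Integrable fun x : Plane => x j * partialDeriv j φ x := by
  have hdc : Continuous fun x => fderiv ℝ φ x (EuclideanSpace.single j 1) :=
    (hφ.continuous_fderiv (by simp)).clm_apply continuous_const
  have hds : HasCompactSupport fun x => fderiv ℝ φ x (EuclideanSpace.single j 1) :=
    hc.fderiv_apply ℝ _
  have hfc : Continuous fun x : Plane => x j := (EuclideanSpace.proj j : Plane →L[ℝ] ℝ).continuous
  exact (hfc.mul hdc).integrable_of_hasCompactSupport hds.mul_left

theorem partialDeriv_interiorCutoff_of_notMem (hz : TubeWidth Ω L z ε) {w : ℝ} (hw : 0 < w)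
    (hwε : w ≤ ε) (j : Fin 2) {x : Plane} (hx : x ∉ innerTube Ω w) :
    partialDeriv j (interiorCutoff Ω z ε w) x = 0 := by
  obtain ⟨c, hc⟩ := hz.interiorCutoff_eventually_const hw hwε hx
  rw [partialDeriv, hc.fderiv_eq]
  simp

/-- The cutoff depends on r alone, so its gradient is -`cutoff`'(r) iT, and the position vector z +
r iT has component r - `sweepRate` along iT. -/
theorem sum_coord_mul_partialDeriv_interiorCutoff (hz : TubeWidth Ω L z ε) {w : ℝ} (hw : 0 < w)
    (hwε : w ≤ ε) {p : ℝ × ℝ} (hp : p ∈ fermiStrip ε) :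
    ∑ j, toPlane (fermiMap z p) j *
      partialDeriv j (interiorCutoff Ω z ε w) (toPlane (fermiMap z p)) =
      deriv (cutoff w) p.2 * (sweepRate z p.1 - p.2) := by
  have hs : HasFDerivAt (fun p : ℝ × ℝ => 1 - cutoff w p.2) _ p :=
    (HasFDerivAt.comp p (hasDerivAt_cutoff w p.2).hasFDerivAt hasFDerivAt_snd).const_sub 1
  obtain ⟨h0, h1⟩ := hz.fderiv_single_of_fermi (ψ := interiorCutoff Ω z ε w)
    (Ψ := fun p => 1 - cutoff w p.2) hp
    ((hz.contDiff_interiorCutoff hw hwε).differentiable (by simp) _) (by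
      filter_upwards [(isOpen_fermiStrip ε).mem_nhds hp] with q hq
      exact hz.interiorCutoff_of_mem_tube w hq)
  have hT := congrArg Complex.re (hz.conj_mul_self p.1)
  simp at hT
  rw [Fin.sum_univ_two, partialDeriv, partialDeriv, h0, h1, hs.fderiv, toPlane_zero, toPlane_one]
  simp [fermiMap, sweepRate]
  linear_combination (-(deriv (cutoff w) p.2) * p.2) * hT

/-- The area formula `2 |Ω| = ∮ x dy - y dx`. -/
theorem sweep_eq (hz : TubeWidth Ω L z ε) : sweep z L = 2 * volume.real Ω := by
  obtain ⟨M, hM0, hM⟩ := hz.exists_curvature_bound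
  obtain ⟨B, hB0, hB⟩ := hz.periodic_sweepRate.exists_norm_le hz.pos
    hz.contDiff_sweepRate.continuous
  have hL := hz.pos
  -- Apply the identity ∫ x · ∇φ = -2 ∫ φ to the interior cutoff of width w. The left side is
  -- -`sweep z L` up to (1 + Mε + MB) L w, from replacing J (`sweepRate` - r) by `sweepRate`. The
  -- right side is -2|Ω| up to 3 L w, twice the bound for the area of the tube. Then w tends to 0.
  have key : ∀ w, 0 < w → w ≤ ε →
      |sweep z L - 2 * volume.real Ω| ≤ ((1 + M * ε + M * B) * L + 3 * L) * w := by
    intro w hw hwε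
    set φ := interiorCutoff Ω z ε w with hφ
    have hφs := hz.contDiff_interiorCutoff hw hwε
    have hφc := hz.hasCompactSupport_interiorCutoff w
    have h1 : ∫ x : Plane, ∑ j, x j * partialDeriv j φ x = -2 * ∫ x, φ x := by
      rw [integral_finsetSum _ fun j _ => integrable_coord_mul_partialDeriv hφs hφc j,
        Fin.sum_univ_two, integral_coord_mul_partialDeriv hφs hφc,
        integral_coord_mul_partialDeriv hφs hφc]
      ring
    have h2 : ∫ x : Plane, ∑ j, x j * partialDeriv j φ x =
        ∫ p in cell L w, fermiJac z p * (deriv (cutoff w) p.2 * (sweepRate z p.1 - p.2)) := by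
      rw [← setIntegral_eq_integral_of_forall_compl_eq_zero (s := innerTube Ω w) fun x hx =>
        Finset.sum_eq_zero fun j _ => by
          rw [hz.partialDeriv_interiorCutoff_of_notMem hw hwε j hx, mul_zero],
        hz.setIntegral_innerTube hwε]
      refine setIntegral_congr_fun (measurableSet_cell L w) fun p hp => ?_
      simp only [smul_eq_mul]
      rw [hz.sum_coord_mul_partialDeriv_interiorCutoff hw hwε
        ⟨mem_univ _, hp.2.1, hp.2.2.trans_le hwε⟩]
    have hcd := continuous_deriv_cutoff w
    have hcs := hz.contDiff_sweepRate.continuous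
    have hcJ := hz.contDiff_fermiJac.continuous
    have h3 : ∫ p in cell L w, sweepRate z p.1 * deriv (cutoff w) p.2 = -sweep z L := by
      rw [Measure.volume_eq_prod, setIntegral_prod_mul, integral_deriv_cutoff hw,
        ← intervalIntegral.integral_of_le hL.le, sweep]
      ring
    have h4 : ∫ p in cell L w, (-deriv (cutoff w) p.2) * ((1 + M * ε + M * B) * w) =
        (1 + M * ε + M * B) * L * w := by
      rw [integral_mul_const]
      have : ∫ p in cell L w, (-deriv (cutoff w) p.2) =
          ∫ p in cell L w, (-1 : ℝ) * deriv (cutoff w) p.2 := by simp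
      rw [this, Measure.volume_eq_prod, setIntegral_prod_mul (fun _ : ℝ => (-1 : ℝ)),
        integral_deriv_cutoff hw]
      simp [hL.le]
      ring
    have h5 : |(∫ p in cell L w, fermiJac z p * (deriv (cutoff w) p.2 * (sweepRate z p.1 - p.2))) -
        ∫ p in cell L w, sweepRate z p.1 * deriv (cutoff w) p.2| ≤
        (1 + M * ε + M * B) * L * w := by
      rw [← integral_sub (integrableOn_cell_of_continuousOn (by fun_prop) L w)
        (integrableOn_cell_of_continuousOn (by fun_prop) L w), ← h4, ← Real.norm_eq_abs]
      refine norm_integral_le_of_norm_le (integrableOn_cell_of_continuousOn (by fun_prop) L w) ?_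
      refine (ae_restrict_iff' (measurableSet_cell L w)).2 (Eventually.of_forall fun p hp => ?_)
      have hr0 : 0 < p.2 := hp.2.1
      have hrw : p.2 < w := hp.2.2
      have e : fermiJac z p * (deriv (cutoff w) p.2 * (sweepRate z p.1 - p.2)) -
          sweepRate z p.1 * deriv (cutoff w) p.2 = (-deriv (cutoff w) p.2) *
            (p.2 * (1 - p.2 * curvature z p.1 + curvature z p.1 * sweepRate z p.1)) := by
        rw [fermiJac]; ring
      have hκ := hM p.1
      have hb : |sweepRate z p.1| ≤ B := hB p.1
      rw [e, Real.norm_eq_abs, abs_mul,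
        abs_of_nonneg (neg_nonneg.2 (deriv_cutoff_nonpos hw p.2)), abs_mul, abs_of_pos hr0]
      have e2 : |1 - p.2 * curvature z p.1 + curvature z p.1 * sweepRate z p.1| ≤
          1 + M * ε + M * B := by
        refine (abs_add_le _ _).trans (add_le_add ((abs_sub _ _).trans ?_) ?_)
        · rw [abs_one, abs_mul, abs_of_pos hr0, mul_comm M]
          exact add_le_add le_rfl
            (mul_le_mul (hrw.le.trans hwε) hκ (abs_nonneg _) (hw.le.trans hwε))
        · rw [abs_mul]; gcongr
      rw [mul_comm _ w]
      have := deriv_cutoff_nonpos hw p.2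
      gcongr
      linarith
    have hΩfin : volume Ω ≠ ⊤ := hz.isBounded.measure_lt_top.ne
    have h6 : |volume.real Ω - ∫ x, φ x| ≤ 3 / 2 * (L * w) := by
      have e1 : volume.real Ω = ∫ x, Ω.indicator 1 x := by
        rw [integral_indicator_one hz.isOpen.measurableSet]
      have hi1 : Integrable (Ω.indicator (1 : Plane → ℝ)) :=
        (integrable_indicator_iff hz.isOpen.measurableSet).2
          (integrableOn_const hΩfin)
      rw [e1, ← integral_sub hi1 (hφs.continuous.integrable_of_hasCompactSupport hφc)]
      have e2 : ∀ x, Ω.indicator 1 x - φ x = fermiLift z ε (fun p => cutoff w p.2) x := fun x => by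
        rw [hφ, interiorCutoff]; ring
      rw [integral_congr_ae (Eventually.of_forall e2)]
      have e3 : ∀ x, x ∉ innerTube Ω w → fermiLift z ε (fun p => cutoff w p.2) x = 0 := by
        intro x hx
        by_cases hxt : x ∈ innerTube Ω ε
        · rw [hz.innerTube_eq le_rfl] at hxt
          obtain ⟨p, hp, rfl⟩ := hxt
          rw [hz.fermiLift_apply (fun _ _ => rfl) hp]
          apply cutoff_eq_zero hw
          by_contra hcon
          push Not at hcon
          apply hx
          rw [hz.innerTube_eq hwε]
          exact ⟨p, ⟨mem_univ _, hp.2.1, by linarith⟩, rfl⟩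
        · exact hz.fermiLift_eq_zero _ hxt
      rw [← setIntegral_eq_integral_of_forall_compl_eq_zero e3, ← Real.norm_eq_abs]
      refine (norm_setIntegral_le_of_norm_le_const (C := 1)
        (volume_innerTube_lt_top hz.isBounded w) fun x _ => ?_).trans
        (by rw [one_mul]; exact hz.volume_innerTube_le hw.le hwε)
      rw [fermiLift]
      split_ifs
      · rw [Real.norm_eq_abs, cutoff, abs_of_nonneg (Real.smoothTransition.nonneg _)]
        exact Real.smoothTransition.le_one _
      · simp
    rw [← h2, h1, h3] at h5
    rw [abs_le] at h5 h6 ⊢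
    constructor <;> linarith [h5.1, h5.2, h6.1, h6.2]
  have hε := hz.width_pos
  by_contra hne
  have hpos : 0 < |sweep z L - 2 * volume.real Ω| := abs_pos.2 (sub_ne_zero.2 hne)
  set C := (1 + M * ε + M * B) * L + 3 * L with hC
  have hC0 : 0 < C := by positivity
  have h := key (min ε (|sweep z L - 2 * volume.real Ω| / (2 * C))) (by positivity) (min_le_left _ _)
  have h' : C * min ε (|sweep z L - 2 * volume.real Ω| / (2 * C)) ≤
      |sweep z L - 2 * volume.real Ω| / 2 := by
    calc _ ≤ C * (|sweep z L - 2 * volume.real Ω| / (2 * C)) := by gcongr; exact min_le_right _ _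
      _ = _ := by field_simp
  linarith

end TubeWidth

/-! ### The total curvature -/

/-- A continuous angle starting at 0 and ending below 0 would take some value in (-π, 0), where the
sine is negative. Capping the target at -π/2 from below keeps that value in the range. -/
theorem nonneg_of_sin_nonneg {f : ℝ → ℝ} {a b : ℝ} (hab : a ≤ b) (hf : ContinuousOn f (Icc a b))
    (ha : f a = 0) (hs : ∀ x ∈ Icc a b, 0 ≤ Real.sin (f x)) : 0 ≤ f b := by
  by_contra hcon
  push Not at hcon
  have hv : max (f b) (-(Real.pi / 2)) ∈ Icc (f b) (f a) := by
    rw [ha]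
    exact ⟨le_max_left _ _, max_le hcon.le (by linarith [Real.pi_pos])⟩
  obtain ⟨x, hx, hfx⟩ := intermediate_value_Icc' hab hf hv
  have h1 := hs x hx
  rw [hfx] at h1
  have h2 : Real.sin (max (f b) (-(Real.pi / 2))) < 0 := by
    apply Real.sin_neg_of_neg_of_neg_pi_lt
    · exact max_lt hcon (by linarith [Real.pi_pos])
    · exact lt_max_of_lt_right (by linarith [Real.pi_pos])
  linarith

/-- The average of the derivative of `z` over `[s, s + w]`. -/
def meanDeriv (z : ℝ → ℂ) (p : ℝ × ℝ) : ℂ := ∫ x in (0 : ℝ)..1, deriv z (p.1 + p.2 * x)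

/-- A positive multiple of the secant vector from `s` to `s + w`, extended by the tangent vectors
for `w = 0` and `w = L`. -/
def secantField (L : ℝ) (z : ℝ → ℂ) (p : ℝ × ℝ) : ℂ :=
  meanDeriv z p - meanDeriv z (p.1 + p.2, L - p.2)

namespace ArcCurve

variable {L : ℝ} {z : ℝ → ℂ}

theorem continuous_meanDeriv (hz : ArcCurve L z) : Continuous (meanDeriv z) := by
  have := hz.contDiff_deriv.continuous
  exact intervalIntegral.continuous_parametric_intervalIntegral_of_continuous' (by fun_prop) 0 1

theorem mul_meanDeriv (hz : ArcCurve L z) (s w : ℝ) :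
    w * meanDeriv z (s, w) = z (s + w) - z s := by
  have h := intervalIntegral.smul_integral_comp_add_mul (a := 0) (b := 1) (deriv z) w s
  rw [meanDeriv, ← Complex.real_smul, h, mul_zero, add_zero, mul_one]
  exact intervalIntegral.integral_eq_sub_of_hasDerivAt (fun x _ => hz.hasDerivAt x)
    (hz.contDiff_deriv.continuous.intervalIntegrable _ _)

theorem meanDeriv_zero (z : ℝ → ℂ) (s : ℝ) : meanDeriv z (s, 0) = deriv z s := by
  simp [meanDeriv]

theorem meanDeriv_period (hz : ArcCurve L z) (s : ℝ) : meanDeriv z (s, L) = 0 := by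
  have h := hz.mul_meanDeriv s L
  rw [hz.periodic, sub_self, mul_eq_zero] at h
  exact h.resolve_left (by exact_mod_cast hz.pos.ne')

theorem continuous_secantField (hz : ArcCurve L z) : Continuous (secantField L z) :=
  hz.continuous_meanDeriv.sub (hz.continuous_meanDeriv.comp (by fun_prop))

theorem secantField_zero (hz : ArcCurve L z) (s : ℝ) : secantField L z (s, 0) = deriv z s := by
  simp [secantField, meanDeriv_zero, hz.meanDeriv_period]

theorem secantField_period (hz : ArcCurve L z) (s : ℝ) :
    secantField L z (s, L) = -deriv z s := by
  simp [secantField, meanDeriv_zero, hz.meanDeriv_period, hz.periodic_deriv s]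

/-- By periodicity the mean of z' over the complementary arc is -(z(s + w) - z(s))/(L - w).
Subtracting it from the mean over [s, s + w] adds two positive multiples of the secant, while
remaining continuous up to w = 0 and w = L. -/
theorem secantField_eq (hz : ArcCurve L z) (s : ℝ) {w : ℝ} (hw : w ∈ Ioo 0 L) :
    secantField L z (s, w) = ((1 / w + 1 / (L - w) : ℝ) : ℂ) * (z (s + w) - z s) := by
  have h1 := hz.mul_meanDeriv s w
  have h2 := hz.mul_meanDeriv (s + w) (L - w)
  have e : s + w + (L - w) = s + L := by ring
  rw [e, hz.periodic] at h2
  have hw0 : (w : ℂ) ≠ 0 := by exact_mod_cast hw.1.ne'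
  have hw1 : ((L - w : ℝ) : ℂ) ≠ 0 := by exact_mod_cast (sub_pos.2 hw.2).ne'
  have h1' : meanDeriv z (s, w) = (z (s + w) - z s) / w := by rw [← h1]; field_simp
  have h2' : meanDeriv z (s + w, L - w) = (z s - z (s + w)) / (L - w : ℝ) := by
    rw [← h2]; field_simp
  rw [secantField, h1', h2']
  push_cast at hw1 ⊢
  field_simp
  ring

theorem secantField_ne_zero (hz : ArcCurve L z) (s : ℝ) {w : ℝ} (hw : w ∈ Icc 0 L) :
    secantField L z (s, w) ≠ 0 := by
  rcases hw.1.eq_or_lt with rfl | h0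
  · rw [hz.secantField_zero]; exact hz.deriv_ne_zero s
  rcases hw.2.eq_or_lt with rfl | h1
  · rw [hz.secantField_period]; exact neg_ne_zero.2 (hz.deriv_ne_zero s)
  rw [hz.secantField_eq s ⟨h0, h1⟩]
  refine mul_ne_zero ?_ ?_
  · have : 0 < 1 / w + 1 / (L - w) := by
      have := sub_pos.2 h1
      positivity
    exact_mod_cast this.ne'
  · intro h
    obtain ⟨n, hn⟩ := hz.inj _ _ (sub_eq_zero.1 h)
    have hL := hz.pos
    have h2 : (n : ℝ) * L = -w := by linarith
    have h3 : (-1 : ℝ) < n := by nlinarith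
    have h4 : (n : ℝ) < 0 := by nlinarith
    have h5 : -1 < n := by exact_mod_cast h3
    have h6 : n < 0 := by exact_mod_cast h4
    omega

/-- A continuous determination of the angle of the secants. -/
theorem exists_angle (hz : ArcCurve L z) {s₀ : ℝ} (h0 : deriv z s₀ = 1) :
    ∃ θ : ℝ × ℝ → ℝ, Continuous θ ∧ θ (s₀, 0) = 0 ∧ ∀ s, ∀ w ∈ Icc 0 L,
      ((Circle.exp (θ (s, w)) : Circle) : ℂ) =
        secantField L z (s, w) / ‖secantField L z (s, w)‖ := by
  have hL := hz.pos
  -- Clamping w to [0, L] makes the field continuous and nonvanishing on the whole plane, which is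
  -- simply connected, so its direction lifts through the covering `Circle.exp`.
  set g : ℝ × ℝ → ℂ := fun p => secantField L z (p.1, projIcc 0 L hL.le p.2) with hg
  have hgc : Continuous g := hz.continuous_secantField.comp
    (continuous_fst.prodMk (continuous_subtype_val.comp (continuous_projIcc.comp continuous_snd)))
  have hg0 : ∀ p, g p ≠ 0 := fun p => hz.secantField_ne_zero p.1 (projIcc 0 L hL.le p.2).2
  have hn0 : ∀ p, (‖g p‖ : ℂ) ≠ 0 := fun p => by exact_mod_cast norm_ne_zero_iff.2 (hg0 p)
  have hmem : ∀ p, g p / ‖g p‖ ∈ Submonoid.unitSphere ℂ := fun p => by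
    rw [Submonoid.unitSphere, Submonoid.mem_mk, Subsemigroup.mem_mk, mem_sphere_zero_iff_norm,
      norm_div, Complex.norm_real, norm_norm, div_self]
    exact norm_ne_zero_iff.2 (hg0 p)
  set f : C(ℝ × ℝ, Circle) := ⟨fun p => ⟨g p / ‖g p‖, hmem p⟩,
    Continuous.subtype_mk (hgc.div (Complex.continuous_ofReal.comp hgc.norm) hn0) _⟩ with hf
  have hfc : ∀ p, (f p : ℂ) = g p / ‖g p‖ := fun p => rfl
  have hgw : ∀ s, ∀ w ∈ Icc 0 L, g (s, w) = secantField L z (s, w) := fun s w hw => by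
    simp only [hg, projIcc_of_mem hL.le hw]
  obtain ⟨θ, ⟨h1, h2⟩, -⟩ := Circle.isCoveringMap_exp.existsUnique_continuousMap_lifts f (s₀, 0)
    (0 : ℝ) (by
      rw [Circle.ext_iff, hfc, hgw _ _ ⟨le_rfl, hL.le⟩, hz.secantField_zero, h0]
      simp)
  refine ⟨θ, θ.continuous, h1, fun s w hw => ?_⟩
  have := congrFun h2 (s, w)
  simp only [Function.comp] at this
  rw [this, hfc, hgw s w hw]

/-- By the Frenet equation, z' multiplied by exp(-i · `turning`) has zero derivative. -/
theorem deriv_eq_exp_turning (hz : ArcCurve L z) (s t : ℝ) :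
    deriv z t = Complex.exp ((turning z t - turning z s : ℝ) * Complex.I) * deriv z s := by
  have h : ∀ t, HasDerivAt (fun t => Complex.exp (-(turning z t : ℂ) * Complex.I) * deriv z t)
      0 t := by
    intro t
    have h1 : HasDerivAt (fun t => (turning z t : ℂ)) (curvature z t) t :=
      (hz.hasDerivAt_turning t).ofReal_comp
    have h2 := ((h1.neg.mul_const Complex.I).cexp).mul (hz.hasDerivAt_deriv t)
    refine h2.congr_deriv ?_
    ring
  have hconst := is_const_of_deriv_eq_zero (fun t => (h t).differentiableAt)
    (fun t => (h t).deriv) t s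
  have e1 : Complex.exp ((turning z t : ℂ) * Complex.I) *
      Complex.exp (-(turning z t : ℂ) * Complex.I) = 1 := by
    rw [← Complex.exp_add]; simp
  have e2 : Complex.exp ((turning z t - turning z s : ℝ) * Complex.I) =
      Complex.exp ((turning z t : ℂ) * Complex.I) * Complex.exp (-(turning z s : ℂ) * Complex.I) := by
    rw [← Complex.exp_add]; congr 1; push_cast; ring
  rw [e2, mul_assoc, ← hconst, ← mul_assoc, e1, one_mul]

end ArcCurve

/-- A lowest point of the closure of Ω is on the boundary and has a horizontal tangent. The inward
normal there cannot point down, which selects z' = 1 rather than -1. -/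
theorem BoundaryCurve.exists_bottom {Ω : Set Plane} {L : ℝ} {z : ℝ → ℂ}
    (hz : BoundaryCurve Ω L z) : ∃ s₀, deriv z s₀ = 1 ∧ ∀ t, (z s₀).im ≤ (z t).im := by
  have hmemf : ∀ t, toPlane (z t) ∈ frontier Ω := fun t => by
    rw [hz.frontier_eq]; exact mem_range_self t
  have hmem : ∀ t, toPlane (z t) ∈ closure Ω := fun t => frontier_subset_closure (hmemf t)
  have hcoord : Continuous fun x : Plane => x 1 := (EuclideanSpace.proj 1 : Plane →L[ℝ] ℝ).continuous
  obtain ⟨p, hp, hmin⟩ := hz.isBounded.isCompact_closure.exists_isMinOn ⟨_, hmem 0⟩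
    hcoord.continuousOn
  have hpf : p ∈ frontier Ω := by
    rw [hz.isOpen.frontier_eq]
    refine ⟨hp, fun hpΩ => ?_⟩
    obtain ⟨w, rfl⟩ := toPlane.surjective p
    have hc : Continuous fun r : ℝ => toPlane (w - r * Complex.I) := by
      have := toPlane.continuous
      fun_prop
    have h1 : ∀ᶠ r : ℝ in 𝓝[>] 0, toPlane (w - r * Complex.I) ∈ Ω := by
      have := hc.tendsto 0
      simp only [Complex.ofReal_zero, zero_mul, sub_zero] at this
      exact (this.mono_left nhdsWithin_le_nhds).eventually (hz.isOpen.mem_nhds hpΩ)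
    obtain ⟨r, hr, hr0⟩ := (h1.and self_mem_nhdsWithin).exists
    have h2 := hmin (subset_closure hr)
    simp only [mem_ofPred_eq, toPlane_one] at h2
    simp at h2
    have : (0 : ℝ) < r := hr0
    linarith
  rw [hz.frontier_eq] at hpf
  obtain ⟨s₀, rfl⟩ := hpf
  have hm : ∀ w, toPlane w ∈ closure Ω → (z s₀).im ≤ w.im := fun w hw => by
    have := hmin hw
    simpa [toPlane_one] using this
  refine ⟨s₀, ?_, fun t => hm _ (hmem t)⟩
  have him : (deriv z s₀).im = 0 := by
    have hl : IsLocalMin (fun t => (z t).im) s₀ := Eventually.of_forall fun t => hm _ (hmem t)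
    exact hl.hasDerivAt_eq_zero (ArcCurve.hasDerivAt_im (hz.hasDerivAt s₀))
  have hre : 0 ≤ (deriv z s₀).re := by
    obtain ⟨r, hr, hr0⟩ := ((hz.inward s₀).and self_mem_nhdsWithin).exists
    have h1 := hm _ (subset_closure hr)
    have hr0' : (0 : ℝ) < r := hr0
    simp at h1
    exact nonneg_of_mul_nonneg_right h1 hr0'
  have hn := congrArg Complex.re (hz.conj_mul_self s₀)
  simp [him] at hn
  apply Complex.ext
  · rcases mul_self_eq_one_iff.1 hn with h | h
    · simpa using h
    · linarith
  · simpa using him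

/-- Hopf's argument, keeping only the sign. The rotation of the tangent from s₀ to s₀ + L is the
variation of the secant angle from (s₀, 0) to (s₀ + L, 0), which may be computed along a path
through (s₀, L). With s₀ a lowest point, the secants on each leg stay in a closed half-plane, so
neither leg contributes negatively. -/
theorem BoundaryCurve.turning_nonneg {Ω : Set Plane} {L : ℝ} {z : ℝ → ℂ}
    (hz : BoundaryCurve Ω L z) : 0 ≤ turning z L := by
  obtain ⟨s₀, h0, hmin⟩ := hz.exists_bottom
  obtain ⟨θ, hθc, hθ0, hθ⟩ := hz.exists_angle h0
  have hL := hz.pos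
  have hsin : ∀ s, ∀ w ∈ Icc 0 L, Real.sin (θ (s, w)) =
      (secantField L z (s, w)).im / ‖secantField L z (s, w)‖ := by
    intro s w hw
    have := congrArg Complex.im (hθ s w hw)
    rw [Circle.coe_exp, Complex.exp_ofReal_mul_I_im, Complex.div_ofReal_im] at this
    exact this
  have him : ∀ s, ∀ w ∈ Icc 0 L, (deriv z s).im = 0 ∨ w ∈ Ioo 0 L →
      ∃ c : ℝ, 0 ≤ c ∧ (secantField L z (s, w)).im = c * ((z (s + w)).im - (z s).im) := by
    intro s w hw hor
    by_cases hw' : w ∈ Ioo 0 L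
    · refine ⟨1 / w + 1 / (L - w), ?_, ?_⟩
      · have := hw'.1
        have := sub_pos.2 hw'.2
        positivity
      · rw [hz.secantField_eq s hw', Complex.im_ofReal_mul, Complex.sub_im]
    · refine ⟨0, le_rfl, ?_⟩
      have hd := hor.resolve_right hw'
      have : w = 0 ∨ w = L := by
        by_contra hcon
        push Not at hcon
        exact hw' ⟨hw.1.lt_of_ne' hcon.1, hw.2.lt_of_ne hcon.2⟩
      rcases this with rfl | rfl
      · rw [hz.secantField_zero, hd]; simp
      · rw [hz.secantField_period, Complex.neg_im, hd]; simp
  -- Secants issuing from the lowest point point upwards.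
  have hleg1 : 0 ≤ θ (s₀, L) := by
    refine nonneg_of_sin_nonneg (f := fun w => θ (s₀, w)) hL.le
      (hθc.comp (by fun_prop)).continuousOn hθ0 fun w hw => ?_
    obtain ⟨c, hc, he⟩ := him s₀ w hw (Or.inl (by simp [h0]))
    rw [hsin s₀ w hw, he]
    exact div_nonneg (mul_nonneg hc (sub_nonneg.2 (hmin _))) (norm_nonneg _)
  have hcos : Complex.exp (θ (s₀, L) * Complex.I) = -1 := by
    have := hθ s₀ L ⟨hL.le, le_rfl⟩
    rw [hz.secantField_period, h0, Circle.coe_exp] at this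
    simpa using this
  -- Secants ending at the lowest point point downwards; subtracting θ(s₀, L), whose exponential is
  -- -1, changes the sign of the sine.
  have hleg2 : 0 ≤ θ (s₀ + L, 0) - θ (s₀, L) := by
    have := nonneg_of_sin_nonneg (f := fun s => θ (s, s₀ + L - s) - θ (s₀, L))
      (a := s₀) (b := s₀ + L) (by linarith) ((hθc.comp (by fun_prop)).sub continuous_const).continuousOn
      (by simp) fun s hs => ?_
    · simpa using this
    have hw : s₀ + L - s ∈ Icc 0 L := ⟨by linarith [hs.2], by linarith [hs.1]⟩
    have hc' := congrArg Complex.re hcos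
    have hs' := congrArg Complex.im hcos
    rw [Complex.exp_ofReal_mul_I_re] at hc'
    rw [Complex.exp_ofReal_mul_I_im] at hs'
    simp at hc' hs'
    rw [Real.sin_sub, hc', hs', hsin s _ hw]
    have hor : (deriv z s).im = 0 ∨ s₀ + L - s ∈ Ioo 0 L := by
      rcases hs.1.eq_or_lt with rfl | h1
      · left; simp [h0]
      rcases hs.2.eq_or_lt with rfl | h2
      · left; simp [hz.periodic_deriv s₀, h0]
      · right; exact ⟨by linarith, by linarith⟩
    obtain ⟨c, hc, he⟩ := him s _ hw hor
    have e : s + (s₀ + L - s) = s₀ + L := by ring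
    rw [e, hz.periodic] at he
    rw [he]
    have := mul_nonneg hc (sub_nonneg.2 (hmin s))
    have h3 : 0 ≤ -(c * ((z s₀).im - (z s).im)) := by linarith
    have h4 := div_nonneg h3 (norm_nonneg (secantField L z (s, s₀ + L - s)))
    rw [neg_div] at h4
    linarith
  -- Both sides lift the tangent direction and vanish at s₀, so uniqueness of lifts makes them
  -- equal.
  have hlift : (fun s => θ (s, 0)) = fun s => turning z s - turning z s₀ := by
    refine Circle.isCoveringMap_exp.eq_of_comp_eq (hθc.comp (by fun_prop))
      (hz.contDiff_turning.continuous.sub continuous_const) ?_ s₀ (by simp [hθ0])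
    funext s
    simp only [Function.comp]
    rw [Circle.ext_iff, hθ s 0 ⟨le_rfl, hL.le⟩, hz.secantField_zero, hz.unit, Circle.coe_exp,
      hz.deriv_eq_exp_turning s₀ s, h0]
    simp
  have := congrFun hlift (s₀ + L)
  simp only [hz.turning_add] at this
  linarith

/-! ### Fourier series: the isoperimetric inequality and a weighted Parseval formula -/

/-- Wirtinger's inequality for the coordinates of a closed curve with unit speed. -/
theorem ArcCurve.wirtinger {L : ℝ} {z : ℝ → ℂ} (hz : ArcCurve L z) :
    ∃ c : ℂ, ∫ s in (0 : ℝ)..L, ‖z s - c‖ ^ 2 ≤ L ^ 3 / (4 * Real.pi ^ 2) := by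
  have hL := hz.pos
  set c := fourierCoeffOn hL z 0 with hc
  refine ⟨c, ?_⟩
  set f : ℝ → ℂ := fun s => z s - c with hf
  have hzc := hz.smooth.continuous
  have hfc : Continuous f := hzc.sub continuous_const
  have hdc := hz.contDiff_deriv.continuous
  have hmem : ∀ {g : ℝ → ℂ}, Continuous g → MemLp g 2 (volume.restrict (Ioc 0 L)) := fun hg =>
    (memLp_two_iff_integrable_sq_norm hg.aestronglyMeasurable).2
      ((hg.norm.pow 2).integrableOn_Icc.mono_set Ioc_subset_Icc_self)
  have h1 := hasSum_sq_fourierCoeffOn hL (hmem hfc)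
  have h2 := hasSum_sq_fourierCoeffOn hL (hmem hdc)
  have h0 : fourierCoeffOn hL f 0 = 0 := by
    have e := fourierCoeffOn_eq_integral f 0 hL
    have e' := fourierCoeffOn_eq_integral z 0 hL
    simp only [neg_zero, fourier_zero, one_smul, sub_zero] at e e'
    rw [e, hf, intervalIntegral.integral_sub (hzc.intervalIntegrable _ _)
      intervalIntegrable_const, smul_sub, ← e', ← hc]
    rw [intervalIntegral.integral_const, smul_smul, sub_zero, one_div, inv_mul_cancel₀ hL.ne',
      one_smul, sub_self]
  -- For n ≠ 0 integration by parts gives the factor L/(2π|n|) ≤ L/(2π), the boundary term vanishing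
  -- by periodicity. The case n = 0 is why the mean c was subtracted.
  have hle : ∀ n : ℤ, ‖fourierCoeffOn hL f n‖ ^ 2 ≤
      (L / (2 * Real.pi)) ^ 2 * ‖fourierCoeffOn hL (deriv z) n‖ ^ 2 := by
    intro n
    by_cases hn : n = 0
    · rw [hn, h0]; simp; positivity
    · have hd := fourierCoeffOn_of_hasDerivAt hL hn (f := f) (f' := deriv z)
        (fun x _ => (hz.hasDerivAt x).sub_const c) (hdc.intervalIntegrable _ _)
      have hper : f L - f 0 = 0 := by
        have := hz.periodic 0
        rw [zero_add] at this
        simp [hf, this]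
      rw [hper, mul_zero, zero_sub] at hd
      have hn1 : (1 : ℝ) ≤ |(n : ℝ)| := by
        have : (1 : ℤ) ≤ |n| := Int.one_le_abs hn
        exact_mod_cast this
      have hnorm : ‖fourierCoeffOn hL f n‖ =
          L / (2 * Real.pi * |(n : ℝ)|) * ‖fourierCoeffOn hL (deriv z) n‖ := by
        rw [hd]
        simp only [norm_mul, norm_neg, norm_div, norm_one, Complex.norm_I, Complex.norm_real,
          Complex.norm_intCast, Complex.ofReal_zero, sub_zero, Real.norm_eq_abs,
          abs_of_pos Real.pi_pos, abs_of_pos hL]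
        simp
        ring
      rw [hnorm, mul_pow]
      have hπ := Real.pi_pos
      have hle : L / (2 * Real.pi * |(n : ℝ)|) ≤ L / (2 * Real.pi) :=
        div_le_div_of_nonneg_left hL.le (by positivity) (by nlinarith)
      gcongr
  have h3 := hasSum_le hle h1 (h2.mul_left _)
  simp only [hz.unit, sub_zero, smul_eq_mul] at h3
  simp only [one_pow, intervalIntegral.integral_const, sub_zero, smul_eq_mul, mul_one,
    inv_mul_cancel₀ hL.ne'] at h3
  rw [inv_mul_le_iff₀ hL] at h3
  refine h3.trans (le_of_eq ?_)
  have := Real.pi_pos.ne'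
  field_simp
  ring

/-- Hurwitz's proof. Translating by the mean c does not change the swept area; unit speed bounds the
integrand by |z - c| ≤ (π/L)|z - c|² + L/(4π). Wirtinger's inequality makes the integrals of both
terms at most L²/(4π). -/
theorem ArcCurve.sweep_le {L : ℝ} {z : ℝ → ℂ} (hz : ArcCurve L z) :
    sweep z L ≤ L ^ 2 / (2 * Real.pi) := by
  obtain ⟨c, hc⟩ := hz.wirtinger
  have hL := hz.pos
  have hπ := Real.pi_pos
  have hzc := hz.smooth.continuous
  have hdc := hz.contDiff_deriv.continuous
  have h1 : sweep z L = ∫ s in (0 : ℝ)..L, (conj (z s - c) * deriv z s).im := by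
    have hd : ∀ s, HasDerivAt (fun s => (conj c * z s).im) (conj c * deriv z s).im s := fun s =>
      ArcCurve.hasDerivAt_im ((hz.hasDerivAt s).const_mul _)
    have h0 : ∫ s in (0 : ℝ)..L, (conj c * deriv z s).im = 0 := by
      rw [intervalIntegral.integral_eq_sub_of_hasDerivAt (fun s _ => hd s)
        ((Complex.continuous_im.comp (continuous_const.mul hdc)).intervalIntegrable _ _)]
      have := hz.periodic 0
      rw [zero_add] at this
      rw [this, sub_self]
    have e : ∀ s, (conj (z s - c) * deriv z s).im = sweepRate z s - (conj c * deriv z s).im := by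
      intro s
      rw [map_sub, sub_mul, Complex.sub_im, sweepRate]
    have hi : IntervalIntegrable (fun s => (conj c * deriv z s).im) volume 0 L :=
      (Complex.continuous_im.comp (continuous_const.mul hdc)).intervalIntegrable _ _
    simp only [e]
    rw [intervalIntegral.integral_sub (hz.contDiff_sweepRate.continuous.intervalIntegrable _ _) hi,
      h0, sub_zero, sweep]
  have hcc : Continuous fun s => z s - c := hzc.sub continuous_const
  have h2 : ∫ s in (0 : ℝ)..L, (conj (z s - c) * deriv z s).im ≤
      ∫ s in (0 : ℝ)..L, (Real.pi / L * ‖z s - c‖ ^ 2 + L / (4 * Real.pi)) := by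
    refine intervalIntegral.integral_mono_on hL.le
      ((Complex.continuous_im.comp ((Complex.continuous_conj.comp hcc).mul
        hdc)).intervalIntegrable _ _)
      (((continuous_const.mul (hcc.norm.pow 2)).add continuous_const).intervalIntegrable _ _)
      fun s _ => ?_
    have h3 : (conj (z s - c) * deriv z s).im ≤ ‖z s - c‖ := by
      refine (Complex.im_le_norm _).trans ?_
      rw [norm_mul, hz.unit, mul_one, RCLike.norm_conj]
    refine h3.trans ?_
    have h4 : 0 ≤ Real.pi / L * (‖z s - c‖ - L / (2 * Real.pi)) ^ 2 := by positivity
    have h5 : Real.pi / L * (‖z s - c‖ - L / (2 * Real.pi)) ^ 2 =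
        Real.pi / L * ‖z s - c‖ ^ 2 + L / (4 * Real.pi) - ‖z s - c‖ := by
      field_simp
      ring
    linarith
  rw [h1]
  refine h2.trans ?_
  have hi : IntervalIntegrable (fun s => Real.pi / L * ‖z s - c‖ ^ 2) volume 0 L :=
    (continuous_const.mul (hcc.norm.pow 2)).intervalIntegrable _ _
  rw [intervalIntegral.integral_add hi intervalIntegrable_const,
    intervalIntegral.integral_const_mul, intervalIntegral.integral_const, sub_zero, smul_eq_mul]
  have h6 : Real.pi / L * ∫ s in (0 : ℝ)..L, ‖z s - c‖ ^ 2 ≤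
      Real.pi / L * (L ^ 3 / (4 * Real.pi ^ 2)) := by gcongr
  have h7 : Real.pi / L * (L ^ 3 / (4 * Real.pi ^ 2)) + L * (L / (4 * Real.pi)) =
      L ^ 2 / (2 * Real.pi) := by
    field_simp
    ring
  linarith

/-- The isoperimetric inequality. -/
theorem TubeWidth.isoperimetric {Ω : Set Plane} {L ε : ℝ} {z : ℝ → ℂ} (hz : TubeWidth Ω L z ε) :
    4 * Real.pi * volume.real Ω ≤ L ^ 2 := by
  have h := hz.sweep_le
  rw [hz.sweep_eq, le_div_iff₀ (by positivity)] at h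
  linarith

/-- Parseval's formula for the exponentials of a reparametrized interval. -/
theorem hasSum_sq_weighted_fourier {ℓ J : ℝ → ℝ} {L : ℝ} (hL : 0 < L)
    (hℓ : ∀ s, HasDerivAt ℓ (J s) s) (hJc : Continuous J) (hJ : ∀ s, 0 < J s) (h0 : ℓ 0 = 0)
    {f : ℝ → ℂ} (hf : MemLp f 2 (volume.restrict (Ioc 0 L))) :
    HasSum (fun n : ℤ => ‖∫ s in Ioc 0 L,
        J s • (Complex.exp (-(2 * Real.pi * n * ℓ s / ℓ L : ℝ) * Complex.I) * f s)‖ ^ 2)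
      (ℓ L * ∫ s in Ioc 0 L, J s • ‖f s‖ ^ 2) := by
  have hmono : StrictMono ℓ := strictMono_of_deriv_pos fun s => by rw [(hℓ s).deriv]; exact hJ s
  have hℓc : Continuous ℓ := continuous_iff_continuousAt.2 fun s => (hℓ s).continuousAt
  set Λ := ℓ L with hΛ
  have hΛ0 : 0 < Λ := by rw [← h0]; exact hmono hL
  have himg : ℓ '' Ioc 0 L = Ioc 0 Λ := by
    apply Subset.antisymm
    · rintro _ ⟨s, hs, rfl⟩
      exact ⟨by rw [← h0]; exact hmono hs.1, hmono.monotone hs.2⟩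
    · have := intermediate_value_Ioc hL.le hℓc.continuousOn
      rwa [h0] at this
  set σ := Function.invFun ℓ with hσ
  have hσℓ : ∀ s, σ (ℓ s) = s := Function.leftInverse_invFun hmono.injective
  have hchange : ∀ g : ℝ → ℂ, ∫ y in Ioc 0 Λ, g y = ∫ s in Ioc 0 L, J s • g (ℓ s) := by
    intro g
    rw [← himg, integral_image_eq_integral_abs_deriv_smul measurableSet_Ioc
      (fun s _ => (hℓ s).hasDerivWithinAt) hmono.injective.injOn]
    simp only [abs_of_pos (hJ _)]
  have hchangeR : ∀ g : ℝ → ℝ, ∫ y in Ioc 0 Λ, g y = ∫ s in Ioc 0 L, J s • g (ℓ s) := by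
    intro g
    rw [← himg, integral_image_eq_integral_abs_deriv_smul measurableSet_Ioc
      (fun s _ => (hℓ s).hasDerivWithinAt) hmono.injective.injOn]
    simp only [abs_of_pos (hJ _)]
  obtain ⟨C, hC⟩ := isCompact_Icc.exists_bound_of_continuousOn (s := Icc 0 L) hJc.continuousOn
  have hCae : ∀ᵐ s ∂(volume.restrict (Ioc 0 L)), ‖J s‖ ≤ C :=
    (ae_restrict_iff' measurableSet_Ioc).2 (Eventually.of_forall fun s hs =>
      hC s (Ioc_subset_Icc_self hs))
  have hfi : IntegrableOn f (Ioc 0 L) := hf.integrable (by norm_num)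
  have hFi : IntegrableOn (fun y => f (σ y)) (Ioc 0 Λ) := by
    rw [← himg, integrableOn_image_iff_integrableOn_abs_deriv_smul measurableSet_Ioc
      (fun s _ => (hℓ s).hasDerivWithinAt) hmono.injective.injOn]
    simp only [abs_of_pos (hJ _), hσℓ]
    exact hfi.bdd_smul (𝕜 := ℝ) C hJc.aestronglyMeasurable hCae
  have hFi2 : IntegrableOn (fun y => ‖f (σ y)‖ ^ 2) (Ioc 0 Λ) := by
    rw [← himg, integrableOn_image_iff_integrableOn_abs_deriv_smul measurableSet_Ioc
      (fun s _ => (hℓ s).hasDerivWithinAt) hmono.injective.injOn]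
    simp only [abs_of_pos (hJ _), hσℓ]
    exact ((memLp_two_iff_integrable_sq_norm hf.1).1 hf).bdd_smul (𝕜 := ℝ) C hJc.aestronglyMeasurable hCae
  have hF : MemLp (fun y => f (σ y)) 2 (volume.restrict (Ioc 0 Λ)) :=
    (memLp_two_iff_integrable_sq_norm hFi.aestronglyMeasurable).2 hFi2
  have hP := (hasSum_sq_fourierCoeffOn hΛ0 hF).mul_left (Λ ^ 2)
  rw [intervalIntegral.integral_of_le hΛ0.le, hchangeR] at hP
  simp only [hσℓ, sub_zero, smul_eq_mul] at hP ⊢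
  have hval : Λ ^ 2 * (Λ⁻¹ * ∫ s in Ioc 0 L, J s * ‖f s‖ ^ 2) =
      Λ * ∫ s in Ioc 0 L, J s * ‖f s‖ ^ 2 := by field_simp
  rw [hval] at hP
  refine (congrArg (fun F : ℤ → ℝ => HasSum F _) (funext fun n => ?_)).mp hP
  symm
  rw [fourierCoeffOn_eq_integral, intervalIntegral.integral_of_le hΛ0.le, hchange]
  simp only [hσℓ, sub_zero]
  rw [norm_smul, mul_pow, Real.norm_eq_abs, abs_of_pos (by positivity : (0 : ℝ) < 1 / Λ), ← mul_assoc,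
    ← mul_pow, mul_one_div_cancel hΛ0.ne', one_pow, one_mul]
  congr 2
  refine integral_congr_ae (Eventually.of_forall fun s => ?_)
  simp only [smul_eq_mul, fourier_coe_apply]
  congr 3
  push_cast
  ring

/-- If the Fourier coefficients of `g` dominate `√lam` times those of `f`, then so do the norms. -/
theorem weighted_norm_le_of_coeff_le {ℓ J : ℝ → ℝ} {L lam : ℝ} (hL : 0 < L)
    (hℓ : ∀ s, HasDerivAt ℓ (J s) s) (hJc : Continuous J) (hJ : ∀ s, 0 < J s) (h0 : ℓ 0 = 0)
    {f g : ℝ → ℂ} (hf : MemLp f 2 (volume.restrict (Ioc 0 L)))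
    (hg : MemLp g 2 (volume.restrict (Ioc 0 L)))
    (hc : ∀ n : ℤ, lam * ‖∫ s in Ioc 0 L,
        J s • (Complex.exp (-(2 * Real.pi * n * ℓ s / ℓ L : ℝ) * Complex.I) * f s)‖ ^ 2 ≤
      ‖∫ s in Ioc 0 L,
        J s • (Complex.exp (-(2 * Real.pi * n * ℓ s / ℓ L : ℝ) * Complex.I) * g s)‖ ^ 2) :
    lam * ∫ s in Ioc 0 L, J s • ‖f s‖ ^ 2 ≤ ∫ s in Ioc 0 L, J s • ‖g s‖ ^ 2 := by
  have hmono : StrictMono ℓ := strictMono_of_deriv_pos fun s => by rw [(hℓ s).deriv]; exact hJ s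
  have hΛ0 : 0 < ℓ L := by rw [← h0]; exact hmono hL
  have h := hasSum_le hc ((hasSum_sq_weighted_fourier hL hℓ hJc hJ h0 hf).mul_left lam)
    (hasSum_sq_weighted_fourier hL hℓ hJc hJ h0 hg)
  refine le_of_mul_le_mul_left ?_ hΛ0
  linarith

/-! ### Sobolev functions in Fermi coordinates -/

namespace TubeWidth

variable {Ω : Set Plane} {L ε h : ℝ} {z : ℝ → ℂ}

theorem cell_subset (L h : ℝ) : cell L h ⊆ Icc 0 L ×ˢ Icc 0 h :=
  prod_mono Ioc_subset_Icc_self Ioo_subset_Icc_self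

theorem isCompact_Icc_prod_Icc (L h : ℝ) : IsCompact (Icc (0 : ℝ) L ×ˢ Icc (0 : ℝ) h) :=
  isCompact_Icc.prod isCompact_Icc

theorem integrableOn_mul {k f : ℝ × ℝ → ℂ} (hk : ContinuousOn k (Icc 0 L ×ˢ Icc 0 h))
    (hf : IntegrableOn f (cell L h)) : IntegrableOn (fun p => k p * f p) (cell L h) :=
  hf.continuousOn_mul_of_subset hk (isCompact_Icc_prod_Icc L h) (measurableSet_cell L h)
    (cell_subset L h)

theorem integrableOn_smul {E : Type*} [NormedAddCommGroup E] [NormedSpace ℝ E] {k : ℝ × ℝ → ℝ}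
    {f : ℝ × ℝ → E} (hk : ContinuousOn k (Icc 0 L ×ˢ Icc 0 h))
    (hf : IntegrableOn f (cell L h)) : IntegrableOn (fun p => k p • f p) (cell L h) := by
  obtain ⟨C, hC⟩ := (isCompact_Icc_prod_Icc L h).exists_bound_of_continuousOn hk
  exact Integrable.bdd_smul (𝕜 := ℝ) hf C
    ((hk.mono (cell_subset L h)).aestronglyMeasurable (measurableSet_cell L h))
    ((ae_restrict_iff' (measurableSet_cell L h)).2 (Eventually.of_forall fun p hp =>
      hC p (cell_subset L h hp)))

theorem memLp_mul {k f : ℝ × ℝ → ℂ} (hk : ContinuousOn k (Icc 0 L ×ˢ Icc 0 h))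
    (hf : MemLp f 2 (volume.restrict (cell L h))) :
    MemLp (fun p => k p * f p) 2 (volume.restrict (cell L h)) := by
  refine (memLp_two_iff_integrable_sq_norm
    (((hk.mono (cell_subset L h)).aestronglyMeasurable (measurableSet_cell L h)).mul hf.1)).2 ?_
  have := integrableOn_smul (hk.norm.pow 2) ((memLp_two_iff_integrable_sq_norm hf.1).1 hf)
  simp only [smul_eq_mul, Pi.pow_apply] at this
  simp only [Pi.mul_apply, norm_mul, mul_pow]
  exact this

theorem continuousOn_inv_fermiJac (hz : TubeWidth Ω L z ε) (hh : h ≤ ε) :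
    ContinuousOn (fun p => (fermiJac z p)⁻¹) (Icc 0 L ×ˢ Icc 0 h) :=
  hz.contDiff_fermiJac.continuous.continuousOn.inv₀ fun _ hp =>
    (hz.fermiJac_pos ⟨hp.2.1, hp.2.2.trans hh⟩).ne'

theorem integrableOn_comp_fermi (hz : TubeWidth Ω L z ε) (hh : h ≤ ε)
    {E : Type*} [NormedAddCommGroup E] [NormedSpace ℝ E] {f : Plane → E}
    (hf : IntegrableOn f (innerTube Ω h)) :
    IntegrableOn (fun p => f (toPlane (fermiMap z p))) (cell L h) := by
  have h1 := integrableOn_smul (hz.continuousOn_inv_fermiJac hh)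
    ((hz.integrableOn_innerTube_iff hh f).1 hf)
  refine (integrableOn_congr_fun (fun p hp => ?_) (measurableSet_cell L h)).1 h1
  rw [smul_smul, inv_mul_cancel₀ (hz.fermiJac_pos ⟨hp.2.1.le, hp.2.2.le.trans hh⟩).ne', one_smul]

theorem memLp_comp_fermi (hz : TubeWidth Ω L z ε) (hh : h ≤ ε) {f : Plane → ℂ}
    (hf : MemLp f 2 (volume.restrict (innerTube Ω h))) :
    MemLp (fun p => f (toPlane (fermiMap z p))) 2 (volume.restrict (cell L h)) := by
  have : IsFiniteMeasure (volume.restrict (innerTube Ω h)) :=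
    ⟨by rw [Measure.restrict_apply_univ]; exact volume_innerTube_lt_top hz.isBounded h⟩
  refine (memLp_two_iff_integrable_sq_norm
    (hz.integrableOn_comp_fermi hh (hf.integrable (by norm_num))).aestronglyMeasurable).2 ?_
  exact hz.integrableOn_comp_fermi hh ((memLp_two_iff_integrable_sq_norm hf.1).1 hf)

theorem integrableOn_of_memLp (hΩ : Bornology.IsBounded Ω) {f : Plane → ℂ}
    (hf : MemLp f 2 (volume.restrict (innerTube Ω h))) : IntegrableOn f (innerTube Ω h) := by
  have : IsFiniteMeasure (volume.restrict (innerTube Ω h)) :=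
    ⟨by rw [Measure.restrict_apply_univ]; exact volume_innerTube_lt_top hΩ h⟩
  exact hf.integrable (by norm_num)

theorem hasDerivAt_re_deriv (hz : ArcCurve L z) (s : ℝ) :
    HasDerivAt (fun s => (deriv z s).re) (-(curvature z s * (deriv z s).im)) s :=
  (ArcCurve.hasDerivAt_re (hz.hasDerivAt_deriv s)).congr_deriv (by simp)

theorem hasDerivAt_im_deriv (hz : ArcCurve L z) (s : ℝ) :
    HasDerivAt (fun s => (deriv z s).im) (curvature z s * (deriv z s).re) s :=
  (ArcCurve.hasDerivAt_im (hz.hasDerivAt_deriv s)).congr_deriv (by simp)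

/-- The divergence of a tangential field with density `Ψ`, in Fermi coordinates. -/
theorem divergence_tangential (hz : TubeWidth Ω L z ε) {Ψ : ℝ × ℝ → ℝ} (hΨ : ContDiff ℝ ∞ Ψ)
    {φ₀ φ₁ : Plane → ℝ} {p : ℝ × ℝ} (hp : p ∈ fermiStrip ε)
    (h0 : DifferentiableAt ℝ φ₀ (toPlane (fermiMap z p)))
    (h1 : DifferentiableAt ℝ φ₁ (toPlane (fermiMap z p)))
    (e0 : ∀ᶠ q in 𝓝 p, φ₀ (toPlane (fermiMap z q)) = (deriv z q.1).re * Ψ q)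
    (e1 : ∀ᶠ q in 𝓝 p, φ₁ (toPlane (fermiMap z q)) = (deriv z q.1).im * Ψ q) :
    fermiJac z p * (partialDeriv 0 φ₀ (toPlane (fermiMap z p)) +
      partialDeriv 1 φ₁ (toPlane (fermiMap z p))) = fderiv ℝ Ψ p (1, 0) := by
  have hd : HasFDerivAt Ψ (fderiv ℝ Ψ p) p := (hΨ.differentiable (by simp) p).hasFDerivAt
  have hd0 : HasFDerivAt (fun q : ℝ × ℝ => (deriv z q.1).re * Ψ q) _ p :=
    (HasFDerivAt.comp p (hasDerivAt_re_deriv hz.toArcCurve p.1).hasFDerivAt hasFDerivAt_fst).mul hd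
  have hd1 : HasFDerivAt (fun q : ℝ × ℝ => (deriv z q.1).im * Ψ q) _ p :=
    (HasFDerivAt.comp p (hasDerivAt_im_deriv hz.toArcCurve p.1).hasFDerivAt hasFDerivAt_fst).mul hd
  have hJ : fermiJac z p ≠ 0 := (hz.fermiJac_pos ⟨hp.2.1.le, hp.2.2.le⟩).ne'
  have hT := congrArg Complex.re (hz.conj_mul_self p.1)
  simp at hT
  rw [partialDeriv, partialDeriv, (hz.fderiv_single_of_fermi hp h0 e0).1,
    (hz.fderiv_single_of_fermi hp h1 e1).2, hd0.fderiv, hd1.fderiv]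
  -- The derivative of the frame contributes nothing, since T' = κ iT is orthogonal to T, and the
  -- normal derivatives of Ψ cancel between the two components.
  simp
  field_simp
  linear_combination (fderiv ℝ Ψ p (1, 0)) * hT

/-- The weak derivative along the boundary, tested with real functions. -/
theorem weak_tangential_real (hz : TubeWidth Ω L z ε) (hh : h ≤ ε) {u : Plane → ℂ}
    {g : Fin 2 → Plane → ℂ} (hu : IsH1WithGradient (innerTube Ω h) u g) {Ψ : ℝ × ℝ → ℝ}
    (hΨ : ContDiff ℝ ∞ Ψ) (hper : ∀ s r, Ψ (s + L, r) = Ψ (s, r)) {a b : ℝ} (ha : 0 < a)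
    (hb : b < h) (hsupp : ∀ p : ℝ × ℝ, p.2 ∉ Icc a b → Ψ p = 0) :
    ∫ p in cell L h, u (toPlane (fermiMap z p)) * (fderiv ℝ Ψ p (1, 0) : ℂ) =
      -∫ p in cell L h, fermiJac z p • (((deriv z p.1).re * g 0 (toPlane (fermiMap z p)) +
        (deriv z p.1).im * g 1 (toPlane (fermiMap z p))) * (Ψ p : ℂ)) := by
  -- The test functions are the two Cartesian components of the tangential field ΨT, so the sum of
  -- the two weak identities involves its divergence.
  set Ψ₀ : ℝ × ℝ → ℝ := fun p => (deriv z p.1).re * Ψ p with hΨ₀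
  set Ψ₁ : ℝ × ℝ → ℝ := fun p => (deriv z p.1).im * Ψ p with hΨ₁
  have hc0 : ContDiff ℝ ∞ Ψ₀ :=
    (Complex.reCLM.contDiff.comp (hz.contDiff_deriv.comp contDiff_fst)).mul hΨ
  have hc1 : ContDiff ℝ ∞ Ψ₁ :=
    (Complex.imCLM.contDiff.comp (hz.contDiff_deriv.comp contDiff_fst)).mul hΨ
  have hp0 : ∀ s r, Ψ₀ (s + L, r) = Ψ₀ (s, r) := fun s r => by
    simp only [hΨ₀, hz.periodic_deriv s, hper]
  have hp1 : ∀ s r, Ψ₁ (s + L, r) = Ψ₁ (s, r) := fun s r => by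
    simp only [hΨ₁, hz.periodic_deriv s, hper]
  have hs0 : ∀ p : ℝ × ℝ, p.2 ∉ Icc a b → Ψ₀ p = 0 := fun p hp => by simp [hΨ₀, hsupp p hp]
  have hs1 : ∀ p : ℝ × ℝ, p.2 ∉ Icc a b → Ψ₁ p = 0 := fun p hp => by simp [hΨ₁, hsupp p hp]
  set φ₀ := fermiLift z ε Ψ₀ with hφ₀
  set φ₁ := fermiLift z ε Ψ₁ with hφ₁
  have hd0 : ContDiff ℝ ∞ φ₀ := hz.contDiff_fermiLift hp0 hc0.contDiffOn ha (hb.trans_le hh) hs0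
  have hd1 : ContDiff ℝ ∞ φ₁ := hz.contDiff_fermiLift hp1 hc1.contDiffOn ha (hb.trans_le hh) hs1
  have hk0 : HasCompactSupport φ₀ := hz.hasCompactSupport_fermiLift hs0
  have hk1 : HasCompactSupport φ₁ := hz.hasCompactSupport_fermiLift hs1
  have w0 := hu.weakPartial 0 φ₀ hd0 hk0 (hz.tsupport_fermiLift_subset_innerTube ha hb hh hs0)
  have w1 := hu.weakPartial 1 φ₁ hd1 hk1 (hz.tsupport_fermiLift_subset_innerTube ha hb hh hs1)
  have hint : ∀ {f : Plane → ℂ} {k : Plane → ℝ}, MemLp f 2 (volume.restrict (innerTube Ω h)) →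
      Continuous k → HasCompactSupport k → IntegrableOn (fun x => f x * (k x : ℂ))
        (innerTube Ω h) := by
    intro f k hf hk hkc
    obtain ⟨C, hC⟩ := hk.bounded_above_of_compact_support hkc
    exact Integrable.mul_bdd (integrableOn_of_memLp hz.isBounded hf)
      (Complex.continuous_ofReal.comp hk).aestronglyMeasurable
      (Eventually.of_forall fun x => by rw [Complex.norm_real]; exact hC x)
  have hpc : ∀ {φ : Plane → ℝ} (j : Fin 2), ContDiff ℝ ∞ φ → Continuous (partialDeriv j φ) :=
    fun j hφ => (hφ.continuous_fderiv (by simp)).clm_apply continuous_const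
  have hpk : ∀ {φ : Plane → ℝ} (j : Fin 2), HasCompactSupport φ →
      HasCompactSupport (partialDeriv j φ) := fun j hφ => hφ.fderiv_apply ℝ _
  have hsum : ∫ x in innerTube Ω h, u x * ((partialDeriv 0 φ₀ x + partialDeriv 1 φ₁ x : ℝ) : ℂ) =
      -∫ x in innerTube Ω h, (g 0 x * (φ₀ x : ℂ) + g 1 x * (φ₁ x : ℂ)) := by
    rw [integral_add (hint (hu.gradient_memLp 0) hd0.continuous hk0)
      (hint (hu.gradient_memLp 1) hd1.continuous hk1), neg_add, ← w0, ← w1,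
      ← integral_add (hint hu.memLp (hpc 0 hd0) (hpk 0 hk0))
        (hint hu.memLp (hpc 1 hd1) (hpk 1 hk1))]
    refine integral_congr_ae (Eventually.of_forall fun x => ?_)
    simp only
    push_cast
    ring
  rw [hz.setIntegral_innerTube hh, hz.setIntegral_innerTube hh] at hsum
  have hstrip : ∀ p ∈ cell L h, p ∈ fermiStrip ε := fun p hp =>
    ⟨mem_univ _, hp.2.1, hp.2.2.trans_le hh⟩
  refine Eq.trans ?_ (hsum.trans ?_)
  · refine setIntegral_congr_fun (measurableSet_cell L h) fun p hp => ?_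
    have := hz.divergence_tangential hΨ (hstrip p hp) (hd0.differentiable (by simp) _)
      (hd1.differentiable (by simp) _) (hz.eventually_fermiLift hp0 (hstrip p hp))
      (hz.eventually_fermiLift hp1 (hstrip p hp))
    rw [← this, Complex.real_smul]
    push_cast
    ring
  · congr 1
    refine setIntegral_congr_fun (measurableSet_cell L h) fun p hp => ?_
    simp only [hφ₀, hφ₁]
    rw [hz.fermiLift_apply hp0 (hstrip p hp), hz.fermiLift_apply hp1 (hstrip p hp)]
    simp only [hΨ₀, hΨ₁]
    push_cast
    ring_nf

/-- The weak derivative along the boundary. -/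
theorem weak_tangential (hz : TubeWidth Ω L z ε) (hh : h ≤ ε) {u : Plane → ℂ}
    {g : Fin 2 → Plane → ℂ} (hu : IsH1WithGradient (innerTube Ω h) u g) {Ψ : ℝ × ℝ → ℂ}
    (hΨ : ContDiff ℝ ∞ Ψ) (hper : ∀ s r, Ψ (s + L, r) = Ψ (s, r)) {a b : ℝ} (ha : 0 < a)
    (hb : b < h) (hsupp : ∀ p : ℝ × ℝ, p.2 ∉ Icc a b → Ψ p = 0) :
    ∫ p in cell L h, u (toPlane (fermiMap z p)) * fderiv ℝ Ψ p (1, 0) =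
      -∫ p in cell L h, fermiJac z p • (((deriv z p.1).re * g 0 (toPlane (fermiMap z p)) +
        (deriv z p.1).im * g 1 (toPlane (fermiMap z p))) * Ψ p) := by
  have hre : ContDiff ℝ ∞ fun p => (Ψ p).re := Complex.reCLM.contDiff.comp hΨ
  have him : ContDiff ℝ ∞ fun p => (Ψ p).im := Complex.imCLM.contDiff.comp hΨ
  have w0 := hz.weak_tangential_real hh hu hre (fun s r => by rw [hper]) ha hb
    (fun p hp => by rw [hsupp p hp]; rfl)
  have w1 := hz.weak_tangential_real hh hu him (fun s r => by rw [hper]) ha hb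
    (fun p hp => by rw [hsupp p hp]; rfl)
  have hd : ∀ p, HasFDerivAt Ψ (fderiv ℝ Ψ p) p := fun p =>
    (hΨ.differentiable (by simp) p).hasFDerivAt
  have e0 : ∀ p, fderiv ℝ (fun p => (Ψ p).re) p (1, 0) = (fderiv ℝ Ψ p (1, 0)).re := fun p => by
    rw [HasFDerivAt.fderiv (f := fun p => (Ψ p).re) (Complex.reCLM.hasFDerivAt.comp p (hd p))]; rfl
  have e1 : ∀ p, fderiv ℝ (fun p => (Ψ p).im) p (1, 0) = (fderiv ℝ Ψ p (1, 0)).im := fun p => by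
    rw [HasFDerivAt.fderiv (f := fun p => (Ψ p).im) (Complex.imCLM.hasFDerivAt.comp p (hd p))]; rfl
  simp only [e0] at w0
  simp only [e1] at w1
  have hU : IntegrableOn (fun p => u (toPlane (fermiMap z p))) (cell L h) :=
    hz.integrableOn_comp_fermi hh (integrableOn_of_memLp hz.isBounded hu.memLp)
  have hG : ∀ j, IntegrableOn (fun p => g j (toPlane (fermiMap z p))) (cell L h) := fun j =>
    hz.integrableOn_comp_fermi hh (integrableOn_of_memLp hz.isBounded (hu.gradient_memLp j))
  have hTc := hz.contDiff_deriv.continuous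
  have hG' : IntegrableOn (fun p : ℝ × ℝ => ((deriv z p.1).re : ℂ) * g 0 (toPlane (fermiMap z p)) +
      (deriv z p.1).im * g 1 (toPlane (fermiMap z p))) (cell L h) :=
    (integrableOn_mul (k := fun p : ℝ × ℝ => ((deriv z p.1).re : ℂ))
      (Continuous.continuousOn (by fun_prop)) (hG 0)).add
    (integrableOn_mul (k := fun p : ℝ × ℝ => ((deriv z p.1).im : ℂ))
      (Continuous.continuousOn (by fun_prop)) (hG 1))
  have hdc : Continuous fun p => fderiv ℝ Ψ p (1, 0) :=
    (hΨ.continuous_fderiv (by simp)).clm_apply continuous_const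
  have hΨc := hΨ.continuous
  have hJc : Continuous (fermiJac z) := hz.contDiff_fermiJac.continuous
  have hmul : ∀ {f : ℝ × ℝ → ℂ} {k : ℝ × ℝ → ℝ}, IntegrableOn f (cell L h) → Continuous k →
      IntegrableOn (fun p => f p * (k p : ℂ)) (cell L h) := fun {f k} hf hk => by
    have := integrableOn_mul (k := fun p => (k p : ℂ))
      (Complex.continuous_ofReal.comp hk).continuousOn hf
    simpa only [mul_comm] using this
  have hΨre : Continuous fun p => (Ψ p).re := Complex.continuous_re.comp hΨc
  have hΨim : Continuous fun p => (Ψ p).im := Complex.continuous_im.comp hΨc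
  have hdre : Continuous fun p => (fderiv ℝ Ψ p (1, 0)).re := Complex.continuous_re.comp hdc
  have hdim : Continuous fun p => (fderiv ℝ Ψ p (1, 0)).im := Complex.continuous_im.comp hdc
  have s1 : ∫ p in cell L h, u (toPlane (fermiMap z p)) * fderiv ℝ Ψ p (1, 0) =
      (∫ p in cell L h, u (toPlane (fermiMap z p)) * ((fderiv ℝ Ψ p (1, 0)).re : ℂ)) +
        Complex.I * ∫ p in cell L h,
          u (toPlane (fermiMap z p)) * ((fderiv ℝ Ψ p (1, 0)).im : ℂ) := by
    rw [← integral_const_mul, ← integral_add (hmul hU hdre)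
      ((hmul hU hdim).const_mul _)]
    refine integral_congr_ae (Eventually.of_forall fun p => ?_)
    simp only
    nth_rewrite 1 [← Complex.re_add_im (fderiv ℝ Ψ p (1, 0))]
    ring
  rw [s1, w0, w1, mul_neg, ← neg_add, ← integral_const_mul]
  congr 1
  rw [← integral_add (integrableOn_smul hJc.continuousOn
      (hmul hG' hΨre))
    ((integrableOn_smul hJc.continuousOn (hmul hG' hΨim)).const_mul _)]
  refine integral_congr_ae (Eventually.of_forall fun p => ?_)
  simp only [Complex.real_smul]
  nth_rewrite 3 [← Complex.re_add_im (Ψ p)]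
  ring

end TubeWidth

/-! ### The lower bound -/

/-- The circulation of the potential along the curve at distance `r` from the boundary. -/
def fiberFlux (β L : ℝ) (z : ℝ → ℂ) (r : ℝ) : ℝ :=
  β / 2 * (sweep z L - 2 * r * L + r ^ 2 * turning z L)

/-- The length of the curve at distance `r` from the boundary. -/
def fiberLength (L : ℝ) (z : ℝ → ℂ) (r : ℝ) : ℝ := L - r * turning z L

/-- The `n`-th magnetic frequency of the curve at distance `r` from the boundary. -/
def fiberMode (β L : ℝ) (z : ℝ → ℂ) (n : ℤ) (r : ℝ) : ℝ :=
  (2 * Real.pi * n - fiberFlux β L z r) / fiberLength L z r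

/-- The phase of the magnetic eigenfunction with frequency `m r` along the curve at
distance `r`. -/
def magPhase (β : ℝ) (z : ℝ → ℂ) (m : ℝ → ℝ) (p : ℝ × ℝ) : ℝ :=
  β / 2 * (sweep z p.1 - 2 * p.2 * p.1 + p.2 * (tangentialPart z p.1 - tangentialPart z 0) +
    p.2 ^ 2 * turning z p.1) + m p.2 * (p.1 - p.2 * turning z p.1)

namespace ArcCurve

variable {L : ℝ} {z : ℝ → ℂ}

/-- The derivative is J times the sum of the tangential potential and m(r). Hence the exponential of
i times this phase is an eigenfunction of the tangential magnetic derivative; the terms of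
`magPhase` are the primitives of the terms of this product. -/
theorem hasDerivAt_magPhase (hz : ArcCurve L z) (β : ℝ) (m : ℝ → ℝ) (s r : ℝ) :
    HasDerivAt (fun s => magPhase β z m (s, r))
      (fermiJac z (s, r) * (β / 2 * (sweepRate z s - r) + m r)) s := by
  have h1 := hz.hasDerivAt_sweep s
  have h2 := (hasDerivAt_id' s).const_mul (2 * r)
  have h3 := ((hz.hasDerivAt_tangentialPart s).sub_const (tangentialPart z 0)).const_mul r
  have h4 := hz.hasDerivAt_turning s
  have h5 := ((((h1.sub h2).add h3).add (h4.const_mul (r ^ 2))).const_mul (β / 2)).add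
    (((hasDerivAt_id' s).sub (h4.const_mul r)).const_mul (m r))
  refine h5.congr_deriv ?_
  simp only [fermiJac]
  ring

theorem contDiffAt_magPhase (hz : ArcCurve L z) (β : ℝ) {m : ℝ → ℝ} {p : ℝ × ℝ}
    (hm : ContDiffAt ℝ ∞ m p.2) : ContDiffAt ℝ ∞ (magPhase β z m) p := by
  have h1 : ContDiffAt ℝ ∞ (fun p : ℝ × ℝ => sweep z p.1) p :=
    (hz.contDiff_sweep.comp contDiff_fst).contDiffAt
  have h2 : ContDiffAt ℝ ∞ (fun p : ℝ × ℝ => tangentialPart z p.1) p :=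
    (hz.contDiff_tangentialPart.comp contDiff_fst).contDiffAt
  have h3 : ContDiffAt ℝ ∞ (fun p : ℝ × ℝ => turning z p.1) p :=
    (hz.contDiff_turning.comp contDiff_fst).contDiffAt
  have h4 : ContDiffAt ℝ ∞ (fun p : ℝ × ℝ => m p.2) p := hm.comp p contDiffAt_snd
  have hx : ContDiffAt ℝ ∞ (fun p : ℝ × ℝ => p.1) p := contDiffAt_fst
  have hy : ContDiffAt ℝ ∞ (fun p : ℝ × ℝ => p.2) p := contDiffAt_snd
  exact (contDiffAt_const.mul (((h1.sub ((contDiffAt_const.mul hy).mul hx)).add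
    (hy.mul (h2.sub contDiffAt_const))).add ((hy.pow 2).mul h3))).add (h4.mul (hx.sub (hy.mul h3)))

/-- The increment of the phase over one period is `fiberFlux` + m · `fiberLength`; `fiberMode` is
the value of m that makes it 2πn, so that the exponential closes up. -/
theorem magPhase_add (hz : ArcCurve L z) (β : ℝ) (n : ℤ) (s : ℝ) {r : ℝ}
    (hr : fiberLength L z r ≠ 0) :
    magPhase β z (fiberMode β L z n) (s + L, r) =
      magPhase β z (fiberMode β L z n) (s, r) + n * (2 * Real.pi) := by
  have h : fiberMode β L z n r * fiberLength L z r = 2 * Real.pi * n - fiberFlux β L z r :=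
    div_mul_cancel₀ _ hr
  simp only [magPhase, hz.sweep_add, hz.turning_add, hz.periodic_tangentialPart s]
  simp only [fiberLength, fiberFlux] at h
  linear_combination h

end ArcCurve

/-- All modes share the phase of mode 0 and differ by ordinary Fourier exponentials in the arclength
of the parallel curve. This reduces the magnetic problem on a fibre to Parseval's formula. -/
theorem magPhase_mode (β L : ℝ) (z : ℝ → ℂ) (n : ℤ) (s : ℝ) {r : ℝ} :
    magPhase β z (fiberMode β L z n) (s, r) = magPhase β z (fiberMode β L z 0) (s, r) +
      2 * Real.pi * n * (s - r * turning z s) / fiberLength L z r := by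
  simp only [magPhase, fiberMode]
  push_cast
  ring

theorem exists_Icc_of_tsupport_subset_Ioo {χ : ℝ → ℝ} {h : ℝ} (h0 : 0 < h)
    (hc : HasCompactSupport χ) (hs : tsupport χ ⊆ Ioo 0 h) :
    ∃ a b, 0 < a ∧ b < h ∧ ∀ r, r ∉ Icc a b → χ r = 0 := by
  rcases (tsupport χ).eq_empty_or_nonempty with he | hne
  · exact ⟨h / 2, h / 2, by positivity, by linarith, fun r _ =>
      image_eq_zero_of_notMem_tsupport (by rw [he]; exact notMem_empty r)⟩
  · obtain ⟨a, ha, hamin⟩ := hc.exists_isLeast hne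
    obtain ⟨b, hb, hbmax⟩ := hc.exists_isGreatest hne
    refine ⟨a, b, (hs ha).1, (hs hb).2, fun r hr => image_eq_zero_of_notMem_tsupport fun hmem => ?_⟩
    exact hr ⟨hamin hmem, hbmax hmem⟩

namespace TubeWidth

variable {Ω : Set Plane} {L ε h : ℝ} {z : ℝ → ℂ}

theorem fiberLength_pos (hz : TubeWidth Ω L z ε) {r : ℝ} (hr : r ∈ Icc 0 ε) :
    0 < fiberLength L z r := by
  have hL := hz.pos
  have hc := hz.contDiff_curvature.continuous
  have h1 : fiberLength L z r = ∫ s in (0 : ℝ)..L, fermiJac z (s, r) := by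
    have hi : IntervalIntegrable (fun s => r * curvature z s) volume 0 L :=
      (continuous_const.mul hc).intervalIntegrable _ _
    simp only [fermiJac]
    rw [intervalIntegral.integral_sub intervalIntegrable_const hi,
      intervalIntegral.integral_const, intervalIntegral.integral_const_mul]
    simp [fiberLength, turning]
  rw [h1]
  refine intervalIntegral.intervalIntegral_pos_of_pos
    ((hz.contDiff_fermiJac.continuous.comp (by fun_prop)).intervalIntegrable _ _)
    (fun s => hz.fermiJac_pos hr) hL

theorem contDiffAt_fiberMode (hz : TubeWidth Ω L z ε) (β : ℝ) (n : ℤ) {r : ℝ}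
    (hr : r ∈ Icc 0 ε) : ContDiffAt ℝ ∞ (fiberMode β L z n) r := by
  refine ContDiffAt.div ?_ ?_ (hz.fiberLength_pos hr).ne'
  · unfold fiberFlux
    fun_prop
  · unfold fiberLength
    fun_prop

/-- The tangential component of the magnetic gradient, in Fermi coordinates. -/
def magTangential (β : ℝ) (z : ℝ → ℂ) (u : Plane → ℂ) (g : Fin 2 → Plane → ℂ) (p : ℝ × ℝ) : ℂ :=
  (deriv z p.1).re * (g 0 (toPlane (fermiMap z p)) - Complex.I * u (toPlane (fermiMap z p)) *
    (standardPotential β (toPlane (fermiMap z p)) 0 : ℂ)) +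
  (deriv z p.1).im * (g 1 (toPlane (fermiMap z p)) - Complex.I * u (toPlane (fermiMap z p)) *
    (standardPotential β (toPlane (fermiMap z p)) 1 : ℂ))

theorem potential_tangential (hz : ArcCurve L z) (β : ℝ) (p : ℝ × ℝ) :
    (deriv z p.1).re * standardPotential β (toPlane (fermiMap z p)) 0 +
      (deriv z p.1).im * standardPotential β (toPlane (fermiMap z p)) 1 =
      β / 2 * (sweepRate z p.1 - p.2) := by
  have hT := congrArg Complex.re (hz.conj_mul_self p.1)
  simp at hT
  simp [standardPotential, toPlane_zero, toPlane_one, fermiMap, sweepRate]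
  linear_combination (-(β / 2 * p.2)) * hT

theorem magTangential_eq (hz : ArcCurve L z) (β : ℝ) (u : Plane → ℂ) (g : Fin 2 → Plane → ℂ)
    (p : ℝ × ℝ) :
    magTangential β z u g p = ((deriv z p.1).re * g 0 (toPlane (fermiMap z p)) +
      (deriv z p.1).im * g 1 (toPlane (fermiMap z p))) -
      Complex.I * (β / 2 * (sweepRate z p.1 - p.2) : ℝ) * u (toPlane (fermiMap z p)) := by
  rw [← potential_tangential hz β p, magTangential]
  push_cast
  ring

theorem memLp_sub_potential (hΩ : Bornology.IsBounded Ω) {u : Plane → ℂ} {g : Fin 2 → Plane → ℂ}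
    (hu : IsH1WithGradient (innerTube Ω h) u g) (hm : MeasurableSet (innerTube Ω h)) (β : ℝ)
    (j : Fin 2) :
    MemLp (fun x => g j x - Complex.I * u x * (standardPotential β x j : ℂ)) 2
      (volume.restrict (innerTube Ω h)) := by
  refine (hu.gradient_memLp j).sub ?_
  have hc : Continuous fun x : Plane => standardPotential β x j := by
    have h0 : Continuous fun x : Plane => x 0 := (EuclideanSpace.proj 0 : Plane →L[ℝ] ℝ).continuous
    have h1 : Continuous fun x : Plane => x 1 := (EuclideanSpace.proj 1 : Plane →L[ℝ] ℝ).continuous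
    fin_cases j
    · simpa [standardPotential] using h1.const_mul (-(β / 2))
    · simpa [standardPotential] using h0.const_mul (β / 2)
  obtain ⟨C, hC⟩ := hΩ.isCompact_closure.exists_bound_of_continuousOn hc.continuousOn
  have hmeas : AEStronglyMeasurable (fun x => Complex.I * u x * (standardPotential β x j : ℂ))
      (volume.restrict (innerTube Ω h)) :=
    (aestronglyMeasurable_const.mul hu.memLp.1).mul
      (Complex.continuous_ofReal.comp hc).aestronglyMeasurable
  refine hu.memLp.of_le_mul (c := C) hmeas ((ae_restrict_iff' hm).2
    (Eventually.of_forall fun x hx => ?_))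
  rw [norm_mul, norm_mul, Complex.norm_I, one_mul, Complex.norm_real, mul_comm]
  exact mul_le_mul_of_nonneg_right (hC x (subset_closure hx.1)) (norm_nonneg _)

theorem norm_sq_magTangential_le (hz : ArcCurve L z) (β : ℝ) (u : Plane → ℂ)
    (g : Fin 2 → Plane → ℂ) (p : ℝ × ℝ) :
    ‖magTangential β z u g p‖ ^ 2 ≤ ∑ j, ‖g j (toPlane (fermiMap z p)) -
      Complex.I * u (toPlane (fermiMap z p)) *
        (standardPotential β (toPlane (fermiMap z p)) j : ℂ)‖ ^ 2 := by
  rw [Fin.sum_univ_two, magTangential]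
  set a := g 0 (toPlane (fermiMap z p)) - Complex.I * u (toPlane (fermiMap z p)) *
        (standardPotential β (toPlane (fermiMap z p)) 0 : ℂ)
  set b := g 1 (toPlane (fermiMap z p)) - Complex.I * u (toPlane (fermiMap z p)) *
        (standardPotential β (toPlane (fermiMap z p)) 1 : ℂ)
  have hT := congrArg Complex.re (hz.conj_mul_self p.1)
  simp at hT
  have h1 : ‖((deriv z p.1).re : ℂ) * a + (deriv z p.1).im * b‖ ≤
      |(deriv z p.1).re| * ‖a‖ + |(deriv z p.1).im| * ‖b‖ := by
    refine (norm_add_le _ _).trans (le_of_eq ?_)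
    rw [norm_mul, norm_mul, Complex.norm_real, Complex.norm_real, Real.norm_eq_abs,
      Real.norm_eq_abs]
  have h2 := pow_le_pow_left₀ (norm_nonneg _) h1 2
  have h3 : |(deriv z p.1).re| ^ 2 + |(deriv z p.1).im| ^ 2 = 1 := by
    rw [sq_abs, sq_abs]; linarith
  nlinarith [sq_nonneg (|(deriv z p.1).re| * ‖b‖ - |(deriv z p.1).im| * ‖a‖)]

theorem memLp_magTangential (hz : TubeWidth Ω L z ε) (hh : h ≤ ε) {u : Plane → ℂ}
    {g : Fin 2 → Plane → ℂ} (hu : IsH1WithGradient (innerTube Ω h) u g) (β : ℝ) :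
    MemLp (magTangential β z u g) 2 (volume.restrict (cell L h)) := by
  have hTc := hz.contDiff_deriv.continuous
  have hm := measurableSet_innerTube hz.isOpen h
  exact (memLp_mul (k := fun p : ℝ × ℝ => ((deriv z p.1).re : ℂ))
      (Continuous.continuousOn (by fun_prop))
      (hz.memLp_comp_fermi hh (memLp_sub_potential hz.isBounded hu hm β 0))).add
    (memLp_mul (k := fun p : ℝ × ℝ => ((deriv z p.1).im : ℂ))
      (Continuous.continuousOn (by fun_prop))
      (hz.memLp_comp_fermi hh (memLp_sub_potential hz.isBounded hu hm β 1)))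

/-- The density whose fibre integrals express that the Fourier coefficients of the tangential
magnetic derivative are those of `u` times the magnetic frequencies. -/
def modeDensity (β L : ℝ) (z : ℝ → ℂ) (u : Plane → ℂ) (g : Fin 2 → Plane → ℂ) (n : ℤ)
    (p : ℝ × ℝ) : ℂ :=
  fermiJac z p • (Complex.exp (-(magPhase β z (fiberMode β L z n) p : ℂ) * Complex.I) *
    (magTangential β z u g p -
      Complex.I * fiberMode β L z n p.2 * u (toPlane (fermiMap z p))))

theorem continuousOn_fiberMode (hz : TubeWidth Ω L z ε) (hh : h ≤ ε) (β : ℝ) (n : ℤ) :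
    ContinuousOn (fun p : ℝ × ℝ => fiberMode β L z n p.2) (Icc 0 L ×ˢ Icc 0 h) := fun p hp =>
  (ContinuousAt.comp (x := p) (hz.contDiffAt_fiberMode β n
    ⟨hp.2.1, hp.2.2.trans hh⟩).continuousAt continuousAt_snd).continuousWithinAt

theorem continuousOn_magPhase (hz : TubeWidth Ω L z ε) (hh : h ≤ ε) (β : ℝ) (n : ℤ) :
    ContinuousOn (magPhase β z (fiberMode β L z n)) (Icc 0 L ×ˢ Icc 0 h) := fun _ hp =>
  (hz.contDiffAt_magPhase β (hz.contDiffAt_fiberMode β n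
    ⟨hp.2.1, hp.2.2.trans hh⟩)).continuousAt.continuousWithinAt

theorem integrableOn_modeDensity (hz : TubeWidth Ω L z ε) (hh : h ≤ ε) {u : Plane → ℂ}
    {g : Fin 2 → Plane → ℂ} (hu : IsH1WithGradient (innerTube Ω h) u g) (β : ℝ) (n : ℤ) :
    IntegrableOn (modeDensity β L z u g n) (cell L h) := by
  have hfin : IsFiniteMeasure (volume.restrict (cell L h)) :=
    ⟨by rw [Measure.restrict_apply_univ]; exact volume_cell_lt_top L h⟩
  have hv : IntegrableOn (magTangential β z u g) (cell L h) :=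
    (hz.memLp_magTangential hh hu β).integrable (by norm_num)
  have hU := hz.integrableOn_comp_fermi hh (integrableOn_of_memLp hz.isBounded hu.memLp)
  have hm := hz.continuousOn_fiberMode hh β n
  have hP := hz.continuousOn_magPhase hh β n
  refine integrableOn_smul hz.contDiff_fermiJac.continuous.continuousOn
    (integrableOn_mul ?_ (hv.sub (integrableOn_mul ?_ hU)))
  · exact (((Complex.continuous_ofReal.comp_continuousOn hP).neg).mul continuousOn_const).cexp
  · exact continuousOn_const.mul (Complex.continuous_ofReal.comp_continuousOn hm)

/-- The weak tangential derivative is tested with χ(r) exp(-i · phase), whose s-derivative is the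
test function times -iJ (tangential potential + m). The potential term completes the tangential
derivative of u to the magnetic one. -/
theorem integral_cutoff_smul_modeDensity (hz : TubeWidth Ω L z ε) (h0 : 0 < h) (hh : h ≤ ε)
    {u : Plane → ℂ} {g : Fin 2 → Plane → ℂ} (hu : IsH1WithGradient (innerTube Ω h) u g) (β : ℝ)
    (n : ℤ) {χ : ℝ → ℝ} (hχ : ContDiff ℝ ∞ χ) (hχc : HasCompactSupport χ)
    (hχs : tsupport χ ⊆ Ioo 0 h) :
    ∫ p in cell L h, χ p.2 • modeDensity β L z u g n p = 0 := by
  obtain ⟨a, b, ha, hb, hab⟩ := exists_Icc_of_tsupport_subset_Ioo h0 hχc hχs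
  set P := magPhase β z (fiberMode β L z n) with hP
  set Ψ : ℝ × ℝ → ℂ := fun p => χ p.2 * Complex.exp (-(P p : ℂ) * Complex.I) with hΨ
  have hsupp : ∀ p : ℝ × ℝ, p.2 ∉ Icc a b → Ψ p = 0 := fun p hp => by
    simp [hΨ, hab _ hp]
  have hΨs : ContDiff ℝ ∞ Ψ := by
    rw [contDiff_iff_contDiffAt]
    intro p
    by_cases hp : p.2 ∈ Icc a b
    · have h1 : ContDiffAt ℝ ∞ P p := hz.contDiffAt_magPhase β (hz.contDiffAt_fiberMode β n
        ⟨ha.le.trans hp.1, (hp.2.trans hb.le).trans hh⟩)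
      have h2 : ContDiffAt ℝ ∞ (fun p => (P p : ℂ)) p := Complex.ofRealCLM.contDiff.contDiffAt.comp p h1
      have h3 : ContDiffAt ℝ ∞ (fun p : ℝ × ℝ => (χ p.2 : ℂ)) p :=
        (Complex.ofRealCLM.contDiff.comp (hχ.comp contDiff_snd)).contDiffAt
      exact h3.mul ((h2.neg.mul contDiffAt_const).cexp)
    · have hz0 : Ψ =ᶠ[𝓝 p] fun _ => 0 := by
        filter_upwards [(isClosed_Icc.preimage continuous_snd).isOpen_compl.mem_nhds hp] with q hq
        exact hsupp q hq
      exact contDiffAt_const.congr_of_eventuallyEq hz0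
  -- On the support the phase grows by 2πn over a period; elsewhere `fiberLength` may vanish, but
  -- the test function is zero there.
  have hper : ∀ s r, Ψ (s + L, r) = Ψ (s, r) := by
    intro s r
    by_cases hr : r ∈ Icc a b
    · have hne := (hz.fiberLength_pos (r := r)
        ⟨ha.le.trans hr.1, (hr.2.trans hb.le).trans hh⟩).ne'
      simp only [hΨ, hP, hz.magPhase_add β n s hne]
      congr 1
      rw [Complex.exp_eq_exp_iff_exists_int]
      exact ⟨-n, by push_cast; ring⟩
    · rw [hsupp _ hr, hsupp _ hr]
  have hw := hz.weak_tangential hh hu hΨs hper ha hb hsupp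
  have hder : ∀ p ∈ cell L h, fderiv ℝ Ψ p (1, 0) =
      -Complex.I * (fermiJac z p * (β / 2 * (sweepRate z p.1 - p.2) + fiberMode β L z n p.2) : ℝ) *
        Ψ p := by
    rintro ⟨s, r⟩ hp
    have hd : HasFDerivAt Ψ (fderiv ℝ Ψ (s, r)) (s, r) :=
      (hΨs.differentiable (by simp) (s, r)).hasFDerivAt
    have h1 : HasDerivAt (fun s => Ψ (s, r)) (fderiv ℝ Ψ (s, r) (1, 0)) s :=
      HasFDerivAt.comp_hasDerivAt (f := fun s : ℝ => (s, r)) s hd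
        ((hasDerivAt_id' s).prodMk (hasDerivAt_const s r))
    have h2 := (((hz.hasDerivAt_magPhase β (fiberMode β L z n) s r).ofReal_comp.neg.mul_const
      Complex.I).cexp).const_mul (χ r : ℂ)
    rw [h1.unique h2]
    simp only [hΨ, hP, Pi.neg_apply]
    ring
  have hfin : IsFiniteMeasure (volume.restrict (cell L h)) :=
    ⟨by rw [Measure.restrict_apply_univ]; exact volume_cell_lt_top L h⟩
  have hU := hz.integrableOn_comp_fermi hh (integrableOn_of_memLp hz.isBounded hu.memLp)
  have hG : ∀ j, IntegrableOn (fun p => g j (toPlane (fermiMap z p))) (cell L h) := fun j =>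
    hz.integrableOn_comp_fermi hh (integrableOn_of_memLp hz.isBounded (hu.gradient_memLp j))
  have hTc := hz.contDiff_deriv.continuous
  have hΨc := hΨs.continuous
  have hG' : IntegrableOn (fun p : ℝ × ℝ => ((deriv z p.1).re : ℂ) * g 0 (toPlane (fermiMap z p)) +
      (deriv z p.1).im * g 1 (toPlane (fermiMap z p))) (cell L h) :=
    (integrableOn_mul (k := fun p : ℝ × ℝ => ((deriv z p.1).re : ℂ))
      (Continuous.continuousOn (by fun_prop)) (hG 0)).add
    (integrableOn_mul (k := fun p : ℝ × ℝ => ((deriv z p.1).im : ℂ))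
      (Continuous.continuousOn (by fun_prop)) (hG 1))
  have hdc : Continuous fun p => fderiv ℝ Ψ p (1, 0) :=
    (hΨs.continuous_fderiv (by simp)).clm_apply continuous_const
  have i1 : IntegrableOn (fun p => u (toPlane (fermiMap z p)) * fderiv ℝ Ψ p (1, 0))
      (cell L h) := by
    have := integrableOn_mul hdc.continuousOn hU
    simpa only [mul_comm] using this
  have i2 : IntegrableOn (fun p => fermiJac z p • (((deriv z p.1).re * g 0 (toPlane (fermiMap z p)) +
        (deriv z p.1).im * g 1 (toPlane (fermiMap z p))) * Ψ p)) (cell L h) := by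
    refine integrableOn_smul hz.contDiff_fermiJac.continuous.continuousOn ?_
    have := integrableOn_mul hΨc.continuousOn hG'
    simpa only [mul_comm] using this
  have hsum : ∫ p in cell L h, (u (toPlane (fermiMap z p)) * fderiv ℝ Ψ p (1, 0) +
      fermiJac z p • (((deriv z p.1).re * g 0 (toPlane (fermiMap z p)) +
        (deriv z p.1).im * g 1 (toPlane (fermiMap z p))) * Ψ p)) = 0 := by
    rw [integral_add i1 i2, hw, neg_add_cancel]
  rw [← hsum]
  refine setIntegral_congr_fun (measurableSet_cell L h) fun p hp => ?_
  rw [hder p hp, modeDensity, magTangential_eq hz.toArcCurve]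
  simp only [hΨ, hP, Complex.real_smul]
  push_cast
  ring

/-- Fubini turns the preceding identity into the vanishing of the fibre integral against every test
function of r, and the fundamental lemma of the calculus of variations applies. -/
theorem ae_fiber_modeDensity (hz : TubeWidth Ω L z ε) (h0 : 0 < h) (hh : h ≤ ε)
    {u : Plane → ℂ} {g : Fin 2 → Plane → ℂ} (hu : IsH1WithGradient (innerTube Ω h) u g) (β : ℝ)
    (n : ℤ) :
    ∀ᵐ r, r ∈ Ioo 0 h → ∫ s in Ioc 0 L, modeDensity β L z u g n (s, r) = 0 := by
  have hint := hz.integrableOn_modeDensity hh hu β n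
  have hint' : Integrable (modeDensity β L z u g n)
      ((volume.restrict (Ioc 0 L)).prod (volume.restrict (Ioo 0 h))) := by
    rw [Measure.prod_restrict]; exact hint
  refine isOpen_Ioo.ae_eq_zero_of_integral_contDiff_smul_eq_zero
    (IntegrableOn.locallyIntegrableOn hint'.integral_prod_right) fun χ hχ hχc hχs => ?_
  have h1 := hz.integral_cutoff_smul_modeDensity h0 hh hu β n hχ hχc hχs
  obtain ⟨C, hC⟩ := hχ.continuous.bounded_above_of_compact_support hχc
  have hint2 : Integrable (fun p : ℝ × ℝ => χ p.2 • modeDensity β L z u g n p)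
      ((volume.restrict (Ioc 0 L)).prod (volume.restrict (Ioo 0 h))) :=
    Integrable.bdd_smul (𝕜 := ℝ) hint' C (hχ.continuous.comp continuous_snd).aestronglyMeasurable
      (Eventually.of_forall fun p => hC p.2)
  rw [cell, Measure.volume_eq_prod, ← Measure.prod_restrict, integral_prod_symm _ hint2] at h1
  simp only [integral_smul] at h1
  rw [← setIntegral_eq_integral_of_forall_compl_eq_zero (s := Ioo 0 h)]
  · exact h1
  · intro r hr
    rw [image_eq_zero_of_notMem_tsupport fun hmem => hr (hχs hmem), zero_smul]

/-- A lower bound for the magnetic frequencies of all parallel curves is a lower bound for the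
magnetic energy. -/
theorem mul_sqNormL2_le_magneticEnergy (hz : TubeWidth Ω L z ε) (h0 : 0 < h) (hh : h ≤ ε)
    {β lam : ℝ} (hlam : ∀ n : ℤ, ∀ r ∈ Ioo 0 h, lam ≤ fiberMode β L z n r ^ 2)
    {u : Plane → ℂ} {g : Fin 2 → Plane → ℂ} (hu : IsH1WithGradient (innerTube Ω h) u g) :
    lam * sqNormL2 (innerTube Ω h) u ≤ magneticEnergy (innerTube Ω h) β u g := by
  set U : ℝ × ℝ → ℂ := fun p => u (toPlane (fermiMap z p)) with hU
  set V : ℝ × ℝ → ℂ := magTangential β z u g with hV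
  have hUm : MemLp U 2 (volume.restrict (cell L h)) := hz.memLp_comp_fermi hh hu.memLp
  have hVm : MemLp V 2 (volume.restrict (cell L h)) := hz.memLp_magTangential hh hu β
  have hfin : IsFiniteMeasure (volume.restrict (cell L h)) :=
    ⟨by rw [Measure.restrict_apply_univ]; exact volume_cell_lt_top L h⟩
  have hJc := hz.contDiff_fermiJac.continuous
  have hm := measurableSet_innerTube hz.isOpen h
  have hprod : ∀ {f : ℝ × ℝ → ℂ}, IntegrableOn f (cell L h) → Integrable f
      ((volume.restrict (Ioc 0 L)).prod (volume.restrict (Ioo 0 h))) := fun hf => by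
    rw [Measure.prod_restrict]; exact hf
  have hprodR : ∀ {f : ℝ × ℝ → ℝ}, IntegrableOn f (cell L h) → Integrable f
      ((volume.restrict (Ioc 0 L)).prod (volume.restrict (Ioo 0 h))) := fun hf => by
    rw [Measure.prod_restrict]; exact hf
  have hfib : ∀ {f : ℝ × ℝ → ℂ}, MemLp f 2 (volume.restrict (cell L h)) →
      ∀ᵐ r ∂(volume.restrict (Ioo 0 h)), MemLp (fun s => f (s, r)) 2
        (volume.restrict (Ioc 0 L)) := by
    intro f hf
    filter_upwards [(hprod (hf.integrable (by norm_num))).prod_left_ae,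
      (hprodR ((memLp_two_iff_integrable_sq_norm hf.1).1 hf)).prod_left_ae] with r h1 h2
    exact (memLp_two_iff_integrable_sq_norm h1.aestronglyMeasurable).2 h2
  have hJU : IntegrableOn (fun p => fermiJac z p • ‖U p‖ ^ 2) (cell L h) :=
    integrableOn_smul hJc.continuousOn ((memLp_two_iff_integrable_sq_norm hUm.1).1 hUm)
  have hJV : IntegrableOn (fun p => fermiJac z p • ‖V p‖ ^ 2) (cell L h) :=
    integrableOn_smul hJc.continuousOn ((memLp_two_iff_integrable_sq_norm hVm.1).1 hVm)
  -- There are countably many frequencies, so one null set of r serves for all n.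
  have hmode : ∀ᵐ r ∂(volume.restrict (Ioo 0 h)), ∀ n : ℤ,
      ∫ s in Ioc 0 L, modeDensity β L z u g n (s, r) = 0 := by
    rw [ae_all_iff]
    exact fun n => (ae_restrict_iff' measurableSet_Ioo).2 (hz.ae_fiber_modeDensity h0 hh hu β n)
  have hfiber : ∀ᵐ r ∂(volume.restrict (Ioo 0 h)),
      lam * ∫ s in Ioc 0 L, fermiJac z (s, r) • ‖U (s, r)‖ ^ 2 ≤
        ∫ s in Ioc 0 L, fermiJac z (s, r) • ‖V (s, r)‖ ^ 2 := by
    filter_upwards [hmode, hfib hUm, hfib hVm, ae_restrict_mem measurableSet_Ioo] with r hr hUr hVr hrm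
    have hrε : r ∈ Icc 0 ε := ⟨hrm.1.le, hrm.2.le.trans hh⟩
    have hl : ∀ s, HasDerivAt (fun s => s - r * turning z s) (fermiJac z (s, r)) s := fun s =>
      (hasDerivAt_id' s).sub ((hz.hasDerivAt_turning s).const_mul r)
    have hJr : Continuous fun s => fermiJac z (s, r) := hJc.comp (by fun_prop)
    -- The common unimodular factor of all modes. Multiplying by it preserves the norms on the fibre
    -- and turns magnetic coefficients into Fourier coefficients.
    set e : ℝ → ℂ := fun s =>
      Complex.exp (-(magPhase β z (fiberMode β L z 0) (s, r) : ℂ) * Complex.I) with he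
    have hec : Continuous e := by
      have : Continuous fun s => magPhase β z (fiberMode β L z 0) (s, r) :=
        continuous_iff_continuousAt.2 fun s => (hz.hasDerivAt_magPhase β _ s r).continuousAt
      fun_prop
    have hen : ∀ s, ‖e s‖ = 1 := fun s => by
      simp only [he]
      rw [← Complex.ofReal_neg, Complex.norm_exp_ofReal_mul_I]
    have hmemE : ∀ {f : ℝ → ℂ}, MemLp f 2 (volume.restrict (Ioc 0 L)) →
        MemLp (fun s => e s * f s) 2 (volume.restrict (Ioc 0 L)) := by
      intro f hf
      exact hf.of_le (hec.aestronglyMeasurable.mul hf.1)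
        (Eventually.of_forall fun s => by rw [norm_mul, hen, one_mul])
    have hw := weighted_norm_le_of_coeff_le (lam := lam) hz.pos hl hJr
      (fun s => hz.fermiJac_pos hrε) (by simp [ArcCurve.turning_zero]) (hmemE hUr) (hmemE hVr) fun n => ?_
    · simpa only [norm_mul, hen, one_mul] using hw
    have hrn := hr n
    have hexp : ∀ s, Complex.exp (-(magPhase β z (fiberMode β L z n) (s, r) : ℂ) * Complex.I) =
        Complex.exp (-(2 * Real.pi * n * (s - r * turning z s) / (L - r * turning z L) : ℝ) *
          Complex.I) * e s := by
      intro s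
      rw [magPhase_mode β L z n s, he, ← Complex.exp_add, fiberLength]
      congr 1
      push_cast
      ring
    have hbdd : ∀ {f : ℝ → ℂ}, MemLp f 2 (volume.restrict (Ioc 0 L)) →
        IntegrableOn (fun s => fermiJac z (s, r) • (Complex.exp
          (-(2 * Real.pi * n * (s - r * turning z s) / (L - r * turning z L) : ℝ) * Complex.I) *
            (e s * f s))) (Ioc 0 L) := by
      intro f hf
      have hphc : Continuous fun s => Complex.exp
          (-(2 * Real.pi * n * (s - r * turning z s) / (L - r * turning z L) : ℝ) * Complex.I) := by
        have := hz.contDiff_turning.continuous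
        fun_prop
      obtain ⟨C, hC⟩ := isCompact_Icc.exists_bound_of_continuousOn (s := Icc 0 L) hJr.continuousOn
      refine Integrable.bdd_smul (𝕜 := ℝ) ?_ C hJr.aestronglyMeasurable
        ((ae_restrict_iff' measurableSet_Ioc).2 (Eventually.of_forall fun s hs =>
          hC s (Ioc_subset_Icc_self hs)))
      refine Integrable.bdd_mul (c := 1) ((hmemE hf).integrable (by norm_num))
        hphc.aestronglyMeasurable (Eventually.of_forall fun s => ?_)
      rw [← Complex.ofReal_neg, Complex.norm_exp_ofReal_mul_I]
    -- The vanishing fibre integral of `modeDensity` says that the n-th coefficient of V is i ·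
    -- `fiberMode` times that of U.
    have hcoef : ∫ s in Ioc 0 L, fermiJac z (s, r) • (Complex.exp
          (-(2 * Real.pi * n * (s - r * turning z s) / (L - r * turning z L) : ℝ) * Complex.I) *
            (e s * V (s, r))) =
        Complex.I * fiberMode β L z n r * ∫ s in Ioc 0 L, fermiJac z (s, r) • (Complex.exp
          (-(2 * Real.pi * n * (s - r * turning z s) / (L - r * turning z L) : ℝ) * Complex.I) *
            (e s * U (s, r))) := by
      rw [← sub_eq_zero, ← integral_const_mul, ← integral_sub (hbdd hVr) ((hbdd hUr).const_mul _),
        ← hrn]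
      refine integral_congr_ae (Eventually.of_forall fun s => ?_)
      simp only [modeDensity, hexp, hU, hV, Complex.real_smul]
      ring
    rw [hcoef, norm_mul, mul_pow, norm_mul, Complex.norm_I, one_mul, Complex.norm_real,
      Real.norm_eq_abs, sq_abs]
    exact mul_le_mul_of_nonneg_right (hlam n r hrm) (by positivity)
  have hE : ∫ p in cell L h, fermiJac z p • ‖V p‖ ^ 2 ≤ magneticEnergy (innerTube Ω h) β u g := by
    rw [magneticEnergy, hz.setIntegral_innerTube hh]
    refine setIntegral_mono_on hJV ((hz.integrableOn_innerTube_iff hh (fun x => ∑ j,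
      ‖g j x - Complex.I * u x * (standardPotential β x j : ℂ)‖ ^ 2)).1 ?_)
      (measurableSet_cell L h) fun p hp => ?_
    · refine integrable_finsetSum _ fun j _ => ?_
      have := memLp_sub_potential hz.isBounded hu hm β j
      exact (memLp_two_iff_integrable_sq_norm this.1).1 this
    · exact smul_le_smul_of_nonneg_left (norm_sq_magTangential_le hz.toArcCurve β u g p)
        (hz.fermiJac_pos ⟨hp.2.1.le, hp.2.2.le.trans hh⟩).le
  refine le_trans ?_ hE
  rw [sqNormL2, hz.setIntegral_innerTube hh, cell, Measure.volume_eq_prod,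
    ← Measure.prod_restrict, integral_prod_symm _ (hprodR hJU), integral_prod_symm _ (hprodR hJV),
    ← integral_const_mul]
  exact integral_mono_ae ((hprodR hJU).integral_prod_right.const_mul lam)
    (hprodR hJV).integral_prod_right hfiber

end TubeWidth

/-! ### Smooth functions as elements of the Sobolev space -/

theorem isOpen_innerTube {Ω : Set Plane} (hΩ : IsOpen Ω) (h : ℝ) : IsOpen (innerTube Ω h) :=
  hΩ.inter (isOpen_lt (Metric.continuous_infDist_pt _) continuous_const)

/-- The product uφ, extended by zero, is smooth with compact support in the whole plane, so the
integral of its derivative vanishes; the product rule splits it into the two sides. -/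
theorem isWeakPartial_fderiv {W : Set Plane} (hW : IsOpen W) {u : Plane → ℂ}
    (hu : ContDiffOn ℝ ∞ u W) (j : Fin 2) :
    IsWeakPartial W j u (fun x => fderiv ℝ u x (EuclideanSpace.single j 1)) := by
  intro φ hφ hφc hφs
  set v : Plane := EuclideanSpace.single j 1 with hv
  set F : Plane → ℂ := fun x => u x * (φ x : ℂ) with hF
  have hφ' : ContDiff ℝ ∞ fun x => (φ x : ℂ) := Complex.ofRealCLM.contDiff.comp hφ
  have hFs : ContDiff ℝ ∞ F := by
    rw [contDiff_iff_contDiffAt]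
    intro x
    by_cases hx : x ∈ tsupport φ
    · exact (hu.contDiffAt (hW.mem_nhds (hφs hx))).mul hφ'.contDiffAt
    · have h0 : F =ᶠ[𝓝 x] fun _ => 0 := by
        filter_upwards [(isClosed_tsupport _).isOpen_compl.mem_nhds hx] with y hy
        simp [hF, image_eq_zero_of_notMem_tsupport hy]
      exact contDiffAt_const.congr_of_eventuallyEq h0
  have hFc : HasCompactSupport F := (hφc.comp_left (g := fun t : ℝ => (t : ℂ)) (by simp)).mul_left
  have hdF : Continuous fun x => fderiv ℝ F x v :=
    (hFs.continuous_fderiv (by simp)).clm_apply continuous_const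
  have hdFc : HasCompactSupport fun x => fderiv ℝ F x v := hFc.fderiv_apply ℝ _
  have htot : ∫ x, fderiv ℝ F x v = 0 := by
    have := integral_mul_fderiv_eq_neg_fderiv_mul_of_integrable (μ := volume) (f := F)
      (g := fun _ => (1 : ℂ)) (v := v) (by simpa using hdF.integrable_of_hasCompactSupport hdFc)
      (by simp)
      (by simpa using hFs.continuous.integrable_of_hasCompactSupport hFc)
      (fun x _ => hFs.differentiable (by simp) x) (fun x _ => differentiableAt_const _)
    simpa using this
  have hset : ∫ x in W, fderiv ℝ F x v = 0 := by
    rw [setIntegral_eq_integral_of_forall_compl_eq_zero, htot]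
    intro x hx
    have h0 : F =ᶠ[𝓝 x] fun _ => 0 := by
      filter_upwards [(isClosed_tsupport φ).isOpen_compl.mem_nhds fun h => hx (hφs h)] with y hy
      simp [hF, image_eq_zero_of_notMem_tsupport hy]
    rw [h0.fderiv_eq]
    simp
  have hps : Continuous fun x => (partialDeriv j φ x : ℂ) :=
    Complex.continuous_ofReal.comp ((hφ.continuous_fderiv (by simp)).clm_apply continuous_const)
  have i1 : IntegrableOn (fun x => u x * (partialDeriv j φ x : ℂ)) W := by
    refine IntegrableOn.of_forall_sdiff_eq_zero (s := tsupport φ) ?_ hW.measurableSet ?_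
    · exact ((hu.continuousOn.mono hφs).mul hps.continuousOn).integrableOn_compact hφc
    · intro x hx
      have : fderiv ℝ φ x = 0 := image_eq_zero_of_notMem_tsupport
        fun h => hx.2 (tsupport_fderiv_subset ℝ h)
      simp [partialDeriv, this]
  have hd : ∀ x ∈ W, fderiv ℝ F x v =
      u x * (partialDeriv j φ x : ℂ) + fderiv ℝ u x v * (φ x : ℂ) := by
    intro x hx
    have h1 : HasFDerivAt u (fderiv ℝ u x) x :=
      ((hu.contDiffAt (hW.mem_nhds hx)).differentiableAt (by simp)).hasFDerivAt
    have h2 : HasFDerivAt (fun x => (φ x : ℂ)) (Complex.ofRealCLM.comp (fderiv ℝ φ x)) x :=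
      HasFDerivAt.comp x Complex.ofRealCLM.hasFDerivAt
        (hφ.differentiable (by simp) x).hasFDerivAt
    have h3 : HasFDerivAt F _ x := h1.mul h2
    rw [h3.fderiv]
    simp [partialDeriv, mul_comm, hv]
  have i2 : IntegrableOn (fun x => fderiv ℝ u x v * (φ x : ℂ)) W := by
    have := (hdF.integrable_of_hasCompactSupport hdFc).integrableOn (s := W) |>.sub i1
    refine this.congr_fun (fun x hx => ?_) hW.measurableSet
    simp only [Pi.sub_apply]
    rw [hd x hx, add_sub_cancel_left]
  rw [eq_neg_iff_add_eq_zero, ← integral_add i1 i2, ← hset]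
  exact setIntegral_congr_fun hW.measurableSet fun x hx => (hd x hx).symm

theorem isH1WithGradient_of_contDiffOn {W : Set Plane} (hW : IsOpen W) (hfin : volume W < ⊤)
    {u : Plane → ℂ} (hu : ContDiffOn ℝ ∞ u W) {C : ℝ} (hC : ∀ x ∈ W, ‖u x‖ ≤ C)
    (hC' : ∀ x ∈ W, ∀ j, ‖fderiv ℝ u x (EuclideanSpace.single j 1)‖ ≤ C) :
    IsH1WithGradient W u fun j x => fderiv ℝ u x (EuclideanSpace.single j 1) := by
  have : IsFiniteMeasure (volume.restrict W) :=
    ⟨by rw [Measure.restrict_apply_univ]; exact hfin⟩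
  refine ⟨?_, fun j => ?_, isWeakPartial_fderiv hW hu⟩
  · exact MemLp.of_bound (hu.continuousOn.aestronglyMeasurable hW.measurableSet) C
      ((ae_restrict_iff' hW.measurableSet).2 (Eventually.of_forall hC))
  · refine MemLp.of_bound (ContinuousOn.aestronglyMeasurable
      ((hu.continuousOn_fderiv_of_isOpen hW (by simp)).clm_apply continuousOn_const)
      hW.measurableSet) C
      ((ae_restrict_iff' hW.measurableSet).2 (Eventually.of_forall fun x hx => hC' x hx j))

theorem magneticEnergy_nonneg (W : Set Plane) (β : ℝ) (u : Plane → ℂ) (g : Fin 2 → Plane → ℂ) :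
    0 ≤ magneticEnergy W β u g :=
  integral_nonneg fun _ => Finset.sum_nonneg fun _ _ => sq_nonneg _

theorem nonneg_of_mem_rayleighQuotients {W : Set Plane} {β q : ℝ}
    (hq : q ∈ rayleighQuotients W β) : 0 ≤ q := by
  obtain ⟨u, g, -, hpos, rfl⟩ := hq
  exact div_nonneg (magneticEnergy_nonneg W β u g) hpos.le

theorem magneticLambda1_nonneg (W : Set Plane) (β : ℝ) : 0 ≤ magneticLambda1 W β :=
  Real.sInf_nonneg fun _ => nonneg_of_mem_rayleighQuotients

theorem rayleighQuotients_nonempty {W : Set Plane} (hW : IsOpen W) (hfin : volume W < ⊤)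
    (hpos : 0 < volume.real W) (β : ℝ) : (rayleighQuotients W β).Nonempty := by
  refine ⟨_, fun _ => 1, _, isH1WithGradient_of_contDiffOn (C := 1) hW hfin contDiffOn_const
    (by simp) (by simp), ?_, rfl⟩
  simpa [sqNormL2] using hpos

/-! ### Distance to the integers -/

theorem iInf_int_sub_sq (x : ℝ) : ⨅ n : ℤ, ((n : ℝ) - x) ^ 2 = |x - round x| ^ 2 := by
  refine le_antisymm ?_ (le_ciInf fun n => ?_)
  · have hb : BddBelow (range fun n : ℤ => ((n : ℝ) - x) ^ 2) :=
      ⟨0, by rintro _ ⟨n, rfl⟩; positivity⟩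
    refine (ciInf_le hb (round x)).trans (le_of_eq ?_)
    rw [sq_abs]; ring
  · rw [← sq_abs ((n : ℝ) - x), abs_sub_comm (n : ℝ) x]
    exact pow_le_pow_left₀ (abs_nonneg _) (round_le x n) 2

/-- With x = n - Φ the numerator is 2π(x + δ), where 2πδ is the flux lost between Γ and the parallel
curve, and the denominator is at most L because K ≥ 0. Since |x| ≥ d, the square (x + δ)² is at
least d² - 2dδ, and the term 2dδ produces the loss. -/
theorem frequency_sq_ge {L a K β r h d n : ℝ} (hL : 0 < L) (hK : 0 ≤ K)
    (hβ : 0 < β) (hr : 0 < r) (hrh : r < h) (hΛ : 0 < L - r * K)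
    (hiso : 4 * Real.pi * a ≤ L ^ 2) (hd0 : 0 ≤ d) (hdn : d ≤ |β * a / (2 * Real.pi) - n|)
    (hdΦ : d ≤ β * a / (2 * Real.pi)) (hd2 : d ≤ 1 / 2) :
    4 * Real.pi ^ 2 / L ^ 2 * d ^ 2 - β * Real.sqrt β * h ≤
      ((2 * Real.pi * n - β / 2 * (2 * a - 2 * r * L + r ^ 2 * K)) / (L - r * K)) ^ 2 := by
  have hπ := Real.pi_pos
  set δ := β * (2 * r * L - r ^ 2 * K) / (4 * Real.pi) with hδ
  have hrK : 0 ≤ r * K := by positivity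
  have hδ0 : 0 ≤ δ := by
    have : 0 ≤ 2 * r * L - r ^ 2 * K := by nlinarith
    positivity
  have hδL : δ ≤ β * r * L / (2 * Real.pi) := by
    rw [hδ, div_le_div_iff₀ (by positivity) (by positivity)]
    have : 0 ≤ β * (r * (r * K)) * Real.pi := by positivity
    nlinarith
  have hnum : 2 * Real.pi * n - β / 2 * (2 * a - 2 * r * L + r ^ 2 * K) =
      2 * Real.pi * (n - β * a / (2 * Real.pi) + δ) := by
    rw [hδ]; field_simp; ring
  set x := n - β * a / (2 * Real.pi) with hx
  have hdx : d ≤ |x| := by rwa [hx, abs_sub_comm]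
  have hsq : d ^ 2 - 2 * d * δ ≤ (x + δ) ^ 2 := by
    -- If d ≤ δ, the left side d(d - 2δ) is nonpositive; otherwise the bound |x + δ| ≥ d - δ ≥ 0 can
    -- be squared.
    rcases le_total d δ with hle | hle
    · nlinarith [sq_nonneg (x + δ)]
    · have h1 : d - δ ≤ |x + δ| := by
        have := abs_sub (x + δ) δ
        rw [add_sub_cancel_right, abs_of_nonneg hδ0] at this
        linarith
      have h2 := pow_le_pow_left₀ (sub_nonneg.2 hle) h1 2
      rw [sq_abs] at h2
      nlinarith [sq_nonneg δ]
  -- From d ≤ Φ and d ≤ 1/2 one has d² ≤ Φ/2 = βa/(4π), and the isoperimetric inequality bounds 4πa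
  -- by L². This is the source of the power 3/2 of β.
  have hd4 : 4 * Real.pi * d ≤ Real.sqrt β * L := by
    refine abs_le_of_sq_le_sq' ?_ (by positivity) |>.2
    rw [mul_pow, mul_pow (Real.sqrt β), Real.sq_sqrt hβ.le]
    have h1 : d ^ 2 ≤ β * a / (2 * Real.pi) * (1 / 2) := by
      rw [sq]; exact mul_le_mul hdΦ hd2 hd0 (hd0.trans hdΦ)
    calc (4 * Real.pi) ^ 2 * d ^ 2 ≤ (4 * Real.pi) ^ 2 * (β * a / (2 * Real.pi) * (1 / 2)) := by
          gcongr
      _ = β * (4 * Real.pi * a) := by field_simp; ring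
      _ ≤ β * L ^ 2 := by gcongr
  have hloss : 4 * Real.pi ^ 2 / L ^ 2 * (2 * d * δ) ≤ β * Real.sqrt β * h := by
    calc 4 * Real.pi ^ 2 / L ^ 2 * (2 * d * δ)
        ≤ 4 * Real.pi ^ 2 / L ^ 2 * (2 * d * (β * r * L / (2 * Real.pi))) := by gcongr
      _ = β * r * (4 * Real.pi * d) / L := by field_simp
      _ ≤ β * r * (Real.sqrt β * L) / L := by gcongr
      _ = β * Real.sqrt β * r := by field_simp
      _ ≤ β * Real.sqrt β * h := by gcongr
  have hmain : 4 * Real.pi ^ 2 / L ^ 2 * (x + δ) ^ 2 ≤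
      (2 * Real.pi * (x + δ) / (L - r * K)) ^ 2 := by
    rw [div_pow, mul_pow, mul_pow, div_mul_eq_mul_div]
    have h1 : (L - r * K) ^ 2 ≤ L ^ 2 := pow_le_pow_left₀ hΛ.le (by linarith) 2
    have h2 : (2 : ℝ) ^ 2 * Real.pi ^ 2 = 4 * Real.pi ^ 2 := by norm_num
    rw [h2]
    gcongr
  have h3 : 4 * Real.pi ^ 2 / L ^ 2 * (d ^ 2 - 2 * d * δ) ≤
      4 * Real.pi ^ 2 / L ^ 2 * (x + δ) ^ 2 := by gcongr
  rw [hnum]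
  refine le_trans ?_ hmain
  linarith [mul_sub (4 * Real.pi ^ 2 / L ^ 2) (d ^ 2) (2 * d * δ)]

/-! ### The gauge transformation for integral flux -/

/-- The phase of the test function for integral flux. -/
def gaugePhase (β : ℝ) (z : ℝ → ℂ) (p : ℝ × ℝ) : ℝ :=
  β / 2 * (sweep z p.1 + p.2 * tangentialPart z p.1)

namespace ArcCurve

variable {L : ℝ} {z : ℝ → ℂ}

theorem contDiff_gaugePhase (hz : ArcCurve L z) (β : ℝ) : ContDiff ℝ ∞ (gaugePhase β z) :=
  contDiff_const.mul ((hz.contDiff_sweep.comp contDiff_fst).add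
    (contDiff_snd.mul (hz.contDiff_tangentialPart.comp contDiff_fst)))

/-- The r-derivative of the phase is exactly the normal component of the potential. The s-derivative
is J times the tangential component, up to the error (β/2) r (1 + J), which is small in a thin tube.
-/
theorem fderiv_exp_gaugePhase (hz : ArcCurve L z) (β : ℝ) (p : ℝ × ℝ) :
    fderiv ℝ (fun p => Complex.exp (gaugePhase β z p * Complex.I)) p (1, 0) =
      Complex.exp (gaugePhase β z p * Complex.I) *
        ((fermiJac z p * (β / 2 * (sweepRate z p.1 - p.2)) +
          β / 2 * (p.2 * (1 + fermiJac z p)) : ℝ) * Complex.I) ∧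
    fderiv ℝ (fun p => Complex.exp (gaugePhase β z p * Complex.I)) p (0, 1) =
      Complex.exp (gaugePhase β z p * Complex.I) *
        ((β / 2 * tangentialPart z p.1 : ℝ) * Complex.I) := by
  obtain ⟨s, r⟩ := p
  have hsm : ContDiff ℝ ∞ fun p => Complex.exp (gaugePhase β z p * Complex.I) :=
    ((Complex.ofRealCLM.contDiff.comp (hz.contDiff_gaugePhase β)).mul contDiff_const).cexp
  have hd := (hsm.differentiable (by simp) (s, r)).hasFDerivAt
  constructor
  · have h1 := HasFDerivAt.comp_hasDerivAt (f := fun s : ℝ => (s, r)) s hd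
      ((hasDerivAt_id' s).prodMk (hasDerivAt_const s r))
    have h2 : HasDerivAt (fun s => gaugePhase β z (s, r)) _ s :=
      ((hz.hasDerivAt_sweep s).add ((hz.hasDerivAt_tangentialPart s).const_mul r)).const_mul (β / 2)
    refine (h1.unique (h2.ofReal_comp.mul_const Complex.I).cexp).trans ?_
    congr 3
    simp only [fermiJac]
    ring
  · have h1 := HasFDerivAt.comp_hasDerivAt (f := fun r : ℝ => (s, r)) r hd
      ((hasDerivAt_const r s).prodMk (hasDerivAt_id' r))
    have h2 : HasDerivAt (fun r => gaugePhase β z (s, r)) _ r :=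
      (((hasDerivAt_id' r).mul_const (tangentialPart z s)).const_add (sweep z s)).const_mul (β / 2)
    refine (h1.unique (h2.ofReal_comp.mul_const Complex.I).cexp).trans ?_
    congr 3
    ring

theorem potential_components (hz : ArcCurve L z) (β : ℝ) (p : ℝ × ℝ) :
    standardPotential β (toPlane (fermiMap z p)) 0 =
      (deriv z p.1).re * (β / 2 * (sweepRate z p.1 - p.2)) -
        (deriv z p.1).im * (β / 2 * tangentialPart z p.1) ∧
    standardPotential β (toPlane (fermiMap z p)) 1 =
      (deriv z p.1).im * (β / 2 * (sweepRate z p.1 - p.2)) +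
        (deriv z p.1).re * (β / 2 * tangentialPart z p.1) := by
  have hT := congrArg Complex.re (hz.conj_mul_self p.1)
  simp at hT
  constructor
  · simp [standardPotential, toPlane_one, fermiMap, sweepRate, tangentialPart]
    linear_combination (β / 2 * (z p.1).im) * hT
  · simp [standardPotential, toPlane_zero, fermiMap, sweepRate, tangentialPart]
    linear_combination (-(β / 2 * (z p.1).re)) * hT

end ArcCurve

/-! ### Bounds and limits for the first eigenvalue of the tube -/

namespace TubeWidth

variable {Ω : Set Plane} {L ε h β : ℝ} {z : ℝ → ℂ}

theorem le_fiberMode_sq (hz : TubeWidth Ω L z ε) (hh : h ≤ ε) (hβ : 0 < β) (n : ℤ) {r : ℝ}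
    (hr : r ∈ Ioo 0 h) :
    4 * Real.pi ^ 2 / L ^ 2 * (⨅ n : ℤ, ((n : ℝ) - magneticFlux Ω β) ^ 2) - β * Real.sqrt β * h ≤
      fiberMode β L z n r ^ 2 := by
  have hΛ := hz.fiberLength_pos (r := r) ⟨hr.1.le, hr.2.le.trans hh⟩
  -- Comparing the nearest integer with 0 shows that the distance d is at most Φ, one of the two
  -- bounds on d needed for the loss term.
  have h0 := round_le (magneticFlux Ω β) 0
  have hΦ0 : 0 ≤ magneticFlux Ω β := by unfold magneticFlux; positivity
  rw [Int.cast_zero, sub_zero, abs_of_nonneg hΦ0] at h0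
  rw [iInf_int_sub_sq, fiberMode, fiberFlux, hz.sweep_eq]
  exact frequency_sq_ge hz.pos hz.turning_nonneg hβ hr.1 hr.2 hΛ hz.isoperimetric
    (abs_nonneg _) (round_le _ n) h0 (abs_sub_round _)

theorem le_magneticLambda1 (hz : TubeWidth Ω L z ε) (h0 : 0 < h) (hh : h ≤ ε) (hβ : 0 < β) :
    4 * Real.pi ^ 2 / L ^ 2 * (⨅ n : ℤ, ((n : ℝ) - magneticFlux Ω β) ^ 2) - β * Real.sqrt β * h ≤
      magneticLambda1 (innerTube Ω h) β := by
  -- Nonemptiness matters because `sInf ∅ = 0`; the constant function 1 provides a quotient.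
  refine le_csInf (rayleighQuotients_nonempty (isOpen_innerTube hz.isOpen h)
    (volume_innerTube_lt_top hz.isBounded h) (hz.volume_innerTube_pos h0 hh) β) ?_
  rintro _ ⟨u, g, hu, hpos, rfl⟩
  rw [le_div_iff₀ hpos]
  exact hz.mul_sqNormL2_le_magneticEnergy h0 hh (fun n r hr => hz.le_fiberMode_sq hh hβ n hr) hu

theorem tendsto_volume_innerTube (hz : TubeWidth Ω L z ε) :
    Tendsto (fun h : ℝ => volume.real (innerTube Ω h)) (𝓝[>] 0) (𝓝 0) := by
  have hc : Tendsto (fun h : ℝ => 3 / 2 * (L * h)) (𝓝[>] 0) (𝓝 0) := by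
    have : Continuous fun h : ℝ => 3 / 2 * (L * h) := by fun_prop
    simpa using (this.tendsto 0).mono_left nhdsWithin_le_nhds
  refine tendsto_of_tendsto_of_tendsto_of_le_of_le' tendsto_const_nhds hc
    (Eventually.of_forall fun h => measureReal_nonneg) ?_
  filter_upwards [Ioo_mem_nhdsGT hz.width_pos] with h hh
  exact hz.volume_innerTube_le hh.1.le hh.2.le

/-- For integral flux the potential is, up to a small error, a gauge transformation. -/
theorem magneticLambda1_le (hz : TubeWidth Ω L z ε) (h0 : 0 < h) (hh : h ≤ ε) (hβ : 0 < β) {n : ℕ}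
    (hn : magneticFlux Ω β = n) :
    magneticLambda1 (innerTube Ω h) β ≤ (5 / 2 * β * h) ^ 2 := by
  set W := innerTube Ω h with hW
  have hWo : IsOpen W := isOpen_innerTube hz.isOpen h
  have hWf : volume W < ⊤ := volume_innerTube_lt_top hz.isBounded h
  set Ψ : ℝ × ℝ → ℂ := fun p => Complex.exp (gaugePhase β z p * Complex.I) with hΨ
  have hΨs : ContDiff ℝ ∞ Ψ :=
    ((Complex.ofRealCLM.contDiff.comp (hz.contDiff_gaugePhase β)).mul contDiff_const).cexp
  -- The phase increases by (β/2) · 2|Ω| = 2πn over one period, by the area formula.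
  have hper : ∀ s r, Ψ (s + L, r) = Ψ (s, r) := by
    intro s r
    simp only [hΨ, gaugePhase, hz.sweep_add, hz.periodic_tangentialPart s, hz.sweep_eq]
    rw [Complex.exp_eq_exp_iff_exists_int]
    refine ⟨n, ?_⟩
    have h1 : β * volume.real Ω = n * (2 * Real.pi) := by
      rwa [magneticFlux, div_eq_iff (by positivity)] at hn
    have h2 := congrArg (fun t : ℝ => (t : ℂ)) h1
    push_cast at h2 ⊢
    linear_combination Complex.I * h2
  set u := fermiLift z ε Ψ with hu
  have hWeq : ∀ x ∈ W, ∃ p : ℝ × ℝ, p.2 ∈ Ioo 0 h ∧ p ∈ fermiStrip ε ∧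
      toPlane (fermiMap z p) = x := by
    intro x hx
    rw [hW, hz.innerTube_eq hh] at hx
    obtain ⟨p, ⟨-, hp⟩, rfl⟩ := hx
    exact ⟨p, hp, ⟨mem_univ _, hp.1, hp.2.trans_le hh⟩, rfl⟩
  have hnorm : ∀ x ∈ W, ‖u x‖ = 1 := by
    intro x hx
    obtain ⟨p, -, hp, rfl⟩ := hWeq x hx
    rw [hu, hz.fermiLift_apply hper hp, hΨ, Complex.norm_exp_ofReal_mul_I]
  have hus : ContDiffOn ℝ ∞ u W := by
    intro x hx
    obtain ⟨p, -, hp, rfl⟩ := hWeq x hx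
    exact (hz.contDiffAt_fermiLift hper hΨs.contDiffOn hp).contDiffWithinAt
  set g : Fin 2 → Plane → ℂ := fun j x => fderiv ℝ u x (EuclideanSpace.single j 1) with hg
  -- The normal components cancel, so the magnetic gradient is the unit tangent t times one scalar
  -- X, and its norm is that of X.
  have hX : ∀ x ∈ W, ∃ (t : Fin 2 → ℝ) (X : ℂ), t 0 ^ 2 + t 1 ^ 2 = 1 ∧ ‖X‖ ≤ 5 / 2 * β * h ∧
      ∀ j, g j x - Complex.I * u x * (standardPotential β x j : ℂ) = t j * X := by
    intro x hx
    obtain ⟨p, hpr, hp, rfl⟩ := hWeq x hx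
    have hud : DifferentiableAt ℝ u (toPlane (fermiMap z p)) :=
      (hz.contDiffAt_fermiLift hper hΨs.contDiffOn hp).differentiableAt (by simp)
    obtain ⟨e0, e1⟩ := hz.fderiv_single_of_fermi hp hud (hz.eventually_fermiLift hper hp)
    obtain ⟨d0, d1⟩ := hz.fderiv_exp_gaugePhase β p
    obtain ⟨a0, a1⟩ := hz.potential_components β p
    have hJ0 : 0 < fermiJac z p := hz.fermiJac_pos ⟨hp.2.1.le, hp.2.2.le⟩
    have hJ1 := hz.half_le_fermiJac (p := p) ⟨hp.2.1.le, hp.2.2.le⟩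
    have hT := congrArg Complex.re (hz.conj_mul_self p.1)
    simp at hT
    have hJc : (fermiJac z p : ℂ) ≠ 0 := by exact_mod_cast hJ0.ne'
    have huv : u (toPlane (fermiMap z p)) = Complex.exp (gaugePhase β z p * Complex.I) :=
      hz.fermiLift_apply hper hp
    refine ⟨![(deriv z p.1).re, (deriv z p.1).im],
      Complex.I * Complex.exp (gaugePhase β z p * Complex.I) *
        (β / 2 * (p.2 * (1 + fermiJac z p)) / fermiJac z p : ℝ), ?_, ?_, ?_⟩
    · simp only [Matrix.cons_val_zero, Matrix.cons_val_one]
      linarith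
    · have hp2 := hpr.1
      rw [norm_mul, norm_mul, Complex.norm_I, Complex.norm_exp_ofReal_mul_I, one_mul, one_mul,
        Complex.norm_real, Real.norm_eq_abs, abs_of_nonneg (by positivity), div_le_iff₀ hJ0]
      have h1 : p.2 * (1 + fermiJac z p) ≤ h * (1 + fermiJac z p) := by
        gcongr; exact hpr.2.le
      -- Since J ≥ 1/2, the ratio (1 + J)/J is at most 3, which bounds X by (3/2)βh; the constant
      -- 5/2 leaves room.
      have h2 : 1 + fermiJac z p ≤ 3 * fermiJac z p := by linarith
      calc β / 2 * (p.2 * (1 + fermiJac z p)) ≤ β / 2 * (h * (3 * fermiJac z p)) := by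
            refine mul_le_mul_of_nonneg_left (h1.trans ?_) (by positivity)
            exact mul_le_mul_of_nonneg_left h2 h0.le
        _ ≤ 5 / 2 * β * h * fermiJac z p := by
            have : 0 < β * h * fermiJac z p := by positivity
            nlinarith
    · rw [Fin.forall_fin_two]
      simp only [hg]
      rw [e0, e1, d0, d1, huv, a0, a1]
      simp only [Matrix.cons_val_zero, Matrix.cons_val_one, Complex.real_smul]
      push_cast
      constructor
      · field_simp
        ring
      · field_simp
        ring
  have hmag : ∀ x ∈ W, ∀ j, ‖g j x - Complex.I * u x * (standardPotential β x j : ℂ)‖ ≤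
      5 / 2 * β * h := by
    intro x hx j
    obtain ⟨t, X, ht, hXn, hj⟩ := hX x hx
    rw [hj, norm_mul, Complex.norm_real, Real.norm_eq_abs]
    have : |t j| ≤ 1 := by
      rw [← sq_le_one_iff_abs_le_one]
      fin_cases j
      · exact (by linarith [sq_nonneg (t 1)] : t 0 ^ 2 ≤ 1)
      · exact (by linarith [sq_nonneg (t 0)] : t 1 ^ 2 ≤ 1)
    calc |t j| * ‖X‖ ≤ 1 * ‖X‖ := by gcongr
      _ ≤ _ := by rwa [one_mul]
  obtain ⟨M, hM⟩ := hz.isBounded.exists_norm_le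
  have hA : ∀ x ∈ W, ∀ j, |standardPotential β x j| ≤ β / 2 * M := by
    intro x hx j
    have hxM := hM x hx.1
    have h1 : ∀ i, |x i| ≤ M := fun i => (PiLp.norm_apply_le x i).trans hxM
    have hb : |β / 2| = β / 2 := abs_of_pos (by positivity)
    fin_cases j
    · simp only [standardPotential, Fin.zero_eta, Matrix.cons_val_zero, abs_mul, abs_neg, hb]
      exact mul_le_mul_of_nonneg_left (h1 1) (by positivity)
    · simp only [standardPotential, Fin.mk_one, Matrix.cons_val_one, Matrix.cons_val_fin_one,
        abs_mul, hb]
      exact mul_le_mul_of_nonneg_left (h1 0) (by positivity)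
  have hgb : ∀ x ∈ W, ∀ j, ‖g j x‖ ≤ 5 / 2 * β * h + β / 2 * M := by
    intro x hx j
    have h1 : g j x = (g j x - Complex.I * u x * (standardPotential β x j : ℂ)) +
      Complex.I * u x * (standardPotential β x j : ℂ) := by ring
    rw [h1]
    refine (norm_add_le _ _).trans (add_le_add (hmag x hx j) ?_)
    rw [norm_mul, norm_mul, Complex.norm_I, hnorm x hx, one_mul, one_mul, Complex.norm_real,
      Real.norm_eq_abs]
    exact hA x hx j
  have hH1 : IsH1WithGradient W u g :=
    isH1WithGradient_of_contDiffOn hWo hWf hus (C := max 1 (5 / 2 * β * h + β / 2 * M))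
      (fun x hx => (hnorm x hx).le.trans (le_max_left _ _))
      (fun x hx j => (hgb x hx j).trans (le_max_right _ _))
  have hvol : 0 < volume.real W := hz.volume_innerTube_pos h0 hh
  have hsq : sqNormL2 W u = volume.real W := by
    rw [sqNormL2, setIntegral_congr_fun (g := fun _ => (1 : ℝ)) hWo.measurableSet
      fun x hx => by simp only [hnorm x hx, one_pow]]
    simp
  have hE : magneticEnergy W β u g ≤ (5 / 2 * β * h) ^ 2 * volume.real W := by
    rw [magneticEnergy]
    refine (Real.le_norm_self _).trans (norm_setIntegral_le_of_norm_le_const hWf fun x hx => ?_)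
    obtain ⟨t, X, ht, hXn, hj⟩ := hX x hx
    rw [Real.norm_eq_abs, abs_of_nonneg (Finset.sum_nonneg fun _ _ => sq_nonneg _),
      Fin.sum_univ_two, hj, hj, norm_mul, norm_mul, mul_pow, mul_pow, ← add_mul,
      Complex.norm_real, Complex.norm_real, Real.norm_eq_abs, Real.norm_eq_abs, sq_abs, sq_abs, ht,
      one_mul]
    exact pow_le_pow_left₀ (norm_nonneg _) hXn 2
  refine (csInf_le ⟨0, fun q hq => nonneg_of_mem_rayleighQuotients hq⟩
    ⟨u, g, hH1, by rw [hsq]; exact hvol, rfl⟩).trans ?_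
  rw [hsq, div_le_iff₀ hvol]
  exact hE

theorem tendsto_magneticLambda1 (hz : TubeWidth Ω L z ε) (hβ : 0 < β)
    (hn : ∃ n : ℕ, magneticFlux Ω β = n) :
    Tendsto (fun h : ℝ => magneticLambda1 (innerTube Ω h) β) (𝓝[>] 0) (𝓝 0) := by
  obtain ⟨n, hn⟩ := hn
  have hc : Tendsto (fun h : ℝ => (5 / 2 * β * h) ^ 2) (𝓝[>] 0) (𝓝 0) := by
    have : Continuous fun h : ℝ => (5 / 2 * β * h) ^ 2 := by fun_prop
    simpa using (this.tendsto 0).mono_left nhdsWithin_le_nhds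
  refine tendsto_of_tendsto_of_tendsto_of_le_of_le' tendsto_const_nhds hc
    (Eventually.of_forall fun h => magneticLambda1_nonneg _ _) ?_
  filter_upwards [Ioo_mem_nhdsGT hz.width_pos] with h hh
  exact hz.magneticLambda1_le hh.1 hh.2.le hβ hn

theorem exists_pos_le_magneticLambda1 (hz : TubeWidth Ω L z ε) (hβ : 0 < β)
    (hn : ¬ ∃ n : ℕ, magneticFlux Ω β = n) :
    ∃ c : ℝ, 0 < c ∧ ∀ᶠ h in 𝓝[>] (0 : ℝ), c ≤ magneticLambda1 (innerTube Ω h) β := by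
  set D := 4 * Real.pi ^ 2 / L ^ 2 * (⨅ n : ℤ, ((n : ℝ) - magneticFlux Ω β) ^ 2) with hD
  have hL := hz.pos
  have hD0 : 0 < D := by
    rw [hD, iInf_int_sub_sq]
    -- The flux is nonnegative, so if it equalled its nearest integer it would be a natural number.
    have hne : magneticFlux Ω β - round (magneticFlux Ω β) ≠ 0 := by
      intro h0
      have hΦ0 : 0 ≤ magneticFlux Ω β := by unfold magneticFlux; positivity
      have h1 : magneticFlux Ω β = (round (magneticFlux Ω β) : ℤ) := sub_eq_zero.1 h0
      have h2 : 0 ≤ round (magneticFlux Ω β) := by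
        rw [h1] at hΦ0
        exact_mod_cast hΦ0
      obtain ⟨k, hk⟩ := Int.eq_ofNat_of_zero_le h2
      exact hn ⟨k, by rw [h1, hk]; simp⟩
    have := abs_pos.2 hne
    positivity
  refine ⟨D / 2, by positivity, ?_⟩
  have hc : Tendsto (fun h : ℝ => D - β * Real.sqrt β * h) (𝓝[>] 0) (𝓝 D) := by
    have : Continuous fun h : ℝ => D - β * Real.sqrt β * h := by fun_prop
    simpa using (this.tendsto 0).mono_left nhdsWithin_le_nhds
  filter_upwards [Ioo_mem_nhdsGT hz.width_pos, hc.eventually_const_le (half_lt_self hD0)]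
    with h hh hh2
  exact hh2.trans (hz.le_magneticLambda1 hh.1 hh.2.le hβ)

end TubeWidth

end

theorem mainTheorem9 (Ω : Set Plane) (γ : ℝ → Plane)
    (hΩ : IsSmoothBoundedDomain Ω) (hγ : IsSimpleClosedCurve γ)
    (hΓ : frontier Ω = Set.range γ) :
    -- 1) lower bound for non-integral flux; `ε₀` depends on `Ω` only
    (∃ ε₀ : ℝ, 0 < ε₀ ∧ ∀ β : ℝ, 0 < β → (¬ ∃ n : ℕ, magneticFlux Ω β = n) →
      ∀ h ∈ Set.Ioo (0 : ℝ) ε₀,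
        4 * Real.pi ^ 2 / curveLength γ ^ 2 * (⨅ n : ℤ, ((n : ℝ) - magneticFlux Ω β) ^ 2)
            - β * Real.sqrt β * h
          ≤ magneticLambda1 (innerTube Ω h) β) ∧
    -- in that case the area tends to zero, but the first eigenvalue stays away from zero
    Tendsto (fun h : ℝ => volume.real (innerTube Ω h)) (𝓝[>] 0) (𝓝 0) ∧
    (∀ β : ℝ, 0 < β → (¬ ∃ n : ℕ, magneticFlux Ω β = n) →
      ∃ c : ℝ, 0 < c ∧ ∀ᶠ h in 𝓝[>] (0 : ℝ), c ≤ magneticLambda1 (innerTube Ω h) β) ∧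
    -- 2) integral flux
    (∀ β : ℝ, 0 < β → (∃ n : ℕ, magneticFlux Ω β = n) →
      Tendsto (fun h : ℝ => magneticLambda1 (innerTube Ω h) β) (𝓝[>] 0) (𝓝 0)) ∧
    -- in particular
    (∀ β : ℝ, 0 < β →
      (Tendsto (fun h : ℝ => magneticLambda1 (innerTube Ω h) β) (𝓝[>] 0) (𝓝 0) ↔
        ∃ n : ℕ, magneticFlux Ω β = n)) := by
  obtain ⟨z, hz⟩ := hΩ.exists_boundaryCurve hγ hΓ
  obtain ⟨ε, hε⟩ := hz.exists_tubeWidth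
  -- The width ε was fixed by the boundary curve before β is introduced, so it serves for every β.
  refine ⟨⟨ε, hε.width_pos, fun β hβ _ h hh => hε.le_magneticLambda1 hh.1 hh.2.le hβ⟩,
    hε.tendsto_volume_innerTube, fun β hβ hn => hε.exists_pos_le_magneticLambda1 hβ hn,
    fun β hβ hn => hε.tendsto_magneticLambda1 hβ hn, fun β hβ => ⟨fun ht => ?_,
      hε.tendsto_magneticLambda1 hβ⟩⟩
  by_contra hn
  obtain ⟨c, hc, hev⟩ := hε.exists_pos_le_magneticLambda1 hβ hn
  exact absurd (ge_of_tendsto ht hev) (not_le.2 hc)
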